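/- Let $m\ge 0$ and $\alpha,\beta\in\mathbb R$, and consider the cubic nonlinear Dirac system in $1+1$ dimensions for complex-valued $u(t,x),v(t,x)$, $$ i(u_t+u_x)=-mv+\partial_{\bar u}W(u,v),\qquad i(v_t-v_x)=-mu+\partial_{\bar v}W(u,v),\tag{1}$$ with initial condition $(u,v)|_{t=0}=(u_0,v_0)$, where $$W(u,v)=\alpha|u|^2|v|^2+\beta(\bar u v+u\bar v)^2$$ and $\partial_{\bar z}=\tfrac12(\partial_a+i\partial_b)$ for $z=a+ib$. (The case $\alpha=1,\beta=0$ is the massive Thirring model and $\alpha=0,\beta=\tfrac14$ the massive Gross–Neveu model.) For $T>0$, a classical solution of (1) on $\mathbb R\times[0,T]$ is a pair of $C^1$ functions on $\mathbb R\times[0,T]$ (up to the boundary) satisfying (1) pointwise. A pair $(u,v)$ with $u,v\in C([0,\infty);L^2(\mathbb R))$ is a strong solution on $\mathbb R\times[0,T]$ with data $(u_0,v_0)$ if there is a sequence of classical solutions $(u^{(n)},v^{(n)})$ of (1) on $\mathbb R\times[0,T]$ such that, as $n\to\infty$, $(u^{(n)},v^{(n)})\to(u,v)$ in $L^2(\mathbb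 R\times[0,T])$ and $(u^{(n)},v^{(n)})|_{t=0}\to(u_0,v_0)$ in $L^2(\mathbb R)$. It is a global strong solution if this holds for every $T>0$ (the sequence may depend on $T$). Theorem. For every $u_0,v_0\in L^2(\mathbb R)$ there is exactly one global strong solution $(u,v)$, $u,v\in C([0,\infty);L^2(\mathbb R))$, with data $(u_0,v_0)$. It satisfies $(u,v)(0)=(u_0,v_0)$ and, for every $T>0$, $|u||v|\in L^2([0,T]\times\mathbb R)$. -/

import Mathlib

open MeasureTheory Filter Topology Set
open scoped NNReal ENNReal ComplexConjugate

noncomputable section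

namespace Dirac

/-- The Wirtinger derivative `∂f/∂z̄ = (∂f/∂x + i ∂f/∂y) / 2` of `f : ℂ → ℂ` at `z = x + i y`. -/
def dbar (f : ℂ → ℂ) (z : ℂ) : ℂ :=
  (1 / 2) * (fderiv ℝ f z 1 + Complex.I * fderiv ℝ f z Complex.I)

/-- The potential `W(u, v) = α |u|² |v|² + β (ū v + u v̄)²`. -/
def W (α β : ℝ) (u v : ℂ) : ℂ :=
  (α : ℂ) * (‖u‖ : ℂ) ^ 2 * (‖v‖ : ℂ) ^ 2 + (β : ℂ) * (conj u * v + u * conj v) ^ 2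

/-- The nonlinearity `N₁ = ∂W/∂ū`. -/
def N₁ (α β : ℝ) (u v : ℂ) : ℂ := dbar (fun z => W α β z v) u

/-- The nonlinearity `N₂ = ∂W/∂v̄`. -/
def N₂ (α β : ℝ) (u v : ℂ) : ℂ := dbar (fun z => W α β u z) v

/-- The closed space-time strip `0 ≤ t ≤ T`, `x ∈ ℝ`; a point is written `(t, x)`. -/
def strip (T : ℝ) : Set (ℝ × ℝ) := Icc 0 T ×ˢ univ

/-- `(u, v)` is a classical solution of the Dirac system on the strip `0 ≤ t ≤ T`: both functions
`u t x`, `v t x` are `C¹` there (up to the boundary) and satisfy the equations pointwise, the time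
derivatives at `t = 0` and `t = T` being one-sided. Values outside the strip play no role. -/
structure IsClassicalSolution (m α β T : ℝ) (u v : ℝ → ℝ → ℂ) : Prop where
  contDiffOn_fst : ContDiffOn ℝ 1 (fun p : ℝ × ℝ => u p.1 p.2) (strip T)
  contDiffOn_snd : ContDiffOn ℝ 1 (fun p : ℝ × ℝ => v p.1 p.2) (strip T)
  eq_fst : ∀ t ∈ Icc 0 T, ∀ x : ℝ,
    Complex.I * (derivWithin (fun s => u s x) (Icc 0 T) t + deriv (fun y => u t y) x)
      = -(m : ℂ) * v t x + N₁ α β (u t x) (v t x)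
  eq_snd : ∀ t ∈ Icc 0 T, ∀ x : ℝ,
    Complex.I * (derivWithin (fun s => v s x) (Icc 0 T) t - deriv (fun y => v t y) x)
      = -(m : ℂ) * u t x + N₂ α β (u t x) (v t x)

/-- The complex space `L²(ℝ)`. -/
abbrev L2 : Type := Lp ℂ 2 (volume : Measure ℝ)

/-- `f` is a measurable function of `(t, x)` representing the curve `u ∈ C([0,∞); L²(ℝ))`, that is,
`f(t, ·) = u(t)` almost everywhere, for almost every `t ≥ 0`. Two such `f` agree almost everywhere
on the half plane `t ≥ 0`. -/
def IsVersion (u : C(ℝ≥0, L2)) (f : ℝ × ℝ → ℂ) : Prop :=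
  AEStronglyMeasurable f (volume.restrict (Ici 0 ×ˢ univ)) ∧
    ∀ᵐ t : ℝ, ∀ ht : 0 ≤ t, (fun x => f (t, x)) =ᵐ[volume] (u ⟨t, ht⟩ : ℝ → ℂ)

/-- `(u, v) ∈ C([0,∞); L²(ℝ))` is a strong solution on `ℝ × [0,T]` with data `(u₀, v₀)`: there are
classical solutions on `ℝ × [0,T]` converging to `(u, v)` in `L²(ℝ × [0,T])` whose values at `t = 0`
converge to `(u₀, v₀)` in `L²(ℝ)`. -/
def IsStrongSolutionOn (m α β T : ℝ) (u₀ v₀ : L2) (u v : C(ℝ≥0, L2)) : Prop :=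
  ∃ f g : ℝ × ℝ → ℂ, IsVersion u f ∧ IsVersion v g ∧
    ∃ U V : ℕ → ℝ → ℝ → ℂ,
      (∀ n, IsClassicalSolution m α β T (U n) (V n)) ∧
      Tendsto (fun n => eLpNorm (fun p : ℝ × ℝ => U n p.1 p.2 - f p) 2
        (volume.restrict (strip T))) atTop (𝓝 0) ∧
      Tendsto (fun n => eLpNorm (fun p : ℝ × ℝ => V n p.1 p.2 - g p) 2
        (volume.restrict (strip T))) atTop (𝓝 0) ∧
      Tendsto (fun n => eLpNorm (fun x : ℝ => U n 0 x - u₀ x) 2 volume) atTop (𝓝 0) ∧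
      Tendsto (fun n => eLpNorm (fun x : ℝ => V n 0 x - v₀ x) 2 volume) atTop (𝓝 0)

/-- A global strong solution is a strong solution on `ℝ × [0,T]` for every `T > 0`. -/
def IsGlobalStrongSolution (m α β : ℝ) (u₀ v₀ : L2) (u v : C(ℝ≥0, L2)) : Prop :=
  ∀ T : ℝ, 0 < T → IsStrongSolutionOn m α β T u₀ v₀ u v

/-- `|u| |v| ∈ L²([0,T] × ℝ)`. -/
def ProductMemL2 (T : ℝ) (u v : C(ℝ≥0, L2)) : Prop :=
  ∃ f g : ℝ × ℝ → ℂ, IsVersion u f ∧ IsVersion v g ∧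
    MemLp (fun p : ℝ × ℝ => ‖f p‖ * ‖g p‖) 2 (volume.restrict (strip T))

end Dirac

end

namespace Dirac

/-! The density |u|² moves to the right, |v|² to the left, and the right-hand sides only exchange
charge: in Re(ū · rhs) the α-term disappears and the rest is antisymmetric in (u, v) (`inner_rhs`,
`inner_rhs_add`). Integration between right-moving characteristics shows that the charge does not
grow and that the flux ∫ |v(s, x+s)|² ds through each such characteristic is at most the initial
charge L (`flux_le`). Along it |u|² grows at rate at most 1 + 4|β||v|² with forcing m²|v|², so
Gronwall gives |u(t,x)|² ≤ K (|u₀(x-t)|² + m²L), where K depends only on T, β and L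
(`pointwise_le`). Reflection gives the same for v with x+t.

For two solutions, |u-u'|² is amplified by |v|² + |v'|², which the charge does not bound pointwise.
By the previous estimate this coefficient is at most a constant plus a function of x+t with
controlled integral; for |v-v'|² it is a constant plus a function of x-t. With P and Q these
functions, the weight e^{-Mt} exp(-∫₀^{x+t} Q) exp(∫₀^{x-t} P) decreases along both families of
characteristics fast enough to absorb the amplification, and it is bounded above and below in terms
of the charge (`weighted_energy`). A cutoff in x+t makes decay at infinity unnecessary, which
matters because classical solutions are not assumed to decay. The result is Lipschitz dependence in
L² with a constant depending only on m, α, β, T and L (`stability`).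

Smooth compactly supported data have classical solutions on every [0, T]: truncate the nonlinearity
by a real factor in [0, 1] and iterate. The a priori bounds hold for the truncated system
independently of the truncation, so a large truncation is never felt (`exists_classicalSolution`).
By stability, solutions with data approaching (u₀, v₀) are Cauchy in L² locally uniformly in time,
which gives existence; comparing two approximating sequences gives uniqueness. The bound on |u||v|
follows from the pointwise bound for u, the flux bound for v, and Fatou (`lintegral_product_le`,
`lintegral_strip_mul_le_of_tendsto`). -/

/-! ### The nonlinearity in explicit form -/

/-- With one argument frozen, `W` has this form in the other one, so a single computation serves
both `N₁` and `N₂`. -/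
theorem hasFDerivAt_sq_norm_mul (c : ℝ) (v z : ℂ) (β : ℝ) :
    HasFDerivAt (fun z : ℂ => (c : ℂ) * (conj z * z) + (β : ℂ) * (conj z * v + z * conj v) ^ 2)
      ((c : ℂ) • (conj z • ContinuousLinearMap.id ℝ ℂ + z • Complex.conjCLE.toContinuousLinearMap)
        + (2 * (β : ℂ) * (conj z * v + z * conj v)) •
          (v • Complex.conjCLE.toContinuousLinearMap + conj v • ContinuousLinearMap.id ℝ ℂ)) z := by
  have hc : HasFDerivAt (fun z : ℂ => conj z) Complex.conjCLE.toContinuousLinearMap z :=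
    Complex.conjCLE.hasFDerivAt
  have hi : HasFDerivAt (fun z : ℂ => z) (ContinuousLinearMap.id ℝ ℂ) z := hasFDerivAt_id z
  have h1 := (hc.mul hi).const_mul (c : ℂ)
  have h2 := ((((hc.mul_const v).add (hi.mul_const (conj v))).pow 2)).const_mul (β : ℂ)
  refine (h1.add h2).congr_fderiv ?_
  ext
  · simp; ring

theorem dbar_sq_norm_mul (c : ℝ) (v z : ℂ) (β : ℝ) :
    dbar (fun z : ℂ => (c : ℂ) * (conj z * z) + (β : ℂ) * (conj z * v + z * conj v) ^ 2) z
      = c * z + 2 * β * (conj z * v + z * conj v) * v := by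
  rw [dbar, (hasFDerivAt_sq_norm_mul c v z β).fderiv]
  simp
  linear_combination ((c : ℂ) / 2 * (conj z - z) + β * (conj z * v + z * conj v) * (conj v - v)) * Complex.I_sq

theorem N₁_eq (α β : ℝ) (u v : ℂ) :
    N₁ α β u v = α * (v * conj v) * u + 2 * β * (conj u * v + u * conj v) * v := by
  have : (fun z => W α β z v) = fun z : ℂ =>
      ((α * ‖v‖ ^ 2 : ℝ) : ℂ) * (conj z * z) + (β : ℂ) * (conj z * v + z * conj v) ^ 2 := by
    funext z
    simp only [W, Complex.conj_mul']
    push_cast; ring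
  rw [N₁, this, dbar_sq_norm_mul, Complex.mul_conj']
  push_cast; ring

theorem N₂_eq (α β : ℝ) (u v : ℂ) :
    N₂ α β u v = α * (u * conj u) * v + 2 * β * (conj u * v + u * conj v) * u := by
  have : (fun z => W α β u z) = fun z : ℂ =>
      ((α * ‖u‖ ^ 2 : ℝ) : ℂ) * (conj z * z) + (β : ℂ) * (conj z * u + z * conj u) ^ 2 := by
    funext z
    simp only [W, Complex.conj_mul']
    push_cast; ring
  rw [N₂, this, dbar_sq_norm_mul, Complex.mul_conj']
  push_cast; ring

/-! ### Functions on the strip and their derivatives along characteristics -/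

/-- Differentiation under the integral sign for continuously differentiable integrands. -/
theorem hasDerivAt_intervalIntegral_param {E : Type*} [NormedAddCommGroup E] [NormedSpace ℝ E]
    {F F' : ℝ → ℝ → E} {U : Set ℝ} (hU : IsOpen U) {a b : ℝ}
    (hF : ∀ t ∈ U, ∀ x, HasDerivAt (fun t => F t x) (F' t x) t)
    (cF : ContinuousOn (fun p : ℝ × ℝ => F p.1 p.2) (U ×ˢ univ))
    (cF' : ContinuousOn (fun p : ℝ × ℝ => F' p.1 p.2) (U ×ˢ univ)) {t : ℝ} (ht : t ∈ U) :
    HasDerivAt (fun t => ∫ x in a..b, F t x) (∫ x in a..b, F' t x) t := by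
  obtain ⟨ε, hε, hb⟩ := Metric.isOpen_iff.1 hU t ht
  have hK : Metric.closedBall t (ε / 2) ⊆ U :=
    (Metric.closedBall_subset_ball (by linarith)).trans hb
  have sec : ∀ {G : ℝ → ℝ → E}, ContinuousOn (fun p : ℝ × ℝ => G p.1 p.2) (U ×ˢ univ) →
      ∀ s ∈ U, Continuous (G s) := fun {G} hG s hs =>
    continuousOn_univ.1 (hG.comp (f := fun x => (s, x)) (by fun_prop) fun x _ => ⟨hs, mem_univ _⟩)
  obtain ⟨C, hC⟩ := ((isCompact_closedBall t (ε / 2)).prod (isCompact_uIcc (a := a) (b := b))).exists_bound_of_continuousOn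
    (cF'.mono (prod_mono hK (subset_univ _)))
  refine (intervalIntegral.hasDerivAt_integral_of_dominated_loc_of_deriv_le
    (s := Metric.closedBall t (ε / 2)) (bound := fun _ => C) (F' := F')
    (Metric.closedBall_mem_nhds t (by linarith)) ?_ ?_ ?_ ?_ ?_ ?_).2
  · filter_upwards [hU.mem_nhds ht] with s hs
    exact (sec cF s hs).aestronglyMeasurable
  · exact (sec cF t ht).intervalIntegrable _ _
  · exact (sec cF' t ht).aestronglyMeasurable
  · exact ae_of_all _ fun x hx s hs => hC (s, x) ⟨hs, uIoc_subset_uIcc hx⟩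
  · exact intervalIntegrable_const
  · exact ae_of_all _ fun x _ s hs => hF s (hK hs) x

/-- The open space-time strip `0 < t < T`. -/
def openStrip (T : ℝ) : Set (ℝ × ℝ) := Ioo 0 T ×ˢ univ

theorem isOpen_openStrip (T : ℝ) : IsOpen (openStrip T) := isOpen_Ioo.prod isOpen_univ

/-- Functions continuous on the closed strip and continuously differentiable in its interior. -/
structure IsC1Strip {E : Type*} [NormedAddCommGroup E] [NormedSpace ℝ E] (T : ℝ)
    (f : ℝ × ℝ → E) : Prop where
  continuousOn : ContinuousOn f (strip T)
  contDiffOn : ContDiffOn ℝ 1 f (openStrip T)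

/-- The projection of the real line onto `[0, T]`. -/
def clamp (T s : ℝ) : ℝ := max 0 (min s T)

theorem continuous_clamp (T : ℝ) : Continuous (clamp T) := by unfold clamp; fun_prop

theorem clamp_mem {T : ℝ} (hT : 0 ≤ T) (s : ℝ) : clamp T s ∈ Icc 0 T :=
  ⟨le_max_left _ _, max_le hT (min_le_right _ _)⟩

theorem clamp_of_mem {T s : ℝ} (hs : s ∈ Icc 0 T) : clamp T s = s := by
  rw [clamp, min_eq_left hs.2, max_eq_right hs.1]

namespace IsC1Strip

variable {E F : Type*} [NormedAddCommGroup E] [NormedSpace ℝ E] [NormedAddCommGroup F]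
  [NormedSpace ℝ F] {T : ℝ} {f : ℝ × ℝ → E}

/-- Freezing time outside [0, T] extends f continuously to the plane, so primitives and parametric
integrals can be treated without boundary cases. -/
theorem continuous_clamp (hf : IsC1Strip T f) (hT : 0 ≤ T) :
    Continuous fun p : ℝ × ℝ => f (clamp T p.1, p.2) := by
  refine hf.continuousOn.comp_continuous ?_ fun p => ⟨clamp_mem hT _, mem_univ _⟩
  have := Dirac.continuous_clamp T
  fun_prop

theorem hasFDerivAt (hf : IsC1Strip T f) {p : ℝ × ℝ} (hp : p ∈ openStrip T) :
    HasFDerivAt f (fderiv ℝ f p) p :=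
  ((hf.contDiffOn.differentiableOn one_ne_zero).differentiableAt
    ((isOpen_openStrip T).mem_nhds hp)).hasFDerivAt

theorem continuousOn_fderiv (hf : IsC1Strip T f) :
    ContinuousOn (fderiv ℝ f) (openStrip T) :=
  hf.contDiffOn.continuousOn_fderiv_of_isOpen (isOpen_openStrip T) le_rfl

theorem comp_contDiff (hf : IsC1Strip T f) {g : E → F} (hg : ContDiff ℝ 1 g) :
    IsC1Strip T fun p => g (f p) :=
  ⟨hg.continuous.comp_continuousOn hf.continuousOn, hg.comp_contDiffOn hf.contDiffOn⟩

theorem of_contDiff (hf : ContDiff ℝ 1 f) : IsC1Strip T f :=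
  ⟨hf.continuous.continuousOn, hf.contDiffOn⟩

theorem of_contDiffOn (hf : ContDiffOn ℝ 1 f (strip T)) : IsC1Strip T f :=
  ⟨hf.continuousOn, hf.mono (prod_mono Ioo_subset_Icc_self subset_rfl)⟩

theorem add {g : ℝ × ℝ → E} (hf : IsC1Strip T f) (hg : IsC1Strip T g) :
    IsC1Strip T fun p => f p + g p :=
  ⟨hf.1.add hg.1, hf.2.add hg.2⟩

theorem sub {g : ℝ × ℝ → E} (hf : IsC1Strip T f) (hg : IsC1Strip T g) :
    IsC1Strip T fun p => f p - g p :=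
  ⟨hf.1.sub hg.1, hf.2.sub hg.2⟩

theorem mul {f g : ℝ × ℝ → ℝ} (hf : IsC1Strip T f) (hg : IsC1Strip T g) :
    IsC1Strip T fun p => f p * g p :=
  ⟨hf.1.mul hg.1, hf.2.mul hg.2⟩

/-- Derivative along a straight line. -/
theorem hasDerivAt_line (hf : IsC1Strip T f) {c t x : ℝ} (ht : t ∈ Ioo 0 T) :
    HasDerivAt (fun s => f (s, x + c * s)) (fderiv ℝ f (t, x + c * t) (1, c)) t := by
  have h1 : HasDerivAt (fun s : ℝ => (s, x + c * s)) (1, c) t := by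
    have := ((hasDerivAt_id t).const_mul c).const_add x
    exact (hasDerivAt_id t).prodMk (by simpa using this)
  exact (hf.hasFDerivAt (p := (t, x + c * t)) ⟨ht, mem_univ _⟩).comp_hasDerivAt
    (f := fun s : ℝ => (s, x + c * s)) t h1

theorem hasDerivAt_space (hf : IsC1Strip T f) {t x : ℝ} (ht : t ∈ Ioo 0 T) :
    HasDerivAt (fun y => f (t, y)) (fderiv ℝ f (t, x) (0, 1)) x :=
  (hf.hasFDerivAt (p := (t, x)) ⟨ht, mem_univ _⟩).comp_hasDerivAt
    (f := fun y : ℝ => (t, y)) x ((hasDerivAt_const x t).prodMk (hasDerivAt_id x))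

end IsC1Strip

/-! ### Energy estimates in characteristic regions -/

/-- The energy inequality in characteristic form, with the flux through the left boundary. -/
theorem energy_flux {T a b : ℝ} {A B : ℝ × ℝ → ℝ} (hA : IsC1Strip T A) (hB : IsC1Strip T B)
    (hBb : ∀ t ∈ Ioo 0 T, B (t, b + t) = 0)
    (hab : a ≤ b)
    (hle : ∀ p ∈ openStrip T, fderiv ℝ A p (1, 1) + fderiv ℝ B p (1, -1) ≤ 0)
    {t : ℝ} (ht : t ∈ Icc 0 T) :
    (∫ y in a..b, (A (t, y + t) + B (t, y + t))) + 2 * ∫ s in 0..t, B (s, a + s)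
      ≤ ∫ y in a..b, (A (0, y) + B (0, y)) := by
  have hT : 0 ≤ T := ht.1.trans ht.2
  have hAB := hA.add hB
  set φ : ℝ × ℝ → ℝ := fun p => A p + B p with hφ
  have c1 : Continuous fun p : ℝ × ℝ => φ (clamp T p.1, p.2 + p.1) :=
    (hAB.continuous_clamp hT).comp (g := fun p : ℝ × ℝ => φ (clamp T p.1, p.2))
      (f := fun p : ℝ × ℝ => (p.1, p.2 + p.1)) (by fun_prop)
  have c2 : Continuous fun s : ℝ => B (clamp T s, a + s) :=
    (hB.continuous_clamp hT).comp (f := fun s : ℝ => (s, a + s)) (by fun_prop)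
  -- The window [a+t, b+t] moves with A, so A crosses neither end, while B crosses both with
  -- relative speed 2. The second term restores what has left on the left; nothing enters on the
  -- right because of `hBb`.
  set G : ℝ → ℝ := fun t => (∫ y in a..b, φ (clamp T t, y + t)) + 2 * ∫ s in 0..t, B (clamp T s, a + s)
    with hG
  have cG : Continuous G := by
    refine (intervalIntegral.continuous_parametric_intervalIntegral_of_continuous'
      (f := fun t y => φ (clamp T t, y + t)) c1 a b).add ?_
    exact continuous_const.mul (intervalIntegral.continuous_primitive (fun _ _ => c2.intervalIntegrable _ _) 0)
  have dG : ∀ s ∈ Ioo 0 T, HasDerivAt G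
      ((∫ y in a..b, fderiv ℝ φ (s, y + s) (1, 1)) + 2 * B (s, a + s)) s := by
    intro s hs
    refine HasDerivAt.add ?_ (HasDerivAt.const_mul 2 ?_)
    · have := hasDerivAt_intervalIntegral_param (F := fun t y => φ (t, y + t))
        (F' := fun t y => fderiv ℝ φ (t, y + t) (1, 1)) (a := a) (b := b) isOpen_Ioo (fun t ht y => by
          simpa using hAB.hasDerivAt_line (c := 1) (x := y) ht)
        (hAB.contDiffOn.continuousOn.comp (f := fun p : ℝ × ℝ => (p.1, p.2 + p.1)) (by fun_prop)
          fun p hp => ⟨hp.1, mem_univ _⟩)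
        ((hAB.continuousOn_fderiv.comp (f := fun p : ℝ × ℝ => (p.1, p.2 + p.1)) (by fun_prop)
          fun p hp => ⟨hp.1, mem_univ _⟩).clm_apply continuousOn_const) hs
      refine this.congr_of_eventuallyEq ?_
      filter_upwards [isOpen_Ioo.mem_nhds hs] with r hr
      rw [clamp_of_mem (Ioo_subset_Icc_self hr)]
    · have := intervalIntegral.integral_hasDerivAt_right (c2.intervalIntegrable 0 s)
        c2.stronglyMeasurable.stronglyMeasurableAtFilter c2.continuousAt
      rwa [clamp_of_mem (Ioo_subset_Icc_self hs)] at this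
  have hneg : ∀ s ∈ Ioo 0 T,
      (∫ y in a..b, fderiv ℝ φ (s, y + s) (1, 1)) + 2 * B (s, a + s) ≤ 0 := by
    intro s hs
    have cD : ∀ {f : ℝ × ℝ → ℝ} (hf : IsC1Strip T f) (e : ℝ × ℝ),
        Continuous fun y => fderiv ℝ f (s, y + s) e := fun {f} hf e =>
      continuousOn_univ.1 ((hf.continuousOn_fderiv.comp (f := fun y : ℝ => (s, y + s))
        (by fun_prop) fun y _ => ⟨hs, mem_univ _⟩).clm_apply continuousOn_const)
    -- The directions (1, 1) and (1, -1) differ by 2∂ₓ, and that part of the derivative of B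
    -- integrates to boundary terms.
    have h1 : ∫ y in a..b, 2 * fderiv ℝ B (s, y + s) (0, 1) = 2 * (B (s, b + s) - B (s, a + s)) := by
      rw [intervalIntegral.integral_const_mul]
      congr 1
      refine intervalIntegral.integral_eq_sub_of_hasDerivAt (f := fun y => B (s, y + s)) (fun y _ => ?_)
        ((cD hB _).intervalIntegrable _ _)
      simpa using (hB.hasDerivAt_space (x := y + s) hs).comp_add_const y s
    have h2 : (∫ y in a..b, fderiv ℝ φ (s, y + s) (1, 1)) ≤
        ∫ y in a..b, 2 * fderiv ℝ B (s, y + s) (0, 1) := by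
      refine intervalIntegral.integral_mono_on hab ((cD hAB _).intervalIntegrable _ _)
        ((continuous_const.mul (cD hB _)).intervalIntegrable _ _) fun y _ => ?_
      have hp : (s, y + s) ∈ openStrip T := ⟨hs, mem_univ _⟩
      have e1 : fderiv ℝ φ (s, y + s) (1, 1) =
          fderiv ℝ A (s, y + s) (1, 1) + fderiv ℝ B (s, y + s) (1, 1) := by
        rw [show fderiv ℝ φ (s, y + s) = _ from ((hA.hasFDerivAt hp).add (hB.hasFDerivAt hp)).fderiv]
        rfl
      have e2 : ((1, 1) : ℝ × ℝ) = (1, -1) + (2 : ℝ) • (0, 1) := by ext <;> norm_num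
      have e3 : fderiv ℝ B (s, y + s) (1, 1) =
          fderiv ℝ B (s, y + s) (1, -1) + 2 * fderiv ℝ B (s, y + s) (0, 1) := by
        conv_lhs => rw [e2]
        rw [map_add, map_smul, smul_eq_mul]
      have := hle _ hp
      linarith
    rw [h1, hBb s hs] at h2
    linarith
  have key : AntitoneOn G (Icc 0 T) := by
    refine antitoneOn_of_deriv_nonpos (convex_Icc 0 T) cG.continuousOn ?_ ?_
    · rw [interior_Icc]
      exact fun s hs => (dG s hs).differentiableAt.differentiableWithinAt
    · rw [interior_Icc]
      exact fun s hs => (dG s hs).deriv.trans_le (hneg s hs)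
  have := key (left_mem_Icc.2 hT) ht ht.1
  simp only [hG, clamp_of_mem ht, clamp_of_mem (left_mem_Icc.2 hT), add_zero,
    intervalIntegral.integral_same, mul_zero] at this
  refine le_trans (le_of_eq ?_) this
  congr 2
  refine intervalIntegral.integral_congr fun s hs => ?_
  rw [uIcc_of_le ht.1] at hs
  simp only [clamp_of_mem (⟨hs.1, hs.2.trans ht.2⟩ : s ∈ Icc 0 T)]

theorem IsC1Strip.fderiv_line_eq {E : Type*} [NormedAddCommGroup E] [NormedSpace ℝ E] {T : ℝ}
    {f : ℝ × ℝ → E} (hf : IsC1Strip T f) {c t x : ℝ} (ht : t ∈ Ioo 0 T) {d : E}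
    (hd : HasDerivAt (fun s => f (s, x + c * s)) d t) :
    fderiv ℝ f (t, x + c * t) (1, c) = d :=
  (hf.hasDerivAt_line ht).unique hd

theorem contDiff_primitive {Q : ℝ → ℝ} (hQ : Continuous Q) :
    ContDiff ℝ 1 fun z => ∫ y in 0..z, Q y := by
  rw [contDiff_one_iff_deriv]
  have : deriv (fun z => ∫ y in 0..z, Q y) = Q := funext fun z => Continuous.deriv_integral Q hQ 0 z
  rw [this]
  exact ⟨fun z => (hQ.integral_hasStrictDerivAt 0 z).hasDerivAt.differentiableAt, hQ⟩

/-- The weight decreasing along both families of characteristics. -/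
noncomputable def weight (M R : ℝ) (P Q : ℝ → ℝ) (p : ℝ × ℝ) : ℝ :=
  Real.exp (-(M * p.1)) * (Real.smoothTransition (R - (p.2 + p.1)) *
    Real.exp (-∫ y in 0..(p.2 + p.1), Q y)) * Real.exp (∫ y in 0..(p.2 - p.1), P y)

section weight

variable {M R : ℝ} {P Q : ℝ → ℝ}

theorem contDiff_weight (hP : Continuous P) (hQ : Continuous Q) :
    ContDiff ℝ 1 (weight M R P Q) := by
  have h1 := (contDiff_primitive hP).comp (contDiff_snd.sub contDiff_fst : ContDiff ℝ 1 fun p : ℝ × ℝ => p.2 - p.1)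
  have h2 := (contDiff_primitive hQ).comp (contDiff_snd.add contDiff_fst : ContDiff ℝ 1 fun p : ℝ × ℝ => p.2 + p.1)
  have h3 : ContDiff ℝ 1 Real.smoothTransition := Real.smoothTransition.contDiff
  unfold weight
  exact ((by fun_prop : ContDiff ℝ 1 fun p : ℝ × ℝ => Real.exp (-(M * p.1))).mul
    ((h3.comp (by fun_prop : ContDiff ℝ 1 fun p : ℝ × ℝ => R - (p.2 + p.1))).mul h2.neg.exp)).mul h1.exp

theorem weight_nonneg (p : ℝ × ℝ) : 0 ≤ weight M R P Q p := by
  have := Real.smoothTransition.nonneg (R - (p.2 + p.1))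
  unfold weight; positivity

/-- Monotonicity of the weight along the right-moving characteristics. -/
theorem exists_hasDerivAt_weight_right (hQ : Continuous Q) (t x : ℝ) :
    ∃ d, HasDerivAt (fun s => weight M R P Q (s, x + 1 * s)) d t ∧
      d ≤ -(M + 2 * Q (x + 1 * t + t)) * weight M R P Q (t, x + 1 * t) := by
  have e : (fun s => weight M R P Q (s, x + 1 * s)) = fun s =>
      Real.exp (-(M * s)) * (Real.smoothTransition (R - (x + 1 * s + s)) *
        Real.exp (-∫ y in 0..(x + 1 * s + s), Q y)) * Real.exp (∫ y in 0..x, P y) := by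
    funext s; simp only [weight, one_mul, add_sub_cancel_right]
  have hl : HasDerivAt (fun s : ℝ => x + 1 * s + s) 2 t := by
    exact ((((hasDerivAt_id t).const_mul (1 : ℝ)).const_add x).add (hasDerivAt_id t)).congr_deriv
      (by norm_num)
  have hχ : HasDerivAt Real.smoothTransition (deriv Real.smoothTransition (R - (x + 1 * t + t)))
      (R - (x + 1 * t + t)) :=
    ((Real.smoothTransition.contDiff (n := 1)).differentiable one_ne_zero _).hasDerivAt
  have h1 : HasDerivAt (fun s : ℝ => Real.exp (-(M * s))) (Real.exp (-(M * t)) * -(M * 1)) t :=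
    ((hasDerivAt_id t).const_mul M).neg.exp
  have h2 := hχ.comp t (hl.const_sub R)
  have h3 := (HasDerivAt.comp (h := fun s => x + 1 * s + s) (h₂ := fun z => ∫ y in 0..z, Q y) t
    (hQ.integral_hasStrictDerivAt 0 (x + 1 * t + t)).hasDerivAt hl).neg.exp
  refine ⟨_, by rw [e]; exact (h1.mul (h2.mul h3)).mul_const _, ?_⟩
  -- Here x+t increases at speed 2, which produces the rate 2Q; the cutoff also decreases, and its
  -- contribution has a favourable sign and is dropped.
  have hd : 0 ≤ deriv Real.smoothTransition (R - (x + 1 * t + t)) :=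
    Real.smoothTransition.monotone.deriv_nonneg
  have : 0 ≤ Real.exp (-(M * t)) * deriv Real.smoothTransition (R - (x + 1 * t + t)) *
      Real.exp (-∫ y in 0..(x + 1 * t + t), Q y) * Real.exp (∫ y in 0..x, P y) := by positivity
  have ex : x + 1 * t - t = x := by ring
  simp only [weight, ex, Function.comp, Pi.neg_apply, Pi.mul_apply]
  linarith [this]

/-- Monotonicity of the weight along the left-moving characteristics. -/
theorem exists_hasDerivAt_weight_left (hP : Continuous P) (t x : ℝ) :
    ∃ d, HasDerivAt (fun s => weight M R P Q (s, x + -1 * s)) d t ∧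
      d ≤ -(M + 2 * P (x + -1 * t - t)) * weight M R P Q (t, x + -1 * t) := by
  have e : (fun s => weight M R P Q (s, x + -1 * s)) = fun s =>
      Real.exp (-(M * s)) * (Real.smoothTransition (R - x) *
        Real.exp (-∫ y in 0..x, Q y)) * Real.exp (∫ y in 0..(x + -1 * s - s), P y) := by
    funext s
    have : x + -1 * s + s = x := by ring
    simp only [weight, this]
  have hl : HasDerivAt (fun s : ℝ => x + -1 * s - s) (-2) t := by
    exact ((((hasDerivAt_id t).const_mul (-1 : ℝ)).const_add x).sub (hasDerivAt_id t)).congr_deriv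
      (by norm_num)
  have h1 : HasDerivAt (fun s : ℝ => Real.exp (-(M * s))) (Real.exp (-(M * t)) * -(M * 1)) t :=
    ((hasDerivAt_id t).const_mul M).neg.exp
  have h3 := (HasDerivAt.comp (h := fun s => x + -1 * s - s) (h₂ := fun z => ∫ y in 0..z, P y) t
    (hP.integral_hasStrictDerivAt 0 (x + -1 * t - t)).hasDerivAt hl).exp
  refine ⟨_, by rw [e]; exact (h1.mul_const _).mul h3, ?_⟩
  have ex : x + -1 * t + t = x := by ring
  simp only [weight, ex, Function.comp]
  -- On left-moving characteristics x+t is constant, so the cutoff is not differentiated and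
  -- equality holds.
  apply le_of_eq
  ring

theorem weight_le (hM : 0 ≤ M) {κ : ℝ} (hPκ : ∀ a b, ∫ y in a..b, P y ≤ κ)
    (hQκ : ∀ a b, ∫ y in a..b, Q y ≤ κ) {p : ℝ × ℝ} (hp : 0 ≤ p.1) :
    weight M R P Q p ≤ Real.exp (2 * κ) := by
  have h1 : Real.exp (-(M * p.1)) ≤ 1 := Real.exp_le_one_iff.2 (by nlinarith)
  have h2 := Real.smoothTransition.le_one (R - (p.2 + p.1))
  have h2' := Real.smoothTransition.nonneg (R - (p.2 + p.1))
  have h3 : Real.exp (-∫ y in 0..(p.2 + p.1), Q y) ≤ Real.exp κ := by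
    -- The minus sign reverses the endpoints, and `hQκ` covers both orientations.
    rw [← intervalIntegral.integral_symm]
    exact Real.exp_le_exp.2 (hQκ _ _)
  have h4 : Real.exp (∫ y in 0..(p.2 - p.1), P y) ≤ Real.exp κ := Real.exp_le_exp.2 (hPκ _ _)
  calc weight M R P Q p ≤ 1 * (1 * Real.exp κ) * Real.exp κ := by unfold weight; gcongr
    _ = Real.exp (2 * κ) := by rw [one_mul, one_mul, ← Real.exp_add]; ring_nf

theorem le_weight (hM : 0 ≤ M) {κ T : ℝ} (hPκ : ∀ a b, ∫ y in a..b, P y ≤ κ)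
    (hQκ : ∀ a b, ∫ y in a..b, Q y ≤ κ) {p : ℝ × ℝ} (hp : p.1 ≤ T) (hR : p.2 + p.1 + 1 ≤ R) :
    Real.exp (-(M * T + 2 * κ)) ≤ weight M R P Q p := by
  rw [weight, Real.smoothTransition.one_of_one_le (by linarith), one_mul, ← Real.exp_add,
    ← Real.exp_add, Real.exp_le_exp]
  have h1 := hQκ 0 (p.2 + p.1)
  have h2 := hPκ (p.2 - p.1) 0
  rw [intervalIntegral.integral_symm] at h2
  nlinarith

theorem weight_eq_zero {p : ℝ × ℝ} (hR : R ≤ p.2 + p.1) : weight M R P Q p = 0 := by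
  rw [weight, Real.smoothTransition.zero_of_nonpos (by linarith)]; ring

end weight

/-- Weighted energy estimate for a pair of nonnegative densities transported with speeds `1` and
`-1` and interacting through coefficients transported in the opposite directions. -/
theorem weighted_energy {T M L κ : ℝ} {P Q : ℝ → ℝ} {A B : ℝ × ℝ → ℝ}
    (hA : IsC1Strip T A) (hB : IsC1Strip T B)
    (hA0 : ∀ p ∈ strip T, 0 ≤ A p) (hB0 : ∀ p ∈ strip T, 0 ≤ B p)
    (hM : 0 ≤ M) (hP : Continuous P) (hQ : Continuous Q)
    (hPκ : ∀ a b, ∫ y in a..b, P y ≤ κ) (hQκ : ∀ a b, ∫ y in a..b, Q y ≤ κ)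
    (hle : ∀ t ∈ Ioo 0 T, ∀ x, fderiv ℝ A (t, x) (1, 1) + fderiv ℝ B (t, x) (1, -1) ≤
      2 * (A (t, x) * Q (x + t) + B (t, x) * P (x - t)) + M * (A (t, x) + B (t, x)))
    (hL : ∀ a b, a ≤ b → ∫ y in a..b, (A (0, y) + B (0, y)) ≤ L) {t : ℝ} (ht : t ∈ Icc 0 T) :
    (∀ a b, a ≤ b → ∫ y in a..b, (A (t, y) + B (t, y)) ≤ Real.exp (M * T + 4 * κ) * L) ∧
    ∀ x, 2 * ∫ s in 0..t, B (s, x + s) ≤ Real.exp (M * T + 4 * κ) * L := by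
  have hT : 0 ≤ T := ht.1.trans ht.2
  -- At time t ≤ T the points y + t with y ≤ c satisfy x + t ≤ c + 2T, so the cutoff at R equals 1
  -- there. The window for the flux inequality extends to R, where the weight vanishes.
  have key : ∀ a c R, a ≤ c → c + 2 * T + 1 ≤ R →
      (∫ y in a..c, (A (t, y + t) + B (t, y + t))) + 2 * ∫ s in 0..t, B (s, a + s) ≤
        Real.exp (M * T + 4 * κ) * L := by
    intro a c R hac hcR
    have haR : a ≤ R := by linarith
    set ω := weight M R P Q with hω
    have cω : IsC1Strip T ω := .of_contDiff (contDiff_weight hP hQ)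
    have ω0 : ∀ p, 0 ≤ ω p := weight_nonneg
    have hAω := hA.mul cω
    have hBω := hB.mul cω
    have hAB := (hA.add hB)
    have cs : ∀ {f : ℝ × ℝ → ℝ}, IsC1Strip T f → ∀ s ∈ Icc 0 T, ∀ r, Continuous fun y => f (s, y + r) :=
      fun {f} hf s hs r => continuousOn_univ.1 (hf.continuousOn.comp (f := fun y => (s, y + r))
        (by fun_prop) fun y _ => ⟨hs, mem_univ _⟩)
    have flux := energy_flux hAω hBω (b := R) (a := a) (fun s hs => by
        rw [hω, weight_eq_zero (by simp; linarith [hs.1]), mul_zero]) haR ?_ ht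
    · have e0 : Real.exp (-(M * T + 2 * κ)) * ∫ y in a..c, (A (t, y + t) + B (t, y + t)) ≤
          ∫ y in a..R, (A (t, y + t) * ω (t, y + t) + B (t, y + t) * ω (t, y + t)) := by
        rw [← intervalIntegral.integral_const_mul]
        refine le_trans ?_ (intervalIntegral.integral_mono_interval (a := a) (b := c) le_rfl hac
          (by linarith) ?_ ((cs (hAω.add hBω) t ht t).intervalIntegrable _ _))
        · refine intervalIntegral.integral_mono_on hac
            ((continuous_const.mul (cs hAB t ht t)).intervalIntegrable _ _)
            ((cs (hAω.add hBω) t ht t).intervalIntegrable _ _) fun y hy => ?_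
          have := le_weight hM hPκ hQκ (R := R) (p := (t, y + t)) ht.2 (by
            simp only; linarith [hy.2, ht.2])
          have h1 := hA0 (t, y + t) ⟨ht, mem_univ _⟩
          have h2 := hB0 (t, y + t) ⟨ht, mem_univ _⟩
          rw [← add_mul, mul_comm]
          gcongr
        · refine ae_of_all _ fun y => ?_
          have h1 := hA0 (t, y + t) ⟨ht, mem_univ _⟩
          have h2 := hB0 (t, y + t) ⟨ht, mem_univ _⟩
          have := ω0 (t, y + t)
          simp only [Pi.zero_apply]
          positivity
      have cl : ∀ {f : ℝ × ℝ → ℝ}, IsC1Strip T f → IntervalIntegrable (fun s => f (s, a + s)) volume 0 t := by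
        intro f hf
        refine ContinuousOn.intervalIntegrable ?_
        rw [uIcc_of_le ht.1]
        exact hf.continuousOn.comp (f := fun s => (s, a + s)) (by fun_prop)
          fun s hs => ⟨⟨hs.1, hs.2.trans ht.2⟩, mem_univ _⟩
      have e1 : Real.exp (-(M * T + 2 * κ)) * ∫ s in 0..t, B (s, a + s) ≤
          ∫ s in 0..t, B (s, a + s) * ω (s, a + s) := by
        rw [← intervalIntegral.integral_const_mul]
        refine intervalIntegral.integral_mono_on ht.1 ((cl hB).const_mul _) (cl hBω) fun s hs => ?_
        have hs' : s ≤ T := hs.2.trans ht.2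
        have := le_weight hM hPκ hQκ (R := R) (p := (s, a + s)) hs' (by simp only; linarith)
        have h2 := hB0 (s, a + s) ⟨⟨hs.1, hs'⟩, mem_univ _⟩
        rw [mul_comm]
        gcongr
      have e2 : ∫ y in a..R, (A (0, y) * ω (0, y) + B (0, y) * ω (0, y)) ≤ Real.exp (2 * κ) * L := by
        have h0 : (0 : ℝ) ∈ Icc 0 T := left_mem_Icc.2 hT
        refine le_trans (intervalIntegral.integral_mono_on haR
          (g := fun y => Real.exp (2 * κ) * (A (0, y) + B (0, y))) ?_ ?_ fun y _ => ?_) ?_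
        · simpa using (cs (hAω.add hBω) 0 h0 0).intervalIntegrable a R
        · have : Continuous fun y => A (0, y) + B (0, y) := by simpa using cs hAB 0 h0 0
          exact (continuous_const.mul this).intervalIntegrable a R
        · have h1 := hA0 (0, y) ⟨h0, mem_univ _⟩
          have h2 := hB0 (0, y) ⟨h0, mem_univ _⟩
          have := weight_le hM hPκ hQκ (R := R) (p := (0, y)) le_rfl
          rw [← add_mul, mul_comm]
          gcongr
        · rw [intervalIntegral.integral_const_mul]
          gcongr
          exact hL _ _ haR
      have e3 : Real.exp (-(M * T + 2 * κ)) * ((∫ y in a..c, (A (t, y + t) + B (t, y + t))) +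
          2 * ∫ s in 0..t, B (s, a + s)) ≤ Real.exp (2 * κ) * L := by
        linarith
      -- The lower bound of the weight costs exp(MT + 2κ) and its upper bound at time 0 costs
      -- exp(2κ), whence MT + 4κ.
      have e4 := mul_le_mul_of_nonneg_left e3 (Real.exp_pos (M * T + 2 * κ)).le
      rw [← mul_assoc, ← Real.exp_add, ← mul_assoc, ← Real.exp_add] at e4
      rwa [show M * T + 2 * κ + -(M * T + 2 * κ) = 0 by ring, Real.exp_zero, one_mul,
        show M * T + 2 * κ + 2 * κ = M * T + 4 * κ by ring] at e4
    -- The decay rates M + 2Q and M + 2P of the weight along the two characteristics cancel exactly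
    -- the growth allowed by `hle`.
    · rintro ⟨s, x⟩ ⟨hs : s ∈ Ioo 0 T, -⟩
      obtain ⟨d1, hd1, hd1'⟩ := exists_hasDerivAt_weight_right (M := M) (R := R) (P := P) hQ s (x - s)
      obtain ⟨d2, hd2, hd2'⟩ := exists_hasDerivAt_weight_left (M := M) (R := R) (Q := Q) hP s (x + s)
      have k1 := hAω.fderiv_line_eq (x := x - s) hs ((hA.hasDerivAt_line hs).mul hd1)
      have k2 := hBω.fderiv_line_eq (x := x + s) hs ((hB.hasDerivAt_line hs).mul hd2)
      have x1 : x - s + 1 * s = x := by ring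
      have x2 : x + s + -1 * s = x := by ring
      rw [x1] at k1 hd1'
      rw [x2] at k2 hd2'
      rw [k1, k2]
      have h1 := hA0 (s, x) ⟨Ioo_subset_Icc_self hs, mem_univ _⟩
      have h2 := hB0 (s, x) ⟨Ioo_subset_Icc_self hs, mem_univ _⟩
      have h3 := mul_le_mul_of_nonneg_left hd1' h1
      have h4 := mul_le_mul_of_nonneg_left hd2' h2
      have h5 := mul_le_mul_of_nonneg_right (hle s hs x) (ω0 (s, x))
      linarith
  have cB : ∀ a, 0 ≤ ∫ s in 0..t, B (s, a + s) := fun a =>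
    intervalIntegral.integral_nonneg ht.1 fun s hs => hB0 _ ⟨⟨hs.1, hs.2.trans ht.2⟩, mem_univ _⟩
  constructor
  · intro a b hab
    have := key (a - t) (b - t) _ (by linarith) le_rfl
    rw [intervalIntegral.integral_comp_add_right (fun y => A (t, y) + B (t, y))] at this
    simp only [sub_add_cancel] at this
    linarith [cB (a - t)]
  · intro x
    have := key x x _ le_rfl le_rfl
    simpa using this

/-- The reflection of space exchanges the two families of characteristics, so it suffices to
estimate the right-moving component. -/
theorem IsC1Strip.reflect {E : Type*} [NormedAddCommGroup E] [NormedSpace ℝ E] {T : ℝ}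
    {f : ℝ × ℝ → E} (hf : IsC1Strip T f) : IsC1Strip T fun p => f (p.1, -p.2) :=
  ⟨hf.1.comp (f := fun p : ℝ × ℝ => (p.1, -p.2)) (by fun_prop) fun _ hp => ⟨hp.1, mem_univ _⟩,
    hf.2.comp (f := fun p : ℝ × ℝ => (p.1, -p.2)) (by fun_prop) fun _ hp => ⟨hp.1, mem_univ _⟩⟩

theorem IsC1Strip.fderiv_reflect {E : Type*} [NormedAddCommGroup E] [NormedSpace ℝ E] {T : ℝ}
    {f : ℝ × ℝ → E} (hf : IsC1Strip T f) {t x c : ℝ} (ht : t ∈ Ioo 0 T) :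
    fderiv ℝ (fun p : ℝ × ℝ => f (p.1, -p.2)) (t, x) (1, c) = fderiv ℝ f (t, -x) (1, -c) := by
  have h := hf.reflect.fderiv_line_eq (x := x - c * t) (c := c) ht
    (d := fderiv ℝ f (t, -x) (1, -c)) ?_
  · simpa using h
  · have h := hf.hasDerivAt_line (c := -c) (x := -(x - c * t)) ht
    rw [show -(x - c * t) + -c * t = -x by ring] at h
    convert h using 4
    ring

/-- Charge conservation bounds the flux through the characteristics. -/
theorem flux_le {T L : ℝ} {A B : ℝ × ℝ → ℝ} (hA : IsC1Strip T A) (hB : IsC1Strip T B)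
    (hA0 : ∀ p ∈ strip T, 0 ≤ A p) (hB0 : ∀ p ∈ strip T, 0 ≤ B p)
    (hle : ∀ t ∈ Ioo 0 T, ∀ x, fderiv ℝ A (t, x) (1, 1) + fderiv ℝ B (t, x) (1, -1) ≤ 0)
    (hL : ∀ a b, a ≤ b → ∫ y in a..b, (A (0, y) + B (0, y)) ≤ L) {t : ℝ} (ht : t ∈ Icc 0 T) :
    (∀ a b, a ≤ b → ∫ y in a..b, (A (t, y) + B (t, y)) ≤ L) ∧
    ∀ x, ∫ s in 0..t, B (s, x + s) ≤ L := by
  -- Without interaction the weight reduces to the cutoff and the constant becomes 1.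
  have := weighted_energy (M := 0) (κ := 0) (P := fun _ => 0) (Q := fun _ => 0) hA hB hA0 hB0 le_rfl
    continuous_const continuous_const (by simp) (by simp) (by simpa using hle) hL ht
  simp only [zero_mul, mul_zero, add_zero, Real.exp_zero, one_mul] at this
  refine ⟨this.1, fun x => ?_⟩
  have h0 : 0 ≤ ∫ s in 0..t, B (s, x + s) :=
    intervalIntegral.integral_nonneg ht.1 fun s hs => hB0 _ ⟨⟨hs.1, hs.2.trans ht.2⟩, mem_univ _⟩
  linarith [this.2 x]

/-- Pointwise bound of a density along its characteristics by its initial value. -/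
theorem pointwise_le {T L c μ : ℝ} {A B : ℝ × ℝ → ℝ} (hA : IsC1Strip T A) (hB : IsC1Strip T B)
    (hA0 : ∀ p ∈ strip T, 0 ≤ A p) (hB0 : ∀ p ∈ strip T, 0 ≤ B p) (hc : 0 ≤ c) (hμ : 0 ≤ μ)
    (hle : ∀ t ∈ Ioo 0 T, ∀ x, fderiv ℝ A (t, x) (1, 1) + fderiv ℝ B (t, x) (1, -1) ≤ 0)
    (hgr : ∀ t ∈ Ioo 0 T, ∀ x, fderiv ℝ A (t, x) (1, 1) ≤ (1 + c * B (t, x)) * A (t, x) + μ * B (t, x))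
    (hL : ∀ a b, a ≤ b → ∫ y in a..b, (A (0, y) + B (0, y)) ≤ L) {t : ℝ} (ht : t ∈ Icc 0 T) (x : ℝ) :
    A (t, x) ≤ Real.exp (T + c * L) * (A (0, x - t) + μ * L) := by
  have hT : 0 ≤ T := ht.1.trans ht.2
  have h0T : (0 : ℝ) ∈ Icc 0 T := left_mem_Icc.2 hT
  set y := x - t with hy
  have c2 : Continuous fun s : ℝ => B (clamp T s, y + s) :=
    (hB.continuous_clamp hT).comp (f := fun s : ℝ => (s, y + s)) (by fun_prop)
  have c1 : Continuous fun s : ℝ => A (clamp T s, y + s) :=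
    (hA.continuous_clamp hT).comp (f := fun s : ℝ => (s, y + s)) (by fun_prop)
  set I : ℝ → ℝ := fun s => ∫ r in 0..s, B (clamp T r, y + r) with hI
  have dI : ∀ s, HasDerivAt I (B (clamp T s, y + s)) s := fun s =>
    (c2.integral_hasStrictDerivAt 0 s).hasDerivAt
  have cI : Continuous I := continuous_iff_continuousAt.2 fun s => (dI s).continuousAt
  -- Gronwall along x - s = y: the exponential is the integrating factor of the rate 1 + cB, and μI
  -- accounts for the forcing μB.
  set Z : ℝ → ℝ := fun s => A (clamp T s, y + s) * Real.exp (-(s + c * I s)) - μ * I s with hZ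
  have cZ : Continuous Z := by
    refine (c1.mul ?_).sub (continuous_const.mul cI)
    exact Real.continuous_exp.comp (continuous_id.add (continuous_const.mul cI)).neg
  have I0 : ∀ s ∈ Icc 0 T, 0 ≤ I s := fun s hs =>
    intervalIntegral.integral_nonneg hs.1 fun r hr => hB0 _ ⟨clamp_mem hT _, mem_univ _⟩
  have dZ : ∀ s ∈ Ioo 0 T, HasDerivAt Z
      (fderiv ℝ A (s, y + s) (1, 1) * Real.exp (-(s + c * I s)) +
        A (s, y + s) * (Real.exp (-(s + c * I s)) * -(1 + c * B (s, y + s))) - μ * B (s, y + s)) s := by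
    intro s hs
    have e := clamp_of_mem (Ioo_subset_Icc_self hs)
    have d1 : HasDerivAt (fun s => A (clamp T s, y + s)) (fderiv ℝ A (s, y + s) (1, 1)) s := by
      have := hA.hasDerivAt_line (c := 1) (x := y) hs
      simp only [one_mul] at this
      refine this.congr_of_eventuallyEq ?_
      filter_upwards [isOpen_Ioo.mem_nhds hs] with r hr
      rw [clamp_of_mem (Ioo_subset_Icc_self hr)]
    have d2 := dI s
    rw [e] at d2
    have d3 := ((hasDerivAt_id s).add (d2.const_mul c)).neg.exp
    have := (d1.mul d3).sub (d2.const_mul μ)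
    rw [e] at this
    exact this
  have key : AntitoneOn Z (Icc 0 T) := by
    refine antitoneOn_of_deriv_nonpos (convex_Icc 0 T) cZ.continuousOn ?_ ?_
    · rw [interior_Icc]
      exact fun s hs => (dZ s hs).differentiableAt.differentiableWithinAt
    · rw [interior_Icc]
      intro s hs
      rw [(dZ s hs).deriv]
      have hs' := Ioo_subset_Icc_self hs
      have hb := hB0 (s, y + s) ⟨hs', mem_univ _⟩
      -- The forcing appears multiplied by the integrating factor; since that is at most 1, the
      -- derivative of μI dominates it.
      have e1 : Real.exp (-(s + c * I s)) ≤ 1 := by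
        have := mul_nonneg hc (I0 s hs')
        exact Real.exp_le_one_iff.2 (by linarith [hs.1])
      have e2 := mul_le_mul_of_nonneg_right (hgr s hs (y + s)) (Real.exp_pos (-(s + c * I s))).le
      have e3 := mul_le_mul_of_nonneg_left e1 (mul_nonneg hμ hb)
      linarith
  have h1 := key h0T ht ht.1
  have hIL : I t ≤ L := by
    refine le_trans (le_of_eq ?_) ((flux_le hA hB hA0 hB0 hle hL ht).2 y)
    refine intervalIntegral.integral_congr fun s hs => ?_
    rw [uIcc_of_le ht.1] at hs
    simp only [clamp_of_mem (⟨hs.1, hs.2.trans ht.2⟩ : s ∈ Icc 0 T)]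
  have e1 : I 0 = 0 := intervalIntegral.integral_same
  simp only [hZ, clamp_of_mem ht, clamp_of_mem h0T, e1, hy, sub_add_cancel, add_zero, mul_zero,
    neg_zero, Real.exp_zero, mul_one, sub_zero] at h1
  have hA0' := hA0 (0, x - t) ⟨h0T, mem_univ _⟩
  have h2 : A (t, x) * Real.exp (-(t + c * I t)) ≤ A (0, x - t) + μ * L := by
    have := mul_le_mul_of_nonneg_left hIL hμ
    linarith
  have hL0 : 0 ≤ L := (I0 t ht).trans hIL
  have h3 := mul_le_mul_of_nonneg_left h2 (Real.exp_pos (t + c * I t)).le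
  rw [mul_comm (A _), ← mul_assoc, ← Real.exp_add, add_neg_cancel, Real.exp_zero, one_mul] at h3
  refine h3.trans ?_
  have : t + c * I t ≤ T + c * L := add_le_add ht.2 (mul_le_mul_of_nonneg_left hIL hc)
  gcongr

/-! ### Algebra of the nonlinearity: charge, growth and differences -/

/-- By the symmetry of `W`, every estimate of the first equation applies to the second after
exchanging u and v. -/
theorem N₂_eq_N₁ (α β : ℝ) (u v : ℂ) : N₂ α β u v = N₁ α β v u := by
  rw [N₁_eq, N₂_eq]; ring

/-- The α-term is a real multiple of u turned by -i, hence orthogonal to u. Writing ūv = Y + iX,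
what remains is -mX + 4βYX; X changes sign when u and v are exchanged and Y does not, which gives
the cancellation in `inner_rhs_add`. -/
theorem inner_rhs (m α β : ℝ) (u v : ℂ) :
    inner ℝ u (-Complex.I * (-(m : ℂ) * v + N₁ α β u v)) =
      -m * (u.re * v.im - u.im * v.re) +
        4 * β * (u.re * v.re + u.im * v.im) * (u.re * v.im - u.im * v.re) := by
  rw [N₁_eq, Complex.inner]
  simp
  ring

theorem inner_rhs_add (m α β : ℝ) (u v : ℂ) :
    inner ℝ u (-Complex.I * (-(m : ℂ) * v + N₁ α β u v)) +
      inner ℝ v (-Complex.I * (-(m : ℂ) * u + N₁ α β v u)) = 0 := by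
  rw [inner_rhs, inner_rhs]; ring

/-- The growth rate of |u|² involves only |v|², whose integral along the characteristics of u is
bounded by the charge. Since X² + Y² = |u|²|v|², the product XY costs half of |u|²|v|²; the mass
term is split by Young's inequality. -/
theorem abs_inner_rhs_le (m α β : ℝ) (u v : ℂ) :
    2 * |inner ℝ u (-Complex.I * (-(m : ℂ) * v + N₁ α β u v))| ≤
      (1 + 4 * |β| * ‖v‖ ^ 2) * ‖u‖ ^ 2 + m ^ 2 * ‖v‖ ^ 2 := by
  rw [inner_rhs]
  set X := u.re * v.im - u.im * v.re with hX
  set Y := u.re * v.re + u.im * v.im with hY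
  have hXY : X ^ 2 + Y ^ 2 = ‖u‖ ^ 2 * ‖v‖ ^ 2 := by
    rw [Complex.sq_norm, Complex.sq_norm, Complex.normSq_apply, Complex.normSq_apply]; ring
  have h1 : |X| ≤ ‖u‖ * ‖v‖ := by
    refine abs_le_of_sq_le_sq ?_ (by positivity)
    rw [mul_pow]; nlinarith [sq_nonneg Y]
  have h2 : 2 * |Y * X| ≤ ‖u‖ ^ 2 * ‖v‖ ^ 2 := by
    rw [abs_mul]; nlinarith [sq_nonneg (|Y| - |X|), sq_abs Y, sq_abs X]
  have h3 : |(-m * X + 4 * β * Y * X)| ≤ |m| * |X| + 4 * |β| * |Y * X| := by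
    refine (abs_add_le _ _).trans (le_of_eq ?_)
    simp [abs_mul, mul_assoc]
  have h4 : 2 * (|m| * |X|) ≤ ‖u‖ ^ 2 + m ^ 2 * ‖v‖ ^ 2 := by
    have := mul_le_mul_of_nonneg_left h1 (abs_nonneg m)
    nlinarith [sq_nonneg (‖u‖ - |m| * ‖v‖), sq_abs m]
  have h5 := mul_le_mul_of_nonneg_left h2 (by positivity : 0 ≤ 4 * |β|)
  nlinarith

theorem norm_mul_mul_sub_le (a b c a' b' c' : ℂ) :
    ‖a * b * c - a' * b' * c'‖ ≤
      ‖a - a'‖ * (‖b‖ * ‖c‖) + ‖a'‖ * ‖b - b'‖ * ‖c‖ + ‖a'‖ * ‖b'‖ * ‖c - c'‖ := by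
  have : a * b * c - a' * b' * c' = (a - a') * (b * c) + a' * (b - b') * c + a' * b' * (c - c') := by
    ring
  rw [this]
  refine (norm_add₃_le).trans (le_of_eq ?_)
  simp

/-- `N₁` is a sum of monomials of degree one in u, ū and degree two in v, v̄, with coefficients α,
2β, 2β; each difference telescopes. -/
theorem norm_N₁_sub_le (α β : ℝ) (u v u' v' : ℂ) :
    ‖N₁ α β u v - N₁ α β u' v'‖ ≤ (|α| + 4 * |β|) *
      (‖u - u'‖ * ‖v‖ ^ 2 + ‖u'‖ * ‖v‖ * ‖v - v'‖ + ‖u'‖ * ‖v'‖ * ‖v - v'‖) := by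
  have e : N₁ α β u v - N₁ α β u' v' = α * (u * v * conj v - u' * v' * conj v') +
      (2 * β) * (conj u * v * v - conj u' * v' * v') +
      (2 * β) * (u * v * conj v - u' * v' * conj v') := by
    rw [N₁_eq, N₁_eq]; ring
  have h1 := norm_mul_mul_sub_le u v (conj v) u' v' (conj v')
  have h2 := norm_mul_mul_sub_le (conj u) v v (conj u') v' v'
  rw [← map_sub, Complex.norm_conj, Complex.norm_conj] at h1
  rw [← map_sub, Complex.norm_conj, Complex.norm_conj] at h2
  rw [e]
  refine (norm_add₃_le).trans ?_
  simp only [norm_mul, Complex.norm_real, Complex.norm_ofNat, Real.norm_eq_abs]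
  have h3 := mul_le_mul_of_nonneg_left h1 (abs_nonneg α)
  have h4 := mul_le_mul_of_nonneg_left h1 (by positivity : 0 ≤ 2 * |β|)
  have h5 := mul_le_mul_of_nonneg_left h2 (by positivity : 0 ≤ 2 * |β|)
  nlinarith

/-- The form is dictated by `weighted_energy`: each squared difference is multiplied only by
intensities of the opposite component. The mixed products are distributed by 2ab ≤ a² + b², after
which 3 is the largest coefficient. -/
theorem inner_sub_rhs_le (m α β : ℝ) (u v u' v' : ℂ) :
    2 * inner ℝ (u - u') (-Complex.I * (-(m : ℂ) * v + N₁ α β u v) -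
        -Complex.I * (-(m : ℂ) * v' + N₁ α β u' v')) ≤
      |m| * (‖u - u'‖ ^ 2 + ‖v - v'‖ ^ 2) + 3 * (|α| + 4 * |β|) *
        (‖u - u'‖ ^ 2 * (‖v‖ ^ 2 + ‖v'‖ ^ 2) + ‖v - v'‖ ^ 2 * (‖u‖ ^ 2 + ‖u'‖ ^ 2)) := by
  have h1 := real_inner_le_norm (u - u') (-Complex.I * (-(m : ℂ) * v + N₁ α β u v) -
        -Complex.I * (-(m : ℂ) * v' + N₁ α β u' v'))
  have h2 : ‖-Complex.I * (-(m : ℂ) * v + N₁ α β u v) -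
        -Complex.I * (-(m : ℂ) * v' + N₁ α β u' v')‖ ≤
      |m| * ‖v - v'‖ + ‖N₁ α β u v - N₁ α β u' v'‖ := by
    have : -Complex.I * (-(m : ℂ) * v + N₁ α β u v) -
        -Complex.I * (-(m : ℂ) * v' + N₁ α β u' v') =
        Complex.I * m * (v - v') + -Complex.I * (N₁ α β u v - N₁ α β u' v') := by ring
    rw [this]
    refine (norm_add_le _ _).trans (le_of_eq ?_)
    simp
  have h3 := norm_N₁_sub_le α β u v u' v'
  set w := ‖u - u'‖
  set z := ‖v - v'‖
  set γ := |α| + 4 * |β|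
  have hγ : 0 ≤ γ := by positivity
  have hw : 0 ≤ w := norm_nonneg _
  have h4 := mul_le_mul_of_nonneg_left (h2.trans (add_le_add_right h3 _)) hw
  have h5 : 2 * (w * (w * ‖v‖ ^ 2 + ‖u'‖ * ‖v‖ * z + ‖u'‖ * ‖v'‖ * z)) ≤
      3 * (w ^ 2 * (‖v‖ ^ 2 + ‖v'‖ ^ 2) + z ^ 2 * (‖u‖ ^ 2 + ‖u'‖ ^ 2)) := by
    nlinarith [sq_nonneg (w * ‖v‖ - z * ‖u'‖), sq_nonneg (w * ‖v'‖ - z * ‖u'‖),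
      sq_nonneg (w * ‖v'‖), sq_nonneg (z * ‖u'‖), sq_nonneg (z * ‖u‖)]
  have h6 := mul_le_mul_of_nonneg_left h5 hγ
  have h7 : 2 * (w * (|m| * z)) ≤ |m| * (w ^ 2 + z ^ 2) := by
    nlinarith [mul_nonneg (abs_nonneg m) (sq_nonneg (w - z))]
  linarith

/-! ### A priori bounds and stability -/

/-- Solutions on the strip of the Dirac system whose right-hand side is damped by a factor `ρ`. -/
structure IsDampedSolution (m α β T : ℝ) (ρ : ℝ × ℝ → ℝ) (u v : ℝ × ℝ → ℂ) : Prop where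
  fst : IsC1Strip T u
  snd : IsC1Strip T v
  nonneg : ∀ p, 0 ≤ ρ p
  le_one : ∀ p, ρ p ≤ 1
  eq_fst : ∀ t ∈ Ioo 0 T, ∀ x, fderiv ℝ u (t, x) (1, 1) =
    ρ (t, x) • (-Complex.I * (-(m : ℂ) * v (t, x) + N₁ α β (u (t, x)) (v (t, x))))
  eq_snd : ∀ t ∈ Ioo 0 T, ∀ x, fderiv ℝ v (t, x) (1, -1) =
    ρ (t, x) • (-Complex.I * (-(m : ℂ) * u (t, x) + N₁ α β (v (t, x)) (u (t, x))))

theorem IsC1Strip.norm_sq {T : ℝ} {u : ℝ × ℝ → ℂ} (hu : IsC1Strip T u) :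
    IsC1Strip T fun p => ‖u p‖ ^ 2 :=
  hu.comp_contDiff (g := fun z : ℂ => ‖z‖ ^ 2) (contDiff_norm_sq ℝ)

theorem IsC1Strip.fderiv_norm_sq {T : ℝ} {u : ℝ × ℝ → ℂ} (hu : IsC1Strip T u) {t : ℝ}
    (ht : t ∈ Ioo 0 T) (x c : ℝ) :
    fderiv ℝ (fun p => ‖u p‖ ^ 2) (t, x) (1, c) =
      2 * inner ℝ (u (t, x)) (fderiv ℝ u (t, x) (1, c)) := by
  have := hu.norm_sq.fderiv_line_eq (x := x - c * t) (c := c) ht (hu.hasDerivAt_line ht).norm_sq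
  simpa using this

theorem IsC1Strip.fderiv_sub_apply {T : ℝ} {u v : ℝ × ℝ → ℂ} (hu : IsC1Strip T u)
    (hv : IsC1Strip T v) {t : ℝ} (ht : t ∈ Ioo 0 T) (x : ℝ) (e : ℝ × ℝ) :
    fderiv ℝ (fun p => u p - v p) (t, x) e = fderiv ℝ u (t, x) e - fderiv ℝ v (t, x) e := by
  have hp : (t, x) ∈ openStrip T := ⟨ht, mem_univ _⟩
  rw [show fderiv ℝ (fun p => u p - v p) (t, x) = _ from
    ((hu.hasFDerivAt hp).sub (hv.hasFDerivAt hp)).fderiv]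
  rfl

namespace IsDampedSolution

variable {m α β T L : ℝ} {ρ : ℝ × ℝ → ℝ} {u v : ℝ × ℝ → ℂ}

/-- The system is invariant under x ↦ -x combined with the exchange of u and v. -/
theorem reflect (h : IsDampedSolution m α β T ρ u v) :
    IsDampedSolution m α β T (fun p => ρ (p.1, -p.2)) (fun p => v (p.1, -p.2))
      (fun p => u (p.1, -p.2)) where
  fst := h.snd.reflect
  snd := h.fst.reflect
  nonneg _ := h.nonneg _
  le_one _ := h.le_one _
  eq_fst t ht x := by rw [h.snd.fderiv_reflect ht, h.eq_snd t ht]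
  eq_snd t ht x := by rw [h.fst.fderiv_reflect ht, neg_neg, h.eq_fst t ht]

/-- The damping is real and common to both equations, so it does not disturb the cancellation of the
exchange terms. -/
theorem charge_identity (h : IsDampedSolution m α β T ρ u v) {t : ℝ} (ht : t ∈ Ioo 0 T) (x : ℝ) :
    fderiv ℝ (fun p => ‖u p‖ ^ 2) (t, x) (1, 1) + fderiv ℝ (fun p => ‖v p‖ ^ 2) (t, x) (1, -1) ≤ 0 := by
  rw [h.fst.fderiv_norm_sq ht, h.snd.fderiv_norm_sq ht, h.eq_fst t ht, h.eq_snd t ht,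
    real_inner_smul_right, real_inner_smul_right]
  apply le_of_eq
  linear_combination 2 * ρ (t, x) * inner_rhs_add m α β (u (t, x)) (v (t, x))

theorem growth (h : IsDampedSolution m α β T ρ u v) {t : ℝ} (ht : t ∈ Ioo 0 T) (x : ℝ) :
    fderiv ℝ (fun p => ‖u p‖ ^ 2) (t, x) (1, 1) ≤
      (1 + 4 * |β| * ‖v (t, x)‖ ^ 2) * ‖u (t, x)‖ ^ 2 + m ^ 2 * ‖v (t, x)‖ ^ 2 := by
  rw [h.fst.fderiv_norm_sq ht, h.eq_fst t ht, real_inner_smul_right]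
  refine le_trans ?_ (abs_inner_rhs_le m α β (u (t, x)) (v (t, x)))
  set X := inner ℝ (u (t, x)) (-Complex.I * (-(m : ℂ) * v (t, x) + N₁ α β (u (t, x)) (v (t, x))))
  have h1 := mul_le_mul_of_nonneg_left (le_abs_self X) (h.nonneg (t, x))
  have h2 := mul_le_mul_of_nonneg_right (h.le_one (t, x)) (abs_nonneg X)
  linarith

/-- Conservation of charge and bound of the flux of `|v|²`. -/
theorem flux_snd_le (h : IsDampedSolution m α β T ρ u v)
    (hL : ∀ a b, a ≤ b → ∫ y in a..b, (‖u (0, y)‖ ^ 2 + ‖v (0, y)‖ ^ 2) ≤ L) {t : ℝ}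
    (ht : t ∈ Icc 0 T) :
    (∀ a b, a ≤ b → ∫ y in a..b, (‖u (t, y)‖ ^ 2 + ‖v (t, y)‖ ^ 2) ≤ L) ∧
    ∀ x, ∫ s in 0..t, ‖v (s, x + s)‖ ^ 2 ≤ L :=
  flux_le h.fst.norm_sq h.snd.norm_sq (fun _ _ => by positivity) (fun _ _ => by positivity)
    (fun _ ht x => h.charge_identity ht x) hL ht

/-- The majorant depends on x - t alone, apart from a constant, and its constants do not involve ρ.
The first fact supplies the coefficients of the weight, the second makes truncation harmless. -/
theorem norm_sq_fst_le (h : IsDampedSolution m α β T ρ u v)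
    (hL : ∀ a b, a ≤ b → ∫ y in a..b, (‖u (0, y)‖ ^ 2 + ‖v (0, y)‖ ^ 2) ≤ L) {t : ℝ}
    (ht : t ∈ Icc 0 T) (x : ℝ) :
    ‖u (t, x)‖ ^ 2 ≤ Real.exp (T + 4 * |β| * L) * (‖u (0, x - t)‖ ^ 2 + m ^ 2 * L) :=
  pointwise_le h.fst.norm_sq h.snd.norm_sq (fun _ _ => by positivity) (fun _ _ => by positivity)
    (by positivity) (by positivity) (fun _ ht x => h.charge_identity ht x)
    (fun _ ht x => h.growth ht x) hL ht x

theorem norm_sq_snd_le (h : IsDampedSolution m α β T ρ u v)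
    (hL : ∀ a b, a ≤ b → ∫ y in a..b, (‖u (0, y)‖ ^ 2 + ‖v (0, y)‖ ^ 2) ≤ L) {t : ℝ}
    (ht : t ∈ Icc 0 T) (x : ℝ) :
    ‖v (t, x)‖ ^ 2 ≤ Real.exp (T + 4 * |β| * L) * (‖v (0, x + t)‖ ^ 2 + m ^ 2 * L) := by
  have := h.reflect.norm_sq_fst_le (L := L) (fun a b hab => ?_) ht (-x)
  · simpa [add_comm] using this
  · have := intervalIntegral.integral_comp_neg (a := a) (b := b)
      (fun y => ‖v (0, y)‖ ^ 2 + ‖u (0, y)‖ ^ 2)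
    simp only at this ⊢
    rw [this]
    simpa [add_comm] using hL (-b) (-a) (by linarith)

end IsDampedSolution

/-- The growth factor of the difference of two solutions of charge at most `L` up to time `T`. -/
noncomputable def stabilityConst (m α β T L : ℝ) : ℝ :=
  Real.exp ((2 * |m| + 6 * (|α| + 4 * |β|) * (2 * Real.exp (T + 4 * |β| * L) * (m ^ 2 * L))) * T +
    4 * (3 * (|α| + 4 * |β|) * Real.exp (T + 4 * |β| * L) * (2 * L)))

theorem IsC1Strip.continuous_slice {E : Type*} [NormedAddCommGroup E] [NormedSpace ℝ E] {T : ℝ}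
    {f : ℝ × ℝ → E} (hf : IsC1Strip T f) {t : ℝ} (ht : t ∈ Icc 0 T) : Continuous fun y => f (t, y) :=
  continuousOn_univ.1 (hf.continuousOn.comp (f := fun y => (t, y)) (by fun_prop)
    fun _ _ => ⟨ht, mem_univ _⟩)

/-- `L²`-stability of solutions with respect to the initial data. -/
theorem stability {m α β T L D : ℝ} {ρ ρ' : ℝ × ℝ → ℝ} {u v u' v' : ℝ × ℝ → ℂ}
    (h : IsDampedSolution m α β T ρ u v) (h' : IsDampedSolution m α β T ρ' u' v')
    (hρ : ρ = 1) (hρ' : ρ' = 1)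
    (hL : ∀ a b, a ≤ b → ∫ y in a..b, (‖u (0, y)‖ ^ 2 + ‖v (0, y)‖ ^ 2) ≤ L)
    (hL' : ∀ a b, a ≤ b → ∫ y in a..b, (‖u' (0, y)‖ ^ 2 + ‖v' (0, y)‖ ^ 2) ≤ L)
    (hD : ∀ a b, a ≤ b →
      ∫ y in a..b, (‖u (0, y) - u' (0, y)‖ ^ 2 + ‖v (0, y) - v' (0, y)‖ ^ 2) ≤ D)
    {t : ℝ} (ht : t ∈ Icc 0 T) (a b : ℝ) (hab : a ≤ b) :
    ∫ y in a..b, (‖u (t, y) - u' (t, y)‖ ^ 2 + ‖v (t, y) - v' (t, y)‖ ^ 2) ≤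
      stabilityConst m α β T L * D := by
  subst hρ hρ'
  have h0 : (0 : ℝ) ∈ Icc 0 T := left_mem_Icc.2 (ht.1.trans ht.2)
  have hL0 : 0 ≤ L := by simpa using hL 0 0 le_rfl
  set K := Real.exp (T + 4 * |β| * L) with hK
  have hK0 : 0 < K := Real.exp_pos _
  set γ := |α| + 4 * |β| with hγ
  have hγ0 : 0 ≤ γ := by positivity
  have cu := h.fst.continuous_slice h0
  have cv := h.snd.continuous_slice h0
  have cu' := h'.fst.continuous_slice h0
  have cv' := h'.snd.continuous_slice h0
  -- The integrals of P and Q are at most a multiple of the two charges; for reversed endpoints they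
  -- are nonpositive.
  have bound : ∀ {f g f' g' : ℝ → ℂ}, Continuous f → Continuous g → Continuous f' → Continuous g' →
      (∀ a b, a ≤ b → ∫ y in a..b, (‖f y‖ ^ 2 + ‖g y‖ ^ 2) ≤ L) →
      (∀ a b, a ≤ b → ∫ y in a..b, (‖f' y‖ ^ 2 + ‖g' y‖ ^ 2) ≤ L) → ∀ a b,
      ∫ y in a..b, 3 * γ * K * (‖f y‖ ^ 2 + ‖f' y‖ ^ 2) ≤ 3 * γ * K * (2 * L) := by
    intro f g f' g' cf cg cf' cg' hf hf' a b
    rw [intervalIntegral.integral_const_mul]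
    gcongr
    rcases le_total a b with hab | hab
    · have e : ∫ y in a..b, (‖f y‖ ^ 2 + ‖f' y‖ ^ 2) ≤
          ∫ y in a..b, ((‖f y‖ ^ 2 + ‖g y‖ ^ 2) + (‖f' y‖ ^ 2 + ‖g' y‖ ^ 2)) := by
        refine intervalIntegral.integral_mono_on hab (Continuous.intervalIntegrable (by fun_prop) _ _)
          (Continuous.intervalIntegrable (by fun_prop) _ _) fun y _ => ?_
        nlinarith [sq_nonneg ‖g y‖, sq_nonneg ‖g' y‖]
      rw [intervalIntegral.integral_add (f := fun y => ‖f y‖ ^ 2 + ‖g y‖ ^ 2)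
        (g := fun y => ‖f' y‖ ^ 2 + ‖g' y‖ ^ 2) (Continuous.intervalIntegrable (by fun_prop) _ _)
        (Continuous.intervalIntegrable (by fun_prop) _ _)] at e
      linarith [hf a b hab, hf' a b hab]
    · rw [intervalIntegral.integral_symm]
      have : 0 ≤ ∫ y in b..a, (‖f y‖ ^ 2 + ‖f' y‖ ^ 2) :=
        intervalIntegral.integral_nonneg hab fun y _ => by positivity
      linarith
  refine (weighted_energy (A := fun p => ‖u p - u' p‖ ^ 2) (B := fun p => ‖v p - v' p‖ ^ 2)
    -- M collects the mass coupling and the constant parts m²L of the pointwise bounds; P and Q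
    -- carry the parts that depend on the data. The factor 6γ is twice 3γ because each of the two
    -- difference inequalities contains both products.
    (M := 2 * |m| + 6 * γ * (2 * K * (m ^ 2 * L)))
    (P := fun y => 3 * γ * K * (‖u (0, y)‖ ^ 2 + ‖u' (0, y)‖ ^ 2))
    (Q := fun y => 3 * γ * K * (‖v (0, y)‖ ^ 2 + ‖v' (0, y)‖ ^ 2))
    (κ := 3 * γ * K * (2 * L))
    (h.fst.sub h'.fst).norm_sq (h.snd.sub h'.snd).norm_sq (fun _ _ => by positivity)
    (fun _ _ => by positivity) (by positivity)
    (continuous_const.mul ((cu.norm.pow 2).add (cu'.norm.pow 2)))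
    (continuous_const.mul ((cv.norm.pow 2).add (cv'.norm.pow 2)))
    (bound cu cv cu' cv' hL hL')
    (bound cv cu cv' cu' (fun a b hab => by simpa only [add_comm] using hL a b hab)
      (fun a b hab => by simpa only [add_comm] using hL' a b hab)) ?_ hD ht).1 a b hab
  intro s hs x
  have hs' := Ioo_subset_Icc_self hs
  rw [(h.fst.sub h'.fst).fderiv_norm_sq hs, (h.snd.sub h'.snd).fderiv_norm_sq hs,
    h.fst.fderiv_sub_apply h'.fst hs, h.snd.fderiv_sub_apply h'.snd hs, h.eq_fst s hs,
    h'.eq_fst s hs, h.eq_snd s hs, h'.eq_snd s hs]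
  simp only [Pi.one_apply, one_smul]
  have e1 := inner_sub_rhs_le m α β (u (s, x)) (v (s, x)) (u' (s, x)) (v' (s, x))
  have e2 := inner_sub_rhs_le m α β (v (s, x)) (u (s, x)) (v' (s, x)) (u' (s, x))
  have p1 := h.norm_sq_fst_le hL hs' x
  have p2 := h'.norm_sq_fst_le hL' hs' x
  have q1 := h.norm_sq_snd_le hL hs' x
  have q2 := h'.norm_sq_snd_le hL' hs' x
  rw [← hK] at p1 p2 q1 q2
  set A := ‖u (s, x) - u' (s, x)‖ ^ 2
  set B := ‖v (s, x) - v' (s, x)‖ ^ 2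
  have hA : 0 ≤ A := by positivity
  have hB : 0 ≤ B := by positivity
  have r1 := mul_le_mul_of_nonneg_left (add_le_add q1 q2) (mul_nonneg (by positivity : 0 ≤ 6 * γ) hA)
  have r2 := mul_le_mul_of_nonneg_left (add_le_add p1 p2) (mul_nonneg (by positivity : 0 ≤ 6 * γ) hB)
  linarith

theorem IsClassicalSolution.isDampedSolution {m α β T : ℝ} {U V : ℝ → ℝ → ℂ}
    (h : IsClassicalSolution m α β T U V) :
    IsDampedSolution m α β T 1 (fun p => U p.1 p.2) (fun p => V p.1 p.2) := by
  have key : ∀ {F : ℝ → ℝ → ℂ}, IsC1Strip T (fun p : ℝ × ℝ => F p.1 p.2) → ∀ t ∈ Ioo 0 T, ∀ x c : ℝ,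
      fderiv ℝ (fun p : ℝ × ℝ => F p.1 p.2) (t, x) (1, c) =
        derivWithin (fun s => F s x) (Icc 0 T) t + c * deriv (fun y => F t y) x := by
    intro F hF t ht x c
    have h1 : HasDerivAt (fun s => F s x) (fderiv ℝ (fun p : ℝ × ℝ => F p.1 p.2) (t, x) (1, 0)) t := by
      simpa using hF.hasDerivAt_line (c := 0) (x := x) ht
    have h2 : HasDerivAt (fun y => F t y) (fderiv ℝ (fun p : ℝ × ℝ => F p.1 p.2) (t, x) (0, 1)) x :=
      hF.hasDerivAt_space ht
    -- At interior times the one-sided derivative is an ordinary one.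
    have hn : Icc 0 T ∈ 𝓝 t := Icc_mem_nhds ht.1 ht.2
    rw [derivWithin_of_mem_nhds hn, h1.deriv, h2.deriv]
    have e : ((1, c) : ℝ × ℝ) = (1, 0) + c • (0, 1) := by ext <;> simp
    rw [e, map_add, map_smul, Complex.real_smul]
  refine ⟨.of_contDiffOn h.1, .of_contDiffOn h.2, fun _ => zero_le_one, fun _ => le_rfl, ?_, ?_⟩
  · intro t ht x
    have := h.eq_fst t (Ioo_subset_Icc_self ht) x
    rw [key (.of_contDiffOn h.1) t ht x, Pi.one_apply, one_smul, ← this, ← mul_assoc]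
    simp
  · intro t ht x
    have := h.eq_snd t (Ioo_subset_Icc_self ht) x
    rw [key (.of_contDiffOn h.2) t ht x, Pi.one_apply, one_smul, ← N₂_eq_N₁, ← this, ← mul_assoc]
    simp [sub_eq_add_neg]

/-! ### The transport equation and Duhamel's formula -/

section duhamel

/-- Solution of the transport equation `(∂ₜ + c ∂ₓ) f = h` with initial value `φ`. -/
noncomputable def duhamel (c : ℝ) (φ : ℝ → ℂ) (h : ℝ × ℝ → ℂ) (p : ℝ × ℝ) : ℂ :=
  φ (p.2 - c * p.1) + ∫ s in 0..p.1, h (s, p.2 - c * p.1 + c * s)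

variable {c : ℝ} {φ φ' : ℝ → ℂ} {h h' : ℝ × ℝ → ℂ}

theorem duhamel_zero_time (x : ℝ) : duhamel c φ h (0, x) = φ x := by simp [duhamel]

theorem continuous_duhamel (hφ : Continuous φ) (hh : Continuous h) : Continuous (duhamel c φ h) := by
  have h1 : Continuous fun p : ℝ × ℝ => φ (p.2 - c * p.1) := hφ.comp (by fun_prop)
  have h2 : Continuous (Function.uncurry fun (p : ℝ × ℝ) s => h (s, p.2 - c * p.1 + c * s)) :=
    hh.comp (f := fun q : (ℝ × ℝ) × ℝ => (q.2, q.1.2 - c * q.1.1 + c * q.2)) (by fun_prop)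
  exact h1.add (intervalIntegral.continuous_parametric_intervalIntegral_of_continuous h2 continuous_fst)

theorem hasDerivAt_primitive_space (hh : Continuous h) (hh' : Continuous h')
    (dh : ∀ s x, HasDerivAt (fun y => h (s, y)) (h' (s, x)) x) (t y : ℝ) :
    HasDerivAt (fun y => ∫ s in 0..t, h (s, y + c * s)) (∫ s in 0..t, h' (s, y + c * s)) y := by
  refine hasDerivAt_intervalIntegral_param (F := fun y s => h (s, y + c * s))
    (F' := fun y s => h' (s, y + c * s)) isOpen_univ (fun y _ s => ?_) ?_ ?_ (mem_univ y)
  · exact (dh s (y + c * s)).comp_add_const y (c * s)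
  · exact (hh.comp (f := fun p : ℝ × ℝ => (p.2, p.1 + c * p.2)) (by fun_prop)).continuousOn
  · exact (hh'.comp (f := fun p : ℝ × ℝ => (p.2, p.1 + c * p.2)) (by fun_prop)).continuousOn

theorem hasDerivAt_duhamel_space (hh : Continuous h) (hh' : Continuous h')
    (dφ : ∀ x, HasDerivAt φ (φ' x) x)
    (dh : ∀ s x, HasDerivAt (fun y => h (s, y)) (h' (s, x)) x) (t x : ℝ) :
    HasDerivAt (fun y => duhamel c φ h (t, y)) (duhamel c φ' h' (t, x)) x :=
  ((dφ _).comp_sub_const x (c * t)).add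
    ((hasDerivAt_primitive_space hh hh' dh t (x - c * t)).comp_sub_const x (c * t))

theorem hasDerivAt_duhamel_line (hh : Continuous h) (t y : ℝ) :
    HasDerivAt (fun s => duhamel c φ h (s, y + c * s)) (h (t, y + c * t)) t := by
  have e : (fun s => duhamel c φ h (s, y + c * s)) = fun s => φ y + ∫ r in 0..s, h (r, y + c * r) := by
    funext s; simp [duhamel]
  rw [e]
  have : Continuous fun r => h (r, y + c * r) :=
    hh.comp (f := fun r : ℝ => (r, y + c * r)) (by fun_prop)
  exact (this.integral_hasStrictDerivAt 0 t).hasDerivAt.const_add _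

theorem contDiff_one_of_partial {f f₁ f₂ : ℝ → ℝ → ℂ}
    (d₁ : ∀ t x, HasDerivAt (fun s => f s x) (f₁ t x) t)
    (d₂ : ∀ t x, HasDerivAt (fun y => f t y) (f₂ t x) x)
    (c₁ : Continuous fun p : ℝ × ℝ => f₁ p.1 p.2) (c₂ : Continuous fun p : ℝ × ℝ => f₂ p.1 p.2) :
    ContDiff ℝ 1 fun p : ℝ × ℝ => f p.1 p.2 := by
  have L : Continuous fun z : ℂ => ContinuousLinearMap.toSpanSingleton ℝ z :=
    (ContinuousLinearMap.toSpanSingletonCLE (𝕜 := ℝ) (E := ℂ)).continuous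
  have key : ∀ p : ℝ × ℝ, HasFDerivAt (fun p : ℝ × ℝ => f p.1 p.2)
      ((ContinuousLinearMap.toSpanSingleton ℝ (f₁ p.1 p.2)).coprod
        (ContinuousLinearMap.toSpanSingleton ℝ (f₂ p.1 p.2))) p := fun p =>
    (hasStrictFDerivAt_uncurry_coprod (f := f)
      (f₁ := fun t x => ContinuousLinearMap.toSpanSingleton ℝ (f₁ t x))
      (f₂ := fun t x => ContinuousLinearMap.toSpanSingleton ℝ (f₂ t x))
      (Eventually.of_forall fun q => (d₁ q.1 q.2).hasFDerivAt)
      (Eventually.of_forall fun q => (d₂ q.1 q.2).hasFDerivAt)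
      (L.comp c₁).continuousAt (L.comp c₂).continuousAt).hasFDerivAt
  rw [contDiff_one_iff_fderiv]
  refine ⟨fun p => (key p).differentiableAt, ?_⟩
  rw [funext fun p => (key p).fderiv]
  have : ∀ p : ℝ × ℝ, (ContinuousLinearMap.toSpanSingleton ℝ (f₁ p.1 p.2)).coprod
        (ContinuousLinearMap.toSpanSingleton ℝ (f₂ p.1 p.2)) =
      (ContinuousLinearMap.toSpanSingleton ℝ (f₁ p.1 p.2)).comp (ContinuousLinearMap.fst ℝ ℝ ℝ) +
      (ContinuousLinearMap.toSpanSingleton ℝ (f₂ p.1 p.2)).comp (ContinuousLinearMap.snd ℝ ℝ ℝ) :=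
    fun p => by ext <;> simp
  rw [funext this]
  exact ((L.comp c₁).clm_comp continuous_const).add ((L.comp c₂).clm_comp continuous_const)

/-- In the coordinates (t, x - ct) both partial derivatives are explicit and continuous: the source
needs a derivative in x only, none in t. -/
theorem contDiff_duhamel (hh : Continuous h) (hh' : Continuous h') (hφ' : Continuous φ')
    (dφ : ∀ x, HasDerivAt φ (φ' x) x)
    (dh : ∀ s x, HasDerivAt (fun y => h (s, y)) (h' (s, x)) x) : ContDiff ℝ 1 (duhamel c φ h) := by
  have key : ContDiff ℝ 1 fun p : ℝ × ℝ => φ p.2 + ∫ s in 0..p.1, h (s, p.2 + c * s) := by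
    refine contDiff_one_of_partial (f := fun t y => φ y + ∫ s in 0..t, h (s, y + c * s))
      (f₁ := fun t y => h (t, y + c * t)) (f₂ := fun t y => φ' y + ∫ s in 0..t, h' (s, y + c * s))
      (fun t y => ?_) (fun t y => ?_) ?_ ?_
    · have : Continuous fun r => h (r, y + c * r) :=
        hh.comp (f := fun r : ℝ => (r, y + c * r)) (by fun_prop)
      exact (this.integral_hasStrictDerivAt 0 t).hasDerivAt.const_add _
    · exact (dφ y).add (hasDerivAt_primitive_space hh hh' dh t y)
    · exact hh.comp (f := fun p : ℝ × ℝ => (p.1, p.2 + c * p.1)) (by fun_prop)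
    · refine (hφ'.comp continuous_snd).add ?_
      have h2 : Continuous (Function.uncurry fun (p : ℝ × ℝ) s => h' (s, p.2 + c * s)) :=
        hh'.comp (f := fun q : (ℝ × ℝ) × ℝ => (q.2, q.1.2 + c * q.2)) (by fun_prop)
      exact intervalIntegral.continuous_parametric_intervalIntegral_of_continuous h2 continuous_fst
  exact key.comp (by fun_prop : ContDiff ℝ 1 fun p : ℝ × ℝ => (p.1, p.2 - c * p.1))

theorem fderiv_duhamel_line (hd : ContDiff ℝ 1 (duhamel c φ h)) (hh : Continuous h) (t x : ℝ) :
    fderiv ℝ (duhamel c φ h) (t, x) (1, c) = h (t, x) := by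
  have h1 : HasDerivAt (fun s : ℝ => (s, (x - c * t) + c * s)) (1, c) t := by
    have := ((hasDerivAt_id t).const_mul c).const_add (x - c * t)
    exact (hasDerivAt_id t).prodMk (by simpa using this)
  have h2 := ((hd.differentiable one_ne_zero (t, (x - c * t) + c * t)).hasFDerivAt).comp_hasDerivAt
    (f := fun s : ℝ => (s, (x - c * t) + c * s)) t h1
  have := h2.unique (hasDerivAt_duhamel_line hh t (x - c * t))
  simpa using this

/-- Integrating e^{λs} gains 1/λ; with λ large the iteration contracts on all of [0, T] at once. -/
theorem norm_duhamel_le {R C lam t : ℝ} (hlam : 0 < lam) (ht : 0 ≤ t) (hφ : ∀ x, ‖φ x‖ ≤ R)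
    (hC : 0 ≤ C) (hb : ∀ s ∈ Icc 0 t, ∀ x, ‖h (s, x)‖ ≤ C * Real.exp (lam * s)) (x : ℝ) :
    ‖duhamel c φ h (t, x)‖ ≤ R + C / lam * Real.exp (lam * t) := by
  refine (norm_add_le _ _).trans (add_le_add (hφ _) ?_)
  have h1 : ‖∫ s in 0..t, h (s, x - c * t + c * s)‖ ≤ ∫ s in 0..t, C * Real.exp (lam * s) :=
    intervalIntegral.norm_integral_le_of_norm_le ht
      (ae_of_all _ fun s hs => hb s (Ioc_subset_Icc_self hs) _)
      (Continuous.intervalIntegrable (by fun_prop) _ _)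
  have h2 : ∫ s in 0..t, C * Real.exp (lam * s) =
      C / lam * Real.exp (lam * t) - C / lam * Real.exp (lam * 0) := by
    refine intervalIntegral.integral_eq_sub_of_hasDerivAt (f := fun s => C / lam * Real.exp (lam * s))
      (fun s _ => ?_) (Continuous.intervalIntegrable (by fun_prop) _ _)
    refine (((hasDerivAt_id s).const_mul lam).exp.const_mul (C / lam)).congr_deriv ?_
    simp only [id]
    field_simp
  rw [h2] at h1
  have : 0 ≤ C / lam * Real.exp (lam * 0) := by positivity
  exact h1.trans (by linarith)

theorem duhamel_sub_duhamel {h₁ h₂ : ℝ × ℝ → ℂ} (hh₁ : Continuous h₁) (hh₂ : Continuous h₂)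
    (p : ℝ × ℝ) : duhamel c φ h₁ p - duhamel c φ h₂ p = duhamel c 0 (fun q => h₁ q - h₂ q) p := by
  have e : ∀ {g : ℝ × ℝ → ℂ}, Continuous g →
      IntervalIntegrable (fun s => g (s, p.2 - c * p.1 + c * s)) volume 0 p.1 := fun {g} hg =>
    (hg.comp (f := fun s : ℝ => (s, p.2 - c * p.1 + c * s)) (by fun_prop)).intervalIntegrable _ _
  simp only [duhamel, add_sub_add_left_eq_sub, Pi.zero_apply, zero_add]
  rw [intervalIntegral.integral_sub (e hh₁) (e hh₂)]

/-- Finite speed of propagation: a characteristic of speed at most 1, followed backwards from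
outside the cone, stays outside. -/
theorem duhamel_eq_zero {r t x : ℝ} (hc : |c| ≤ 1) (ht : 0 ≤ t) (hφ : ∀ x, r < |x| → φ x = 0)
    (hh : ∀ s ∈ Icc 0 t, ∀ x, r + s < |x| → h (s, x) = 0) (hx : r + t < |x|) :
    duhamel c φ h (t, x) = 0 := by
  have key : ∀ s ∈ Icc 0 t, r + s < |x - c * t + c * s| := by
    intro s hs
    have h1 : |x| ≤ |x - c * t + c * s| + |c * (t - s)| := by
      have := abs_add_le (x - c * t + c * s) (c * (t - s))
      rwa [show x - c * t + c * s + c * (t - s) = x by ring] at this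
    have h2 : |c * (t - s)| ≤ t - s := by
      rw [abs_mul, abs_of_nonneg (sub_nonneg.2 hs.2)]
      nlinarith [sub_nonneg.2 hs.2]
    linarith
  rw [duhamel, hφ, zero_add]
  · refine (intervalIntegral.integral_congr fun s hs => ?_).trans intervalIntegral.integral_zero
    rw [uIcc_of_le ht] at hs
    exact hh s hs _ (key s hs)
  · simpa using key 0 (left_mem_Icc.2 ht)

end duhamel

/-- The Duhamel operator of the system with speeds `1` and `-1`, with time restricted to `[0, T]`. -/
noncomputable def duhamelPair (T : ℝ) (φ : ℝ → ℂ × ℂ) (h : ℝ × ℝ → ℂ × ℂ) (p : ℝ × ℝ) : ℂ × ℂ :=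
  (duhamel 1 (fun y => (φ y).1) (fun q => (h q).1) (clamp T p.1, p.2),
    duhamel (-1) (fun y => (φ y).2) (fun q => (h q).2) (clamp T p.1, p.2))

section duhamelPair

variable {T : ℝ} {φ φ' : ℝ → ℂ × ℂ} {h h' : ℝ × ℝ → ℂ × ℂ}

theorem continuous_duhamelPair (hφ : Continuous φ) (hh : Continuous h) :
    Continuous (duhamelPair T φ h) := by
  have := continuous_clamp T
  have e : Continuous fun p : ℝ × ℝ => (clamp T p.1, p.2) := by fun_prop
  exact ((continuous_duhamel hφ.fst hh.fst).comp e).prodMk ((continuous_duhamel hφ.snd hh.snd).comp e)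

theorem hasDerivAt_duhamelPair (hh : Continuous h) (hh' : Continuous h')
    (dφ : ∀ x, HasDerivAt φ (φ' x) x)
    (dh : ∀ s x, HasDerivAt (fun y => h (s, y)) (h' (s, x)) x) (t x : ℝ) :
    HasDerivAt (fun y => duhamelPair T φ h (t, y)) (duhamelPair T φ' h' (t, x)) x := by
  refine HasDerivAt.prodMk ?_ ?_
  · exact hasDerivAt_duhamel_space (c := 1) (φ := fun y => (φ y).1) (φ' := fun y => (φ' y).1) hh.fst hh'.fst
      (fun x => (ContinuousLinearMap.fst ℝ ℂ ℂ).hasFDerivAt.comp_hasDerivAt x (dφ x))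
      (fun s x => (ContinuousLinearMap.fst ℝ ℂ ℂ).hasFDerivAt.comp_hasDerivAt x (dh s x)) (clamp T t) x
  · exact hasDerivAt_duhamel_space (c := (-1)) (φ := fun y => (φ y).2) (φ' := fun y => (φ' y).2) hh.snd hh'.snd
      (fun x => (ContinuousLinearMap.snd ℝ ℂ ℂ).hasFDerivAt.comp_hasDerivAt x (dφ x))
      (fun s x => (ContinuousLinearMap.snd ℝ ℂ ℂ).hasFDerivAt.comp_hasDerivAt x (dh s x)) (clamp T t) x

theorem norm_duhamelPair_le (hT : 0 ≤ T) {R C lam : ℝ} (hlam : 0 < lam) (hφ : ∀ x, ‖φ x‖ ≤ R)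
    (hC : 0 ≤ C) (hb : ∀ p : ℝ × ℝ, ‖h p‖ ≤ C * Real.exp (lam * clamp T p.1)) (p : ℝ × ℝ) :
    ‖duhamelPair T φ h p‖ ≤ R + C / lam * Real.exp (lam * clamp T p.1) := by
  have ht := clamp_mem hT p.1
  have hb' : ∀ s ∈ Icc 0 (clamp T p.1), ∀ x, ‖h (s, x)‖ ≤ C * Real.exp (lam * s) := fun s hs x => by
    have := hb (s, x)
    simp only at this
    rwa [clamp_of_mem ⟨hs.1, hs.2.trans ht.2⟩] at this
  refine norm_prod_le_iff.2 ⟨?_, ?_⟩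
  · exact norm_duhamel_le hlam ht.1 (fun x => (norm_fst_le _).trans (hφ x)) hC
      (fun s hs x => (norm_fst_le _).trans (hb' s hs x)) _
  · exact norm_duhamel_le hlam ht.1 (fun x => (norm_snd_le _).trans (hφ x)) hC
      (fun s hs x => (norm_snd_le _).trans (hb' s hs x)) _

theorem norm_duhamelPair_sub_le (hT : 0 ≤ T) {C lam : ℝ} (hlam : 0 < lam)
    (hh : Continuous h) (hh' : Continuous h') (hC : 0 ≤ C)
    (hb : ∀ p : ℝ × ℝ, ‖h p - h' p‖ ≤ C * Real.exp (lam * clamp T p.1)) (p : ℝ × ℝ) :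
    ‖duhamelPair T φ h p - duhamelPair T φ h' p‖ ≤ C / lam * Real.exp (lam * clamp T p.1) := by
  have e : duhamelPair T φ h p - duhamelPair T φ h' p = duhamelPair T 0 (fun q => h q - h' q) p :=
    Prod.ext (duhamel_sub_duhamel hh.fst hh'.fst _) (duhamel_sub_duhamel hh.snd hh'.snd _)
  rw [e]
  have := norm_duhamelPair_le (φ := 0) (R := 0) hT hlam (by simp) hC hb p
  rwa [zero_add] at this

theorem duhamelPair_eq_zero (hT : 0 ≤ T) {r : ℝ} (hφ : ∀ x, r < |x| → φ x = 0)
    (hh : ∀ t x, r + clamp T t < |x| → h (t, x) = 0) {t x : ℝ} (hx : r + clamp T t < |x|) :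
    duhamelPair T φ h (t, x) = 0 := by
  have ht := clamp_mem hT t
  have hh' : ∀ s ∈ Icc 0 (clamp T t), ∀ x, r + s < |x| → h (s, x) = 0 := fun s hs x hx => by
    refine hh s x ?_
    rwa [clamp_of_mem ⟨hs.1, hs.2.trans ht.2⟩]
  refine Prod.ext ?_ ?_
  · exact duhamel_eq_zero (φ := fun y => (φ y).1) (h := fun q => (h q).1) (by norm_num) ht.1
      (fun x hx => congrArg Prod.fst (hφ x hx)) (fun s hs x hx => congrArg Prod.fst (hh' s hs x hx)) hx
  · exact duhamel_eq_zero (φ := fun y => (φ y).2) (h := fun q => (h q).2) (by norm_num) ht.1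
      (fun x hx => congrArg Prod.snd (hφ x hx)) (fun s hs x hx => congrArg Prod.snd (hh' s hs x hx)) hx

end duhamelPair

/-! ### Picard iteration with control of the space derivative -/

/-- Picard iterates for the unknown and its space derivative. -/
noncomputable def picard (T : ℝ) (φ φ' : ℝ → ℂ × ℂ) (F : ℂ × ℂ → ℂ × ℂ) :
    ℕ → (ℝ × ℝ → ℂ × ℂ) × (ℝ × ℝ → ℂ × ℂ)
  | 0 => (0, 0)
  | k + 1 => (duhamelPair T φ fun p => F ((picard T φ φ' F k).1 p),
      duhamelPair T φ' fun p => fderiv ℝ F ((picard T φ φ' F k).1 p) ((picard T φ φ' F k).2 p))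

section picard

variable {T : ℝ} {φ φ' : ℝ → ℂ × ℂ} {F : ℂ × ℂ → ℂ × ℂ} {Λ Λ₂ : ℝ≥0} {R : ℝ}

theorem continuous_picard (hφ : Continuous φ) (hφ' : Continuous φ') (hF : ContDiff ℝ 1 F) (k : ℕ) :
    Continuous (picard T φ φ' F k).1 ∧ Continuous (picard T φ φ' F k).2 := by
  induction k with
  | zero => exact ⟨continuous_const, continuous_const⟩
  | succ k ih =>
    exact ⟨continuous_duhamelPair hφ (hF.continuous.comp ih.1), continuous_duhamelPair hφ'
      (((hF.continuous_fderiv one_ne_zero).comp ih.1).clm_apply ih.2)⟩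

theorem continuous_fderiv_picard (hφ : Continuous φ) (hφ' : Continuous φ') (hF : ContDiff ℝ 1 F)
    (k : ℕ) : Continuous fun p =>
      fderiv ℝ F ((picard T φ φ' F k).1 p) ((picard T φ φ' F k).2 p) :=
  ((hF.continuous_fderiv one_ne_zero).comp (continuous_picard hφ hφ' hF k).1).clm_apply
    (continuous_picard hφ hφ' hF k).2

theorem hasDerivAt_picard (dφ : ∀ x, HasDerivAt φ (φ' x) x) (hφ' : Continuous φ')
    (hF : ContDiff ℝ 1 F) (k : ℕ) (t x : ℝ) :
    HasDerivAt (fun y => (picard T φ φ' F k).1 (t, y)) ((picard T φ φ' F k).2 (t, x)) x := by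
  have hφ : Continuous φ := continuous_iff_continuousAt.2 fun x => (dφ x).continuousAt
  induction k generalizing t x with
  | zero => exact hasDerivAt_const _ _
  | succ k ih =>
    exact hasDerivAt_duhamelPair (hF.continuous.comp (continuous_picard hφ hφ' hF k).1)
      (continuous_fderiv_picard hφ hφ' hF k) dφ (fun s x =>
        ((hF.differentiable one_ne_zero _).hasFDerivAt).comp_hasDerivAt x (ih s x)) t x

/-- With λ = 2Λ the integral term is half of the assumed bound, so R plus that half closes the
induction. This uniform bound is needed because differences of `fderiv ℝ F` are applied to these
iterates. -/
theorem norm_picard_snd_le (hT : 0 ≤ T) (hR : ∀ x, ‖φ' x‖ ≤ R) (hΛ : 0 < Λ) (hFL : LipschitzWith Λ F)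
    (k : ℕ) (p : ℝ × ℝ) :
    ‖(picard T φ φ' F k).2 p‖ ≤ 2 * R * Real.exp (2 * Λ * clamp T p.1) := by
  have hR0 : 0 ≤ R := (norm_nonneg _).trans (hR 0)
  have hΛ' : (0 : ℝ) < Λ := hΛ
  induction k generalizing p with
  | zero => simp only [picard, Pi.zero_apply, norm_zero]; positivity
  | succ k ih =>
    have h1 := norm_duhamelPair_le (φ := φ') (C := Λ * (2 * R)) (lam := 2 * Λ) hT (by positivity) hR
      (by positivity)
      (h := fun p => fderiv ℝ F ((picard T φ φ' F k).1 p) ((picard T φ φ' F k).2 p)) (fun p => by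
        refine (ContinuousLinearMap.le_opNorm _ _).trans ?_
        rw [mul_assoc]
        exact mul_le_mul (norm_fderiv_le_of_lipschitz ℝ hFL) (ih p) (norm_nonneg _) (by positivity)) p
    refine h1.trans ?_
    have h2 : 1 ≤ Real.exp (2 * Λ * clamp T p.1) :=
      Real.one_le_exp (mul_nonneg (by positivity) (clamp_mem hT _).1)
    rw [show (Λ : ℝ) * (2 * R) / (2 * Λ) = R by field_simp]
    nlinarith

/-- The pair (iterate, derivative) is compared in the sup norm weighted by e^{-λt}. The Lipschitz
constant of the combined map is at most Λ + Λ₂ times the uniform bound of the derivatives, and λ is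
at least twice that, giving the ratio 1/2. -/
theorem dist_picard_le (hT : 0 ≤ T) (dφ : ∀ x, HasDerivAt φ (φ' x) x) (hφ' : Continuous φ')
    (hR : ∀ x, ‖φ x‖ ≤ R) (hR' : ∀ x, ‖φ' x‖ ≤ R) (hF : ContDiff ℝ 1 F) (hF0 : F 0 = 0) (hΛ : 0 < Λ)
    (hFL : LipschitzWith Λ F) (hFL₂ : LipschitzWith Λ₂ (fderiv ℝ F)) {lam : ℝ}
    (hlam : 2 * (Λ + Λ₂ * (2 * R * Real.exp (2 * Λ * T))) ≤ lam) (k : ℕ) (p : ℝ × ℝ) :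
    ‖(picard T φ φ' F (k + 1)).1 p - (picard T φ φ' F k).1 p‖ ≤
        R * (1 / 2) ^ k * Real.exp (lam * clamp T p.1) ∧
      ‖(picard T φ φ' F (k + 1)).2 p - (picard T φ φ' F k).2 p‖ ≤
        R * (1 / 2) ^ k * Real.exp (lam * clamp T p.1) := by
  have hφ : Continuous φ := continuous_iff_continuousAt.2 fun x => (dφ x).continuousAt
  have hR0 : 0 ≤ R := (norm_nonneg _).trans (hR 0)
  have hΛ' : (0 : ℝ) < Λ := hΛ
  set S := 2 * R * Real.exp (2 * Λ * T) with hS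
  have hS0 : 0 ≤ S := by positivity
  have hSΛ : 0 ≤ Λ₂ * S := by positivity
  have hlam0 : 0 < lam := by linarith
  induction k generalizing p with
  | zero =>
    have h1 : 1 ≤ Real.exp (lam * clamp T p.1) :=
      Real.one_le_exp (mul_nonneg hlam0.le (clamp_mem hT _).1)
    have h2 : ∀ ψ : ℝ → ℂ × ℂ, (∀ x, ‖ψ x‖ ≤ R) →
        ‖duhamelPair T ψ (fun _ => 0) p‖ ≤ R * Real.exp (lam * clamp T p.1) := fun ψ hψ => by
      have := norm_duhamelPair_le (φ := ψ) (h := fun _ => 0) hT hlam0 hψ le_rfl (by simp) p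
      rw [zero_div, zero_mul, add_zero] at this
      nlinarith
    simp only [picard, Pi.zero_apply, sub_zero, hF0, map_zero, pow_zero, mul_one]
    exact ⟨h2 φ hR, h2 φ' hR'⟩
  | succ k ih =>
    have cW := fun k => continuous_picard (T := T) hφ hφ' hF k
    set C := R * (1 / 2) ^ k with hC
    have hC0 : 0 ≤ C := by positivity
    have hhalf : ∀ X : ℝ, X ≤ Λ + Λ₂ * S →
        X * C / lam * Real.exp (lam * clamp T p.1) ≤
          R * (1 / 2) ^ (k + 1) * Real.exp (lam * clamp T p.1) := by
      intro X hX
      gcongr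
      rw [div_le_iff₀ hlam0, pow_succ]
      have : X ≤ lam / 2 := by linarith
      have := mul_le_mul_of_nonneg_right this hC0
      linarith
    constructor
    · have h1 := norm_duhamelPair_sub_le (φ := φ) (C := Λ * C) hT hlam0 (hF.continuous.comp (cW (k + 1)).1)
        (hF.continuous.comp (cW k).1) (by positivity) (fun q => by
          refine (hFL.norm_sub_le _ _).trans ?_
          rw [mul_assoc]
          exact mul_le_mul_of_nonneg_left (ih q).1 hΛ'.le) p
      exact h1.trans (hhalf Λ (by linarith))
    · have h1 := norm_duhamelPair_sub_le (φ := φ') (C := (Λ + Λ₂ * S) * C) hT hlam0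
        (continuous_fderiv_picard hφ hφ' hF (k + 1)) (continuous_fderiv_picard hφ hφ' hF k)
        (by positivity) (fun q => by
          have e : fderiv ℝ F ((picard T φ φ' F (k + 1)).1 q) ((picard T φ φ' F (k + 1)).2 q) -
              fderiv ℝ F ((picard T φ φ' F k).1 q) ((picard T φ φ' F k).2 q) =
              fderiv ℝ F ((picard T φ φ' F (k + 1)).1 q)
                ((picard T φ φ' F (k + 1)).2 q - (picard T φ φ' F k).2 q) +
              (fderiv ℝ F ((picard T φ φ' F (k + 1)).1 q) - fderiv ℝ F ((picard T φ φ' F k).1 q))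
                ((picard T φ φ' F k).2 q) := by
            rw [map_sub, sub_apply]; abel
          rw [e]
          refine (norm_add_le _ _).trans ?_
          have a1 := (fderiv ℝ F ((picard T φ φ' F (k + 1)).1 q)).le_of_opNorm_le_of_le
            (norm_fderiv_le_of_lipschitz ℝ hFL) (ih q).2
          have hS' : ‖(picard T φ φ' F k).2 q‖ ≤ S := by
            refine (norm_picard_snd_le hT hR' hΛ hFL k q).trans ?_
            have := (clamp_mem hT q.1).2
            rw [hS]
            gcongr
          have a2 := (fderiv ℝ F ((picard T φ φ' F (k + 1)).1 q) -
              fderiv ℝ F ((picard T φ φ' F k).1 q)).le_of_opNorm_le_of_le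
            ((hFL₂.norm_sub_le _ _).trans (mul_le_mul_of_nonneg_left (ih q).1 Λ₂.2)) hS'
          refine (add_le_add a1 a2).trans (le_of_eq ?_)
          ring) p
      exact h1.trans (hhalf _ le_rfl)

theorem picard_eq_zero (hT : 0 ≤ T) (hF0 : F 0 = 0) {r : ℝ} (hφ : ∀ x, r < |x| → φ x = 0) (k : ℕ)
    {t x : ℝ} (hx : r + clamp T t < |x|) : (picard T φ φ' F k).1 (t, x) = 0 := by
  induction k generalizing t x with
  | zero => rfl
  | succ k ih => exact duhamelPair_eq_zero hT hφ (fun t x hx => by rw [ih hx, hF0]) hx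

theorem tendstoUniformly_of_geometric {X E : Type*} [NormedAddCommGroup E] [CompleteSpace E]
    {w : ℕ → X → E} {C : ℝ} (h : ∀ k p, ‖w (k + 1) p - w k p‖ ≤ C * (1 / 2) ^ k) :
    ∃ W : X → E, TendstoUniformly w W atTop ∧ ∀ k p, ‖w k p - W p‖ ≤ C * (1 / 2) ^ k * 2 := by
  have h' : ∀ p k, dist (w k p) (w (k + 1) p) ≤ C * (1 / 2) ^ k := fun p k => by
    rw [dist_comm, dist_eq_norm]; exact h k p
  have hr : (1 / 2 : ℝ) < 1 := by norm_num
  choose W hW using fun p => cauchySeq_tendsto_of_complete (cauchySeq_of_le_geometric _ _ hr (h' p))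
  have hd : ∀ k p, ‖w k p - W p‖ ≤ C * (1 / 2) ^ k * 2 := fun k p => by
    have := dist_le_of_le_geometric_of_tendsto _ _ hr (h' p) (hW p) k
    rw [dist_eq_norm] at this
    refine this.trans (le_of_eq ?_)
    norm_num; ring
  refine ⟨W, Metric.tendstoUniformly_iff.2 fun ε hε => ?_, hd⟩
  have ht : Tendsto (fun k : ℕ => C * (1 / 2 : ℝ) ^ k * 2) atTop (𝓝 0) := by
    have := ((tendsto_pow_atTop_nhds_zero_of_lt_one (by norm_num) hr).const_mul C).mul_const 2
    simpa using this
  filter_upwards [ht.eventually_lt_const hε] with k hk p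
  rw [dist_comm, dist_eq_norm]
  exact (hd k p).trans_lt hk

/-- Solvability of a semilinear first-order system with globally Lipschitz nonlinearity. -/
theorem exists_fixedPoint (hT : 0 ≤ T) (dφ : ∀ x, HasDerivAt φ (φ' x) x) (hφ' : Continuous φ')
    (hR : ∀ x, ‖φ x‖ ≤ R) (hR' : ∀ x, ‖φ' x‖ ≤ R) (hF : ContDiff ℝ 1 F) (hF0 : F 0 = 0) (hΛ : 0 < Λ)
    (hFL : LipschitzWith Λ F) (hFL₂ : LipschitzWith Λ₂ (fderiv ℝ F)) {r : ℝ}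
    (hφ0 : ∀ x, r < |x| → φ x = 0) :
    ∃ W P : ℝ × ℝ → ℂ × ℂ, Continuous W ∧ Continuous P ∧
      (∀ t x, HasDerivAt (fun y => W (t, y)) (P (t, x)) x) ∧
      W = duhamelPair T φ (fun p => F (W p)) ∧
      ∀ t x, r + clamp T t < |x| → W (t, x) = 0 := by
  have hφ : Continuous φ := continuous_iff_continuousAt.2 fun x => (dφ x).continuousAt
  have hR0 : 0 ≤ R := (norm_nonneg _).trans (hR 0)
  have hΛ' : (0 : ℝ) < Λ := hΛ
  set lam := 2 * (Λ + Λ₂ * (2 * R * Real.exp (2 * Λ * T))) with hlam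
  have hlam0 : 0 < lam := by positivity
  have hexp : ∀ p : ℝ × ℝ, Real.exp (lam * clamp T p.1) ≤ Real.exp (lam * T) := fun p => by
    have := (clamp_mem hT p.1).2
    gcongr
  have hd := dist_picard_le hT dφ hφ' hR hR' hF hF0 hΛ hFL hFL₂ hlam.ge
  have hgeo : ∀ (k : ℕ) (p : ℝ × ℝ), R * (1 / 2) ^ k * Real.exp (lam * clamp T p.1) ≤
      R * Real.exp (lam * T) * (1 / 2) ^ k := fun k p => by
    have := mul_le_mul_of_nonneg_left (hexp p) (by positivity : 0 ≤ R * (1 / 2) ^ k)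
    linarith
  obtain ⟨W, hW, hWd⟩ := tendstoUniformly_of_geometric
    (w := fun k => (picard T φ φ' F k).1) fun k p => (hd k p).1.trans (hgeo k p)
  obtain ⟨P, hP, -⟩ := tendstoUniformly_of_geometric
    (w := fun k => (picard T φ φ' F k).2) fun k p => (hd k p).2.trans (hgeo k p)
  have cW : Continuous W := hW.continuous (Eventually.of_forall fun k => (continuous_picard hφ hφ' hF k).1).frequently
  have cP : Continuous P := hP.continuous (Eventually.of_forall fun k => (continuous_picard hφ hφ' hF k).2).frequently
  refine ⟨W, P, cW, cP, fun t x => ?_, ?_, fun t x hx => ?_⟩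
  -- The derivatives converge uniformly as well, so the limit is differentiable in x with the
  -- limiting derivative.
  · refine hasDerivAt_of_tendstoUniformly (f := fun k y => (picard T φ φ' F k).1 (t, y))
      (f' := fun k y => (picard T φ φ' F k).2 (t, y)) (l := atTop) (g := fun y => W (t, y))
      (g' := fun y => P (t, y)) (hP.comp fun y => (t, y))
      (Eventually.of_forall fun k x => hasDerivAt_picard dφ hφ' hF k t x)
      (fun x => hW.tendsto_at (t, x)) x
  -- The iterates converge to W by construction, and to the Duhamel integral of F(W) because F is
  -- Lipschitz. No contraction is needed here, so λ = 1 suffices.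
  · funext p
    refine tendsto_nhds_unique ((hW.tendsto_at p).comp (tendsto_add_atTop_nat 1)) ?_
    rw [tendsto_iff_norm_sub_tendsto_zero]
    set B := R * Real.exp (lam * T) with hB
    have hB0 : 0 ≤ B := by positivity
    have ht : Tendsto (fun k : ℕ => Λ * (B * (1 / 2 : ℝ) ^ k * 2) / 1 * Real.exp (1 * clamp T p.1))
        atTop (𝓝 0) := by
      have := ((((tendsto_pow_atTop_nhds_zero_of_lt_one (by norm_num)
        (by norm_num : (1 / 2 : ℝ) < 1)).const_mul B).mul_const 2).const_mul
          (Λ : ℝ)).div_const 1 |>.mul_const (Real.exp (1 * clamp T p.1))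
      simpa using this
    refine squeeze_zero (fun _ => norm_nonneg _) (fun k => ?_) ht
    refine norm_duhamelPair_sub_le hT one_pos (hF.continuous.comp (continuous_picard hφ hφ' hF k).1)
      (hF.continuous.comp cW) (by positivity) (fun q => ?_) p
    have h1 : 1 ≤ Real.exp (1 * clamp T q.1) :=
      Real.one_le_exp (mul_nonneg zero_le_one (clamp_mem hT _).1)
    have h2 := (hFL.norm_sub_le ((picard T φ φ' F k).1 q) (W q)).trans
      (mul_le_mul_of_nonneg_left (hWd k q) hΛ'.le)
    exact h2.trans (le_mul_of_one_le_right (by positivity) h1)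
  · have := hW.tendsto_at (t, x)
    refine tendsto_nhds_unique this ?_
    rw [funext fun k => picard_eq_zero hT hF0 hφ0 k hx]
    exact tendsto_const_nhds

end picard

/-! ### Classical solutions for smooth compactly supported data -/

theorem intervalIntegral_le_integral {f : ℝ → ℝ} (hf : Integrable f) (h0 : ∀ x, 0 ≤ f x) {a b : ℝ}
    (hab : a ≤ b) : ∫ x in a..b, f x ≤ ∫ x, f x := by
  rw [intervalIntegral.integral_of_le hab]
  exact setIntegral_le_integral hf (ae_of_all _ h0)

/-- The cutoff of the nonlinearity, preserving the algebraic structure of the system. -/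
noncomputable def cutoff (R : ℝ) (z : ℂ × ℂ) : ℝ :=
  Real.smoothTransition (R + 1 - (‖z.1‖ ^ 2 + ‖z.2‖ ^ 2))

/-- The time derivative along characteristics in the Dirac system. -/
noncomputable def diracRHS (m α β : ℝ) (z : ℂ × ℂ) : ℂ × ℂ :=
  (-Complex.I * (-(m : ℂ) * z.2 + N₁ α β z.1 z.2), -Complex.I * (-(m : ℂ) * z.1 + N₁ α β z.2 z.1))

theorem contDiff_N₁ (α β : ℝ) {f g : ℂ × ℂ → ℂ} (hf : ContDiff ℝ 2 f) (hg : ContDiff ℝ 2 g) :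
    ContDiff ℝ 2 fun z => N₁ α β (f z) (g z) := by
  have h1 : ContDiff ℝ 2 fun z => conj (f z) := Complex.conjCLE.contDiff.comp hf
  have h2 : ContDiff ℝ 2 fun z => conj (g z) := Complex.conjCLE.contDiff.comp hg
  simp only [N₁_eq]
  exact ((contDiff_const.mul (hg.mul h2)).mul hf).add
    ((contDiff_const.mul ((h1.mul hg).add (hf.mul h2))).mul hg)

theorem contDiff_diracRHS (m α β : ℝ) : ContDiff ℝ 2 (diracRHS m α β) :=
  (contDiff_const.mul ((contDiff_const.mul contDiff_snd).add
    (contDiff_N₁ α β contDiff_fst contDiff_snd))).prodMk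
  (contDiff_const.mul ((contDiff_const.mul contDiff_fst).add
    (contDiff_N₁ α β contDiff_snd contDiff_fst)))

theorem contDiff_cutoff (R : ℝ) : ContDiff ℝ 2 (cutoff R) := by
  have h3 : ContDiff ℝ 2 Real.smoothTransition := Real.smoothTransition.contDiff (n := 2)
  exact h3.comp (contDiff_const.sub ((contDiff_fst.norm_sq ℝ).add (contDiff_snd.norm_sq ℝ)))

theorem hasCompactSupport_cutoff (R : ℝ) : HasCompactSupport (cutoff R) := by
  -- Outside this ball |z₁|² + |z₂|² > (|R| + 1)² ≥ R + 1.
  refine HasCompactSupport.intro (isCompact_closedBall (0 : ℂ × ℂ) (|R| + 1)) fun z hz => ?_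
  refine Real.smoothTransition.zero_of_nonpos ?_
  rw [mem_closedBall_zero_iff, not_le, Prod.norm_def, lt_max_iff] at hz
  have hR := le_abs_self R
  have hR' := abs_nonneg R
  rcases hz with hz | hz
  · nlinarith [sq_nonneg ‖z.2‖]
  · nlinarith [sq_nonneg ‖z.1‖]

/-- Global solutions of the system with truncated nonlinearity. -/
theorem exists_truncatedSolution (m α β R : ℝ) {T : ℝ} (hT : 0 ≤ T) {u₀ v₀ : ℝ → ℂ}
    (hu : ContDiff ℝ 1 u₀) (hv : ContDiff ℝ 1 v₀) (hus : HasCompactSupport u₀)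
    (hvs : HasCompactSupport v₀) :
    ∃ U V : ℝ × ℝ → ℂ, ContDiff ℝ 1 U ∧ ContDiff ℝ 1 V ∧
      (∀ x, U (0, x) = u₀ x) ∧ (∀ x, V (0, x) = v₀ x) ∧
      (∀ t ∈ Icc 0 T, ∀ x, fderiv ℝ U (t, x) (1, 1) = cutoff R (U (t, x), V (t, x)) •
        (-Complex.I * (-(m : ℂ) * V (t, x) + N₁ α β (U (t, x)) (V (t, x))))) ∧
      (∀ t ∈ Icc 0 T, ∀ x, fderiv ℝ V (t, x) (1, -1) = cutoff R (U (t, x), V (t, x)) •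
        (-Complex.I * (-(m : ℂ) * U (t, x) + N₁ α β (V (t, x)) (U (t, x))))) ∧
      ∃ r, ∀ t ∈ Icc 0 T, ∀ x, r < |x| → U (t, x) = 0 ∧ V (t, x) = 0 := by
  obtain ⟨φ, hφ⟩ : ∃ φ : ℝ → ℂ × ℂ, φ = fun y => (u₀ y, v₀ y) := ⟨_, rfl⟩
  have cφ : ContDiff ℝ 1 φ := hφ ▸ hu.prodMk hv
  have sφ : HasCompactSupport φ :=
    HasCompactSupport.intro (hus.isCompact.union hvs.isCompact) fun x hx => by
      rw [mem_union, not_or] at hx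
      rw [hφ]
      exact Prod.ext (image_eq_zero_of_notMem_tsupport (f := u₀) hx.1)
        (image_eq_zero_of_notMem_tsupport (f := v₀) hx.2)
  obtain ⟨R₁, hR₁⟩ := sφ.exists_bound_of_continuous cφ.continuous
  obtain ⟨R₂, hR₂⟩ := sφ.deriv.exists_bound_of_continuous (cφ.continuous_deriv le_rfl)
  have dφ : ∀ x, HasDerivAt φ (deriv φ x) x := fun x =>
    (cφ.differentiable one_ne_zero x).hasDerivAt
  obtain ⟨r, hr⟩ := sφ.isCompact.isBounded.subset_closedBall 0
  have hφ0 : ∀ x, r < |x| → φ x = 0 := fun x hx => by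
    refine image_eq_zero_of_notMem_tsupport fun h => ?_
    have := mem_closedBall_zero_iff.1 (hr h)
    rw [Real.norm_eq_abs] at this
    linarith
  obtain ⟨F, hF⟩ : ∃ F : ℂ × ℂ → ℂ × ℂ, F = fun z => cutoff R z • diracRHS m α β z := ⟨_, rfl⟩
  have cF : ContDiff ℝ 2 F := hF ▸ (contDiff_cutoff R).smul (contDiff_diracRHS m α β)
  have sF : HasCompactSupport F := hF ▸ (hasCompactSupport_cutoff R).smul_right
  obtain ⟨Λ, hΛ⟩ := cF.lipschitzWith_of_hasCompactSupport sF two_ne_zero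
  obtain ⟨Λ₂, hΛ₂⟩ := (cF.fderiv_right (m := 1) (by norm_num)).lipschitzWith_of_hasCompactSupport
    (sF.fderiv ℝ) one_ne_zero
  have cF1 : ContDiff ℝ 1 F := cF.of_le (by norm_num)
  have F0 : F 0 = 0 := by
    simp only [hF, diracRHS, N₁_eq, Prod.fst_zero, Prod.snd_zero]
    simp
  -- Λ + 1 replaces Λ because the iteration needs a positive constant.
  obtain ⟨W, P, cW, cP, dW, fW, sW⟩ := exists_fixedPoint (φ' := deriv φ) (R := max R₁ R₂) (Λ := Λ + 1)
    hT dφ (cφ.continuous_deriv le_rfl) (fun x => (hR₁ x).trans (le_max_left _ _))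
    (fun x => (hR₂ x).trans (le_max_right _ _)) cF1 F0 (by positivity)
    (hΛ.weaken (le_add_of_nonneg_right zero_le_one)) hΛ₂ hφ0
  have cFW : Continuous fun p => F (W p) := cF.continuous.comp cW
  have cFP : Continuous fun p => fderiv ℝ F (W p) (P p) :=
    ((cF1.continuous_fderiv one_ne_zero).comp cW).clm_apply cP
  have dFW : ∀ s x, HasDerivAt (fun y => F (W (s, y))) (fderiv ℝ F (W (s, x)) (P (s, x))) x :=
    fun s x => (cF1.differentiable one_ne_zero _).hasFDerivAt.comp_hasDerivAt x (dW s x)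
  -- W has its time clamped. The unclamped Duhamel integrals of its source are C¹ on the whole plane
  -- and agree with W for t in [0, T].
  have cU : ContDiff ℝ 1 (duhamel 1 u₀ (fun q => (F (W q)).1)) :=
    contDiff_duhamel cFW.fst cFP.fst (hu.continuous_deriv le_rfl)
    (fun x => (hu.differentiable one_ne_zero x).hasDerivAt)
    (fun s x => (ContinuousLinearMap.fst ℝ ℂ ℂ).hasFDerivAt.comp_hasDerivAt x (dFW s x))
  have cV : ContDiff ℝ 1 (duhamel (-1) v₀ (fun q => (F (W q)).2)) :=
    contDiff_duhamel cFW.snd cFP.snd (hv.continuous_deriv le_rfl)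
    (fun x => (hv.differentiable one_ne_zero x).hasDerivAt)
    (fun s x => (ContinuousLinearMap.snd ℝ ℂ ℂ).hasFDerivAt.comp_hasDerivAt x (dFW s x))
  have eW : ∀ t ∈ Icc 0 T, ∀ x, W (t, x) = (duhamel 1 u₀ (fun q => (F (W q)).1) (t, x),
      duhamel (-1) v₀ (fun q => (F (W q)).2) (t, x)) := fun t ht x => by
    conv_lhs => rw [fW]
    simp only [duhamelPair, clamp_of_mem ht, hφ]
  have hFW := fun t ht x => (congrArg F (eW t ht x)).trans (congrFun hF _)
  refine ⟨_, _, cU, cV, fun x => duhamel_zero_time x, fun x => duhamel_zero_time x, fun t ht x => ?_,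
    fun t ht x => ?_, r + T, fun t ht x hx => ?_⟩
  · exact (fderiv_duhamel_line cU cFW.fst t x).trans (congrArg Prod.fst (hFW t ht x))
  · exact (fderiv_duhamel_line cV cFW.snd t x).trans (congrArg Prod.snd (hFW t ht x))
  · have := sW t x (by rw [clamp_of_mem ht]; linarith [ht.2])
    rw [eW t ht, Prod.mk_eq_zero] at this
    exact this

theorem derivWithin_add_mul_deriv {T : ℝ} (hT : 0 < T) {G : ℝ × ℝ → ℂ} (hG : ContDiff ℝ 1 G) {t : ℝ}
    (ht : t ∈ Icc 0 T) (x c : ℝ) :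
    derivWithin (fun s => G (s, x)) (Icc 0 T) t + c * deriv (fun y => G (t, y)) x =
      fderiv ℝ G (t, x) (1, c) := by
  have h0 := (hG.differentiable one_ne_zero (t, x)).hasFDerivAt
  have h1 : HasDerivAt (fun s => G (s, x)) (fderiv ℝ G (t, x) (1, 0)) t :=
    h0.comp_hasDerivAt (f := fun s : ℝ => (s, x)) t ((hasDerivAt_id t).prodMk (hasDerivAt_const t x))
  have h2 : HasDerivAt (fun y => G (t, y)) (fderiv ℝ G (t, x) (0, 1)) x :=
    h0.comp_hasDerivAt (f := fun y : ℝ => (t, y)) x ((hasDerivAt_const x t).prodMk (hasDerivAt_id x))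
  rw [h1.hasDerivWithinAt.derivWithin (uniqueDiffOn_Icc hT t ht), h2.deriv]
  have e : ((1, c) : ℝ × ℝ) = (1, 0) + c • (0, 1) := by ext <;> simp
  rw [e, map_add, map_smul, Complex.real_smul]

theorem integrable_sq_norm {u : ℝ → ℂ} (hu : Continuous u) (hus : HasCompactSupport u) :
    Integrable fun y => ‖u y‖ ^ 2 := by
  have hc : Continuous fun y => ‖u y‖ ^ 2 := hu.norm.pow 2
  refine hc.integrable_of_hasCompactSupport (HasCompactSupport.intro hus.isCompact fun x hx => ?_)
  simp [image_eq_zero_of_notMem_tsupport hx]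

/-- The bound of |U|² + |V|² for the truncated problem depends on the data and T but not on R, so R
can be taken equal to it; the truncation is then identically 1 on the solution. -/
theorem exists_classicalSolution (m α β : ℝ) {T : ℝ} (hT : 0 < T) {u₀ v₀ : ℝ → ℂ}
    (hu : ContDiff ℝ 1 u₀) (hv : ContDiff ℝ 1 v₀) (hus : HasCompactSupport u₀)
    (hvs : HasCompactSupport v₀) :
    ∃ U V : ℝ → ℝ → ℂ, IsClassicalSolution m α β T U V ∧
      (Continuous fun p : ℝ × ℝ => U p.1 p.2) ∧ (Continuous fun p : ℝ × ℝ => V p.1 p.2) ∧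
      U 0 = u₀ ∧ V 0 = v₀ ∧
      ∃ r, ∀ t ∈ Icc 0 T, ∀ x, r < |x| → U t x = 0 ∧ V t x = 0 := by
  obtain ⟨Ru, hRu⟩ := hus.exists_bound_of_continuous hu.continuous
  obtain ⟨Rv, hRv⟩ := hvs.exists_bound_of_continuous hv.continuous
  have hint := (integrable_sq_norm hu.continuous hus).add (integrable_sq_norm hv.continuous hvs)
  obtain ⟨L, hL⟩ : ∃ L, L = ∫ y, (‖u₀ y‖ ^ 2 + ‖v₀ y‖ ^ 2) := ⟨_, rfl⟩
  obtain ⟨K, hK⟩ : ∃ K, K = Real.exp (T + 4 * |β| * L) := ⟨_, rfl⟩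
  obtain ⟨R, hR⟩ : ∃ R, R = K * (Ru ^ 2 + m ^ 2 * L) + K * (Rv ^ 2 + m ^ 2 * L) := ⟨_, rfl⟩
  obtain ⟨U, V, cU, cV, U0, V0, eU, eV, r, hr⟩ :=
    exists_truncatedSolution m α β R hT.le hu hv hus hvs
  have hsol : IsDampedSolution m α β T (fun p => cutoff R (U p, V p)) U V :=
    ⟨.of_contDiff cU, .of_contDiff cV, fun _ => Real.smoothTransition.nonneg _,
      fun _ => Real.smoothTransition.le_one _, fun t ht x => eU t (Ioo_subset_Icc_self ht) x,
      fun t ht x => eV t (Ioo_subset_Icc_self ht) x⟩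
  have hLab : ∀ a b, a ≤ b → ∫ y in a..b, (‖U (0, y)‖ ^ 2 + ‖V (0, y)‖ ^ 2) ≤ L := fun a b hab => by
    simp only [U0, V0]
    rw [hL]
    exact intervalIntegral_le_integral (f := fun y => ‖u₀ y‖ ^ 2 + ‖v₀ y‖ ^ 2) hint (fun _ => by positivity) hab
  have hρ : ∀ t ∈ Icc 0 T, ∀ x, cutoff R (U (t, x), V (t, x)) = 1 := fun t ht x => by
    have h1 := hsol.norm_sq_fst_le hLab ht x
    have h2 := hsol.norm_sq_snd_le hLab ht x
    rw [U0, ← hK] at h1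
    rw [V0, ← hK] at h2
    have h3 : ‖u₀ (x - t)‖ ^ 2 ≤ Ru ^ 2 := pow_le_pow_left₀ (norm_nonneg _) (hRu _) 2
    have h4 : ‖v₀ (x + t)‖ ^ 2 ≤ Rv ^ 2 := pow_le_pow_left₀ (norm_nonneg _) (hRv _) 2
    have hK0 : 0 < K := hK ▸ Real.exp_pos _
    have h5 := mul_le_mul_of_nonneg_left h3 hK0.le
    have h6 := mul_le_mul_of_nonneg_left h4 hK0.le
    refine Real.smoothTransition.one_of_one_le ?_
    simp only
    linarith
  refine ⟨fun t x => U (t, x), fun t x => V (t, x), ⟨cU.contDiffOn, cV.contDiffOn, ?_, ?_⟩,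
    cU.continuous, cV.continuous, funext U0, funext V0, r, hr⟩
  · intro t ht x
    have := derivWithin_add_mul_deriv hT cU ht x 1
    rw [eU t ht, hρ t ht, one_smul] at this
    rw [Complex.ofReal_one, one_mul] at this
    rw [this, ← mul_assoc]
    simp
  · intro t ht x
    have := derivWithin_add_mul_deriv hT cV ht x (-1)
    rw [eV t ht, hρ t ht, one_smul] at this
    rw [Complex.ofReal_neg, Complex.ofReal_one, neg_one_mul, ← sub_eq_add_neg] at this
    rw [this, ← mul_assoc, N₂_eq_N₁]
    simp

/-! ### From integrals over intervals to norms in L² -/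

theorem sq_eLpNorm_two {X : Type*} [MeasurableSpace X] {μ : Measure X} (f : X → ℂ) :
    eLpNorm f 2 μ ^ 2 = ∫⁻ x, ‖f x‖ₑ ^ 2 ∂μ := by
  have := eLpNorm_nnreal_pow_eq_lintegral (f := f) (μ := μ) (p := 2) two_ne_zero
  simpa using this

theorem ofReal_sq_norm (z : ℂ) : ENNReal.ofReal (‖z‖ ^ 2) = ‖z‖ₑ ^ 2 := by
  rw [ENNReal.ofReal_pow (norm_nonneg _), ofReal_norm]

theorem lintegral_le_of_forall_intervalIntegral_le {h : ℝ → ℝ} (hc : Continuous h) (h0 : ∀ x, 0 ≤ h x)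
    {D : ℝ} (hD : ∀ a b, a ≤ b → ∫ x in a..b, h x ≤ D) :
    ∫⁻ x, ENNReal.ofReal (h x) ≤ ENNReal.ofReal D := by
  have hA : AECover (volume : Measure ℝ) atTop fun n : ℕ => Ioc (-(n : ℝ)) n :=
    aecover_Ioc (tendsto_neg_atTop_atBot.comp tendsto_natCast_atTop_atTop) tendsto_natCast_atTop_atTop
  refine le_of_tendsto' (hA.lintegral_tendsto_of_countably_generated
    (f := fun x => ENNReal.ofReal (h x)) (by fun_prop)) fun n => ?_
  have hn : -(n : ℝ) ≤ n := by linarith [(n.cast_nonneg : (0 : ℝ) ≤ n)]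
  rw [← ofReal_integral_eq_lintegral_ofReal
    (hc.integrableOn_Icc.mono_set Ioc_subset_Icc_self) (ae_of_all _ h0),
    ← intervalIntegral.integral_of_le hn]
  exact ENNReal.ofReal_le_ofReal (hD _ _ hn)

theorem intervalIntegral_le_of_lintegral_le {h : ℝ → ℝ} (hc : Continuous h) (h0 : ∀ x, 0 ≤ h x)
    {D : ℝ} (hD0 : 0 ≤ D) {μ : Measure ℝ} [IsLocallyFiniteMeasure μ]
    (hD : ∫⁻ x, ENNReal.ofReal (h x) ∂μ ≤ ENNReal.ofReal D) {a b : ℝ} (hab : a ≤ b) :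
    ∫ x in a..b, h x ∂μ ≤ D := by
  rw [intervalIntegral.integral_of_le hab, integral_eq_lintegral_of_nonneg_ae (ae_of_all _ h0)
    hc.aestronglyMeasurable]
  exact ENNReal.toReal_le_of_le_ofReal hD0 ((setLIntegral_le_lintegral _ _).trans hD)

theorem lintegral_sq_add_sq {f g : ℝ → ℂ} (hf : Continuous f) :
    ∫⁻ x, ENNReal.ofReal (‖f x‖ ^ 2 + ‖g x‖ ^ 2) = eLpNorm f 2 volume ^ 2 + eLpNorm g 2 volume ^ 2 := by
  rw [sq_eLpNorm_two, sq_eLpNorm_two, ← lintegral_add_left (by fun_prop)]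
  refine lintegral_congr fun x => ?_
  rw [ENNReal.ofReal_add (by positivity) (by positivity), ofReal_sq_norm, ofReal_sq_norm]

theorem intervalIntegral_sq_le {f g : ℝ → ℂ} (hf : Continuous f) (hg : Continuous g) {D : ℝ}
    (hD0 : 0 ≤ D) (hD : eLpNorm f 2 volume ^ 2 + eLpNorm g 2 volume ^ 2 ≤ ENNReal.ofReal D) (a b : ℝ)
    (hab : a ≤ b) : ∫ x in a..b, (‖f x‖ ^ 2 + ‖g x‖ ^ 2) ≤ D := by
  refine intervalIntegral_le_of_lintegral_le (by fun_prop) (fun _ => by positivity) hD0 ?_ hab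
  rwa [lintegral_sq_add_sq hf]

theorem stabilityConst_ge_one {m α β T L : ℝ} (hT : 0 ≤ T) (hL : 0 ≤ L) :
    1 ≤ stabilityConst m α β T L := by
  refine Real.one_le_exp ?_
  positivity

/-- `L²`-stability for classical solutions. -/
theorem eLpNorm_sub_le_of_classical {m α β T L : ℝ} {U V U' V' : ℝ → ℝ → ℂ} (hL0 : 0 ≤ L)
    (h : IsClassicalSolution m α β T U V) (h' : IsClassicalSolution m α β T U' V')
    (hL : eLpNorm (U 0) 2 volume ^ 2 + eLpNorm (V 0) 2 volume ^ 2 ≤ ENNReal.ofReal L)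
    (hL' : eLpNorm (U' 0) 2 volume ^ 2 + eLpNorm (V' 0) 2 volume ^ 2 ≤ ENNReal.ofReal L)
    {t : ℝ} (ht : t ∈ Icc 0 T) :
    eLpNorm (fun x => U t x - U' t x) 2 volume ≤ ENNReal.ofReal (stabilityConst m α β T L) *
      (eLpNorm (fun x => U 0 x - U' 0 x) 2 volume + eLpNorm (fun x => V 0 x - V' 0 x) 2 volume) ∧
    eLpNorm (fun x => V t x - V' t x) 2 volume ≤ ENNReal.ofReal (stabilityConst m α β T L) *
      (eLpNorm (fun x => U 0 x - U' 0 x) 2 volume + eLpNorm (fun x => V 0 x - V' 0 x) 2 volume) := by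
  have h0 : (0 : ℝ) ∈ Icc 0 T := left_mem_Icc.2 (ht.1.trans ht.2)
  have hC := stabilityConst_ge_one (m := m) (α := α) (β := β) (ht.1.trans ht.2) hL0
  set C := stabilityConst m α β T L
  have s := h.isDampedSolution
  have s' := h'.isDampedSolution
  have cU : ∀ r ∈ Icc 0 T, Continuous (U r) := fun r hr => s.fst.continuous_slice hr
  have cV : ∀ r ∈ Icc 0 T, Continuous (V r) := fun r hr => s.snd.continuous_slice hr
  have cU' : ∀ r ∈ Icc 0 T, Continuous (U' r) := fun r hr => s'.fst.continuous_slice hr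
  have cV' : ∀ r ∈ Icc 0 T, Continuous (V' r) := fun r hr => s'.snd.continuous_slice hr
  set a := eLpNorm (fun x => U 0 x - U' 0 x) 2 volume
  set b := eLpNorm (fun x => V 0 x - V' 0 x) 2 volume
  -- Classical solutions need not differ by an L² function at time 0; in that case the bound is
  -- trivial.
  rcases eq_or_ne (a + b) ⊤ with hab | hab
  · have : ENNReal.ofReal C * (a + b) = ⊤ := by
      rw [hab, ENNReal.mul_top]
      simpa using zero_lt_one.trans_le hC
    rw [this]
    exact ⟨le_top, le_top⟩
  have hfin : a ^ 2 + b ^ 2 ≠ ⊤ := by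
    rw [ENNReal.add_ne_top] at hab ⊢
    exact ⟨ENNReal.pow_ne_top hab.1, ENNReal.pow_ne_top hab.2⟩
  have hst := stability s s' rfl rfl (intervalIntegral_sq_le (cU 0 h0) (cV 0 h0) hL0 hL)
    (intervalIntegral_sq_le (cU' 0 h0) (cV' 0 h0) hL0 hL') (D := (a ^ 2 + b ^ 2).toReal)
    (intervalIntegral_sq_le ((cU 0 h0).sub (cU' 0 h0)) ((cV 0 h0).sub (cV' 0 h0))
      ENNReal.toReal_nonneg (by rw [ENNReal.ofReal_toReal hfin]; rfl)) ht
  have cu := (cU t ht).sub (cU' t ht)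
  have cv := (cV t ht).sub (cV' t ht)
  have key := lintegral_le_of_forall_intervalIntegral_le
    (h := fun y => ‖U t y - U' t y‖ ^ 2 + ‖V t y - V' t y‖ ^ 2)
    ((cu.norm.pow 2).add (cv.norm.pow 2)) (fun _ => by positivity) hst
  rw [lintegral_sq_add_sq (f := fun y => U t y - U' t y) (g := fun y => V t y - V' t y) cu,
    ENNReal.ofReal_mul (by linarith), ENNReal.ofReal_toReal hfin] at key
  -- Since C ≥ 1, C may be replaced by C², which avoids square roots.
  have h1 : ENNReal.ofReal C * (a ^ 2 + b ^ 2) ≤ (ENNReal.ofReal C * (a + b)) ^ 2 := by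
    rw [mul_pow]
    refine mul_le_mul' ?_ ?_
    · rw [sq]
      exact le_mul_of_one_le_left' (ENNReal.one_le_ofReal.2 hC)
    · rw [add_sq]
      exact add_le_add le_self_add le_rfl
  constructor
  · rw [← ENNReal.pow_le_pow_left_iff two_ne_zero]
    exact (le_self_add.trans key).trans h1
  · rw [← ENNReal.pow_le_pow_left_iff two_ne_zero]
    exact (le_add_self.trans key).trans h1

theorem volume_restrict_strip (T : ℝ) : (volume : Measure (ℝ × ℝ)).restrict (strip T) =
    ((volume : Measure ℝ).restrict (Icc 0 T)).prod (volume : Measure ℝ) := by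
  rw [strip, Measure.volume_eq_prod, ← Measure.prod_restrict, Measure.restrict_univ]

theorem measurableSet_strip (T : ℝ) : MeasurableSet (strip T) := measurableSet_Icc.prod .univ

/-- Bound of the space-time `L²`-norm by the uniform-in-time norm. -/
theorem eLpNorm_strip_le {T : ℝ} {F : ℝ × ℝ → ℂ}
    (hF : AEStronglyMeasurable F (volume.restrict (strip T))) {B : ℝ≥0∞}
    (hB : ∀ t ∈ Icc 0 T, eLpNorm (fun x => F (t, x)) 2 volume ≤ B) :
    eLpNorm F 2 (volume.restrict (strip T)) ≤ (1 + ENNReal.ofReal T) * B := by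
  rw [← ENNReal.pow_le_pow_left_iff two_ne_zero, sq_eLpNorm_two]
  rw [volume_restrict_strip] at hF ⊢
  rw [lintegral_prod _ (hF.enorm.pow_const 2)]
  calc ∫⁻ t in Icc 0 T, ∫⁻ x, ‖F (t, x)‖ₑ ^ 2
      ≤ ∫⁻ _ in Icc 0 T, B ^ 2 := by
        refine setLIntegral_mono measurable_const fun t ht => ?_
        rw [← sq_eLpNorm_two]
        exact pow_le_pow_left' (hB t ht) 2
    _ = B ^ 2 * ENNReal.ofReal T := by rw [setLIntegral_const, Real.volume_Icc, sub_zero]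
    _ ≤ ((1 + ENNReal.ofReal T) * B) ^ 2 := by
        rw [mul_pow, mul_comm]
        refine mul_le_mul_left ?_ _
        rw [sq]
        exact (le_add_self).trans (le_mul_of_one_le_left' le_self_add)

/-- The geometric rate makes ∑ |gₙ - G|² integrable, hence finite almost everywhere, so no
subsequence has to be extracted. -/
theorem tendsto_ae_of_eLpNorm_geometric {g : ℕ → ℝ → ℂ} {G : ℝ → ℂ} (hg : ∀ n, Measurable (g n))
    (hG : AEMeasurable G) {C : ℝ} (hC : 0 ≤ C)
    (h : ∀ n, eLpNorm (fun x => g n x - G x) 2 volume ≤ ENNReal.ofReal (C * (1 / 2) ^ n)) :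
    ∀ᵐ x, Tendsto (fun n => g n x) atTop (𝓝 (G x)) := by
  have hm : ∀ n, AEMeasurable (fun x => ‖g n x - G x‖ₑ ^ 2) := fun n =>
    (((hg n).aemeasurable.sub hG).enorm).pow_const 2
  have h1 : ∫⁻ x, ∑' n, ‖g n x - G x‖ₑ ^ 2 ≠ ⊤ := by
    rw [lintegral_tsum hm]
    refine ne_top_of_le_ne_top (b := ∑' n : ℕ, ENNReal.ofReal (C ^ 2 * (1 / 4) ^ n)) ?_ ?_
    · refine (Summable.mul_left _ (summable_geometric_of_lt_one (by norm_num) (by norm_num))).tsum_ofReal_ne_top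
    · refine ENNReal.tsum_le_tsum fun n => ?_
      rw [← sq_eLpNorm_two]
      refine (pow_le_pow_left' (h n) 2).trans (le_of_eq ?_)
      rw [← ENNReal.ofReal_pow (by positivity), mul_pow, ← pow_mul, mul_comm n 2, pow_mul]
      norm_num
  filter_upwards [ae_lt_top' (AEMeasurable.tsum hm) h1] with x hx
  have h2 := ENNReal.tendsto_atTop_zero_of_tsum_ne_top hx.ne
  rw [tendsto_iff_edist_tendsto_0]
  simp only [edist_eq_enorm_sub]
  have h3 := ((ENNReal.continuous_rpow_const (y := 1 / 2)).tendsto 0).comp h2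
  rw [ENNReal.zero_rpow_of_pos (by norm_num)] at h3
  refine h3.congr fun n => ?_
  simp only [Function.comp]
  rw [← ENNReal.rpow_natCast, ← ENNReal.rpow_mul]
  norm_num

theorem IsVersion.aestronglyMeasurable_strip {u : C(ℝ≥0, L2)} {f : ℝ × ℝ → ℂ} (h : IsVersion u f)
    (T : ℝ) : AEStronglyMeasurable f (volume.restrict (strip T)) :=
  h.1.mono_measure (Measure.restrict_mono (prod_mono (fun _ hx => hx.1) subset_rfl) le_rfl)

/-- Fubini gives equality in L² for almost every time, and continuity of the curves gives it for
every time, endpoints included. -/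
theorem IsVersion.eq_of_ae_eq {u u' : C(ℝ≥0, L2)} {f f' : ℝ × ℝ → ℂ} (h : IsVersion u f)
    (h' : IsVersion u' f') {T : ℝ} (hT : 0 < T) (he : f =ᵐ[volume.restrict (strip T)] f') {t : ℝ≥0}
    (ht : (t : ℝ) ≤ T) : u t = u' t := by
  rw [EventuallyEq, volume_restrict_strip] at he
  have h1 : (fun s : ℝ => u s.toNNReal) =ᵐ[volume.restrict (Icc 0 T)] fun s => u' s.toNNReal := by
    have a1 := ae_restrict_of_ae (s := Icc 0 T) h.2
    have a2 := ae_restrict_of_ae (s := Icc 0 T) h'.2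
    filter_upwards [Measure.ae_ae_of_ae_prod he, a1, a2, ae_restrict_mem measurableSet_Icc]
      with s b1 b2 b3 hs
    have e : s.toNNReal = ⟨s, hs.1⟩ := Subtype.ext (Real.coe_toNNReal s hs.1)
    simp only [e]
    refine Lp.ext ?_
    filter_upwards [b1, b2 hs.1, b3 hs.1] with x c1 c2 c3
    rw [← c2, ← c3, c1]
  have h2 := Measure.eqOn_Icc_of_ae_eq volume hT.ne h1
    (u.continuous.comp continuous_real_toNNReal).continuousOn
    (u'.continuous.comp continuous_real_toNNReal).continuousOn ⟨t.2, ht⟩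
  simpa using h2

/-! ### Uniqueness of strong solutions -/

/-- Bound of the charge of data at distance at most `1` from `(u₀, v₀)`. -/
noncomputable def chargeBound (u₀ v₀ : L2) : ℝ := (‖u₀‖ + 1) ^ 2 + (‖v₀‖ + 1) ^ 2

theorem chargeBound_nonneg (u₀ v₀ : L2) : 0 ≤ chargeBound u₀ v₀ := by
  unfold chargeBound; positivity

theorem eLpNorm_le_of_sub_le_one {f : ℝ → ℂ} (hf : Continuous f) (u₀ : L2)
    (h : eLpNorm (fun x => f x - u₀ x) 2 volume ≤ 1) :
    eLpNorm f 2 volume ^ 2 ≤ ENNReal.ofReal ((‖u₀‖ + 1) ^ 2) := by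
  have h1 : eLpNorm f 2 volume ≤ eLpNorm (fun x => f x - u₀ x) 2 volume + eLpNorm u₀ 2 volume := by
    have := eLpNorm_add_le (f := fun x => f x - u₀ x) (g := u₀) (μ := volume) (p := 2)
      (hf.aestronglyMeasurable.sub (Lp.aestronglyMeasurable u₀)) (Lp.aestronglyMeasurable u₀)
      (by norm_num)
    refine le_trans (le_of_eq ?_) this
    congr 1
    funext x
    simp
  rw [ENNReal.ofReal_pow (by positivity)]
  refine pow_le_pow_left' (h1.trans ?_) 2
  rw [add_comm ‖u₀‖, ENNReal.ofReal_add zero_le_one (norm_nonneg _), ENNReal.ofReal_one,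
    ofReal_norm, Lp.enorm_def]
  gcongr

theorem charge_le_chargeBound {f g : ℝ → ℂ} (hf : Continuous f) (hg : Continuous g) {u₀ v₀ : L2}
    (h : eLpNorm (fun x => f x - u₀ x) 2 volume ≤ 1)
    (h' : eLpNorm (fun x => g x - v₀ x) 2 volume ≤ 1) :
    eLpNorm f 2 volume ^ 2 + eLpNorm g 2 volume ^ 2 ≤ ENNReal.ofReal (chargeBound u₀ v₀) := by
  rw [chargeBound, ENNReal.ofReal_add (by positivity) (by positivity)]
  exact add_le_add (eLpNorm_le_of_sub_le_one hf u₀ h) (eLpNorm_le_of_sub_le_one hg v₀ h')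

theorem eLpNorm_sub_triangle {X : Type*} [MeasurableSpace X] {μ : Measure X} {f g h : X → ℂ}
    (hf : AEStronglyMeasurable f μ) (hg : AEStronglyMeasurable g μ) (hh : AEStronglyMeasurable h μ) :
    eLpNorm (fun x => f x - g x) 2 μ ≤
      eLpNorm (fun x => f x - h x) 2 μ + eLpNorm (fun x => g x - h x) 2 μ := by
  have := eLpNorm_sub_le (p := 2) (hf.sub hh) (hg.sub hh) (by norm_num)
  refine le_trans (le_of_eq ?_) this
  congr 1
  funext x
  simp

theorem IsClassicalSolution.continuous_slices {m α β T : ℝ} {U V : ℝ → ℝ → ℂ}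
    (h : IsClassicalSolution m α β T U V) {t : ℝ} (ht : t ∈ Icc 0 T) :
    Continuous (U t) ∧ Continuous (V t) :=
  ⟨h.isDampedSolution.fst.continuous_slice ht, h.isDampedSolution.snd.continuous_slice ht⟩

theorem IsClassicalSolution.aestronglyMeasurable {m α β T : ℝ} {U V : ℝ → ℝ → ℂ}
    (h : IsClassicalSolution m α β T U V) :
    AEStronglyMeasurable (fun p : ℝ × ℝ => U p.1 p.2) (volume.restrict (strip T)) ∧
      AEStronglyMeasurable (fun p : ℝ × ℝ => V p.1 p.2) (volume.restrict (strip T)) :=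
  ⟨h.1.continuousOn.aestronglyMeasurable (measurableSet_strip T),
    h.2.continuousOn.aestronglyMeasurable (measurableSet_strip T)⟩

/-- Two classical approximations of the same data become close in `L²` of the strip. -/
theorem eLpNorm_strip_sub_le {m α β T : ℝ} (hT : 0 ≤ T) {u₀ v₀ : L2} {U V U' V' : ℝ → ℝ → ℂ}
    (h : IsClassicalSolution m α β T U V) (h' : IsClassicalSolution m α β T U' V')
    (hu : eLpNorm (fun x => U 0 x - u₀ x) 2 volume ≤ 1)
    (hv : eLpNorm (fun x => V 0 x - v₀ x) 2 volume ≤ 1)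
    (hu' : eLpNorm (fun x => U' 0 x - u₀ x) 2 volume ≤ 1)
    (hv' : eLpNorm (fun x => V' 0 x - v₀ x) 2 volume ≤ 1) :
    (∀ t ∈ Icc 0 T,
      eLpNorm (fun x => U t x - U' t x) 2 volume ≤
        ENNReal.ofReal (stabilityConst m α β T (chargeBound u₀ v₀)) *
        ((eLpNorm (fun x => U 0 x - u₀ x) 2 volume + eLpNorm (fun x => U' 0 x - u₀ x) 2 volume) +
        (eLpNorm (fun x => V 0 x - v₀ x) 2 volume + eLpNorm (fun x => V' 0 x - v₀ x) 2 volume)) ∧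
      eLpNorm (fun x => V t x - V' t x) 2 volume ≤
        ENNReal.ofReal (stabilityConst m α β T (chargeBound u₀ v₀)) *
        ((eLpNorm (fun x => U 0 x - u₀ x) 2 volume + eLpNorm (fun x => U' 0 x - u₀ x) 2 volume) +
        (eLpNorm (fun x => V 0 x - v₀ x) 2 volume + eLpNorm (fun x => V' 0 x - v₀ x) 2 volume))) := by
  intro t ht
  have h0 : (0 : ℝ) ∈ Icc 0 T := left_mem_Icc.2 hT
  obtain ⟨cU, cV⟩ := h.continuous_slices h0
  obtain ⟨cU', cV'⟩ := h'.continuous_slices h0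
  have key := eLpNorm_sub_le_of_classical (chargeBound_nonneg u₀ v₀) h h'
    (charge_le_chargeBound cU cV hu hv) (charge_le_chargeBound cU' cV' hu' hv') ht
  have e1 := eLpNorm_sub_triangle cU.aestronglyMeasurable cU'.aestronglyMeasurable
    (Lp.aestronglyMeasurable u₀)
  have e2 := eLpNorm_sub_triangle cV.aestronglyMeasurable cV'.aestronglyMeasurable
    (Lp.aestronglyMeasurable v₀)
  have e3 := mul_le_mul_right (add_le_add e1 e2)
    (ENNReal.ofReal (stabilityConst m α β T (chargeBound u₀ v₀)))
  exact ⟨key.1.trans e3, key.2.trans e3⟩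

theorem ae_eq_of_tendsto_eLpNorm {X : Type*} [MeasurableSpace X] {μ : Measure X} {f g : X → ℂ}
    {F G : ℕ → X → ℂ} (hf : AEStronglyMeasurable f μ) (hg : AEStronglyMeasurable g μ)
    (hF : ∀ n, AEStronglyMeasurable (F n) μ) (hG : ∀ n, AEStronglyMeasurable (G n) μ)
    (h1 : Tendsto (fun n => eLpNorm (fun x => F n x - f x) 2 μ) atTop (𝓝 0))
    (h2 : Tendsto (fun n => eLpNorm (fun x => G n x - g x) 2 μ) atTop (𝓝 0))
    (h3 : Tendsto (fun n => eLpNorm (fun x => F n x - G n x) 2 μ) atTop (𝓝 0)) : f =ᵐ[μ] g := by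
  have e : eLpNorm (fun x => f x - g x) 2 μ = 0 := by
    refine le_antisymm (ge_of_tendsto' (f := fun n => eLpNorm (fun x => F n x - f x) 2 μ +
      (eLpNorm (fun x => F n x - G n x) 2 μ + eLpNorm (fun x => G n x - g x) 2 μ)) (x := atTop)
      (by simpa using h1.add (h3.add h2)) fun n => ?_) zero_le
    have a1 := eLpNorm_sub_triangle hf hg (hF n)
    have a2 := eLpNorm_sub_triangle (f := F n) (h := G n) (hF n) hg (hG n)
    have sw : ∀ a b : X → ℂ, eLpNorm (fun x => a x - b x) 2 μ = eLpNorm (fun x => b x - a x) 2 μ :=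
      fun a b => eLpNorm_sub_comm a b 2 μ
    rw [sw f (F n), sw g (F n)] at a1
    rw [sw g (G n)] at a2
    exact a1.trans (add_le_add le_rfl a2)
  have := (eLpNorm_eq_zero_iff (hf.sub hg) (by norm_num)).1 e
  filter_upwards [this] with x hx
  exact sub_eq_zero.1 hx

/-- Two approximating sequences with the same limiting data are close to each other in L² of the
strip by stability, so their limits coincide. -/
theorem IsStrongSolutionOn.unique {m α β T : ℝ} (hT : 0 < T) {u₀ v₀ : L2} {u v u' v' : C(ℝ≥0, L2)}
    (h : IsStrongSolutionOn m α β T u₀ v₀ u v) (h' : IsStrongSolutionOn m α β T u₀ v₀ u' v')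
    {t : ℝ≥0} (ht : (t : ℝ) ≤ T) : u t = u' t ∧ v t = v' t := by
  obtain ⟨f, g, hf, hg, U, V, hs, hU, hV, hU0, hV0⟩ := h
  obtain ⟨f', g', hf', hg', U', V', hs', hU', hV', hU0', hV0'⟩ := h'
  set C := ENNReal.ofReal (stabilityConst m α β T (chargeBound u₀ v₀)) with hC
  set δ : ℕ → ℝ≥0∞ := fun n => (1 + ENNReal.ofReal T) * (C *
    ((eLpNorm (fun x => U n 0 x - u₀ x) 2 volume + eLpNorm (fun x => U' n 0 x - u₀ x) 2 volume) +
    (eLpNorm (fun x => V n 0 x - v₀ x) 2 volume + eLpNorm (fun x => V' n 0 x - v₀ x) 2 volume)))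
    with hδ
  have hδ0 : Tendsto δ atTop (𝓝 0) := by
    have h1 := (hU0.add hU0').add (hV0.add hV0')
    simp only [add_zero] at h1
    have h2 := ENNReal.Tendsto.const_mul (a := C) h1 (Or.inr ENNReal.ofReal_ne_top)
    have h3 := ENNReal.Tendsto.const_mul (a := 1 + ENNReal.ofReal T) h2
      (Or.inr (ENNReal.add_ne_top.2 ⟨ENNReal.one_ne_top, ENNReal.ofReal_ne_top⟩))
    simpa using h3
  -- The stability constant requires a common charge bound, available once all data lie within
  -- distance 1 of the limit.
  have hev : ∀ᶠ n in atTop,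
      eLpNorm (fun p : ℝ × ℝ => U n p.1 p.2 - U' n p.1 p.2) 2 (volume.restrict (strip T)) ≤ δ n ∧
      eLpNorm (fun p : ℝ × ℝ => V n p.1 p.2 - V' n p.1 p.2) 2 (volume.restrict (strip T)) ≤ δ n := by
    filter_upwards [hU0.eventually_le_const zero_lt_one, hU0'.eventually_le_const zero_lt_one,
      hV0.eventually_le_const zero_lt_one, hV0'.eventually_le_const zero_lt_one] with n a1 a2 a3 a4
    have key := eLpNorm_strip_sub_le hT.le (hs n) (hs' n) a1 a3 a2 a4
    exact ⟨eLpNorm_strip_le ((hs n).aestronglyMeasurable.1.sub (hs' n).aestronglyMeasurable.1)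
        fun t ht => (key t ht).1,
      eLpNorm_strip_le ((hs n).aestronglyMeasurable.2.sub (hs' n).aestronglyMeasurable.2)
        fun t ht => (key t ht).2⟩
  constructor
  · refine hf.eq_of_ae_eq hf' hT ?_ ht
    exact ae_eq_of_tendsto_eLpNorm (hf.aestronglyMeasurable_strip T) (hf'.aestronglyMeasurable_strip T)
      (fun n => (hs n).aestronglyMeasurable.1) (fun n => (hs' n).aestronglyMeasurable.1) hU hU'
      (tendsto_of_tendsto_of_tendsto_of_le_of_le' tendsto_const_nhds hδ0
        (Eventually.of_forall fun _ => zero_le) (hev.mono fun n hn => hn.1))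
  · refine hg.eq_of_ae_eq hg' hT ?_ ht
    exact ae_eq_of_tendsto_eLpNorm (hg.aestronglyMeasurable_strip T) (hg'.aestronglyMeasurable_strip T)
      (fun n => (hs n).aestronglyMeasurable.2) (fun n => (hs' n).aestronglyMeasurable.2) hV hV'
      (tendsto_of_tendsto_of_tendsto_of_le_of_le' tendsto_const_nhds hδ0
        (Eventually.of_forall fun _ => zero_le) (hev.mono fun n hn => hn.2))

/-! ### Construction of the strong solution and the product bound -/

theorem exists_smooth_approx (u₀ : L2) : ∃ g : ℕ → ℝ → ℂ, ∀ n, ContDiff ℝ 1 (g n) ∧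
    HasCompactSupport (g n) ∧
    eLpNorm (fun x => g n x - u₀ x) 2 volume ≤ ENNReal.ofReal ((1 / 2) ^ n) := by
  have : ∀ n : ℕ, ∃ g : ℝ → ℂ, ContDiff ℝ 1 g ∧ HasCompactSupport g ∧
      eLpNorm (fun x => g x - u₀ x) 2 volume ≤ ENNReal.ofReal ((1 / 2) ^ n) := by
    intro n
    obtain ⟨g, h1, h2, h3⟩ := MemLp.exist_eLpNorm_sub_le (p := 2) (by norm_num) (by norm_num)
      (Lp.memLp u₀) (ε := (1 / 2) ^ n) (by positivity)
    refine ⟨g, h2.of_le (by exact_mod_cast le_top), h1, ?_⟩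
    rw [eLpNorm_sub_comm] at h3
    exact h3
  choose g hg using this
  exact ⟨g, hg⟩

/-- A continuous function of space and time with uniformly bounded support in space is a continuous
curve in `L²`. -/
theorem exists_continuous_curve {T r : ℝ} (hT : 0 ≤ T) {U : ℝ → ℝ → ℂ}
    (hU : Continuous fun p : ℝ × ℝ => U p.1 p.2) (hr : ∀ t ∈ Icc 0 T, ∀ x, r < |x| → U t x = 0) :
    ∃ c : ℝ≥0 → L2, Continuous c ∧ ∀ t : ℝ≥0, (t : ℝ) ≤ T → c t =ᵐ[volume] U t := by
  have hslice : ∀ t, Continuous (U t) := fun t =>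
    hU.comp (f := fun x : ℝ => (t, x)) (by fun_prop)
  have hmem : ∀ t : ℝ, MemLp (U (clamp T t)) 2 volume := fun t => by
    refine (hslice _).memLp_of_hasCompactSupport (HasCompactSupport.intro
      (isCompact_closedBall (0 : ℝ) r) fun x hx => hr _ (clamp_mem hT t) x ?_)
    simpa using hx
  refine ⟨fun t => (hmem t).toLp, ?_, fun t ht => ?_⟩
  · set h : ℝ≥0 → ℝ≥0 → ℝ → ℝ := fun s t x => ‖U (clamp T t) x - U (clamp T s) x‖ ^ 2 with hh
    have ch : ∀ s t, Continuous (h s t) := fun s t =>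
      ((hslice _).sub (hslice _)).norm.pow 2
    -- All slices vanish outside [-r, r], so the L² distance is an integral over a fixed bounded
    -- interval, continuous in t. The margin 1 puts the support inside a half-open interval.
    have cJ : ∀ s, Continuous fun t => ∫ x in (-r - 1)..(r + 1), h s t x := fun s => by
      refine intervalIntegral.continuous_parametric_intervalIntegral_of_continuous' ?_ _ _
      have e : Continuous fun q : ℝ≥0 × ℝ => (clamp T q.1, q.2) := by
        have := continuous_clamp T
        fun_prop
      exact ((hU.comp e).sub ((hslice _).comp continuous_snd)).norm.pow 2
    have hb : ∀ s t : ℝ≥0, edist (hmem t).toLp (hmem s).toLp ^ 2 ≤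
        ENNReal.ofReal (∫ x in (-r - 1)..(r + 1), h s t x) := fun s t => by
      rw [Lp.edist_toLp_toLp, sq_eLpNorm_two]
      have e : ∀ x, ‖(U (clamp T t) - U (clamp T s)) x‖ₑ ^ 2 = ENNReal.ofReal (h s t x) := fun x => by
        rw [hh, ofReal_sq_norm]; rfl
      simp only [e]
      refine lintegral_le_of_forall_intervalIntegral_le (ch s t) (fun _ => by positivity)
        fun a b hab => ?_
      have hs : Function.support (h s t) ⊆ Ioc (-r - 1) (r + 1) := fun x hx => by
        by_contra hxr
        refine hx ?_
        have : r < |x| := by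
          by_contra hxr'
          rw [not_lt, abs_le] at hxr'
          exact hxr ⟨by linarith, by linarith⟩
        simp only [hh, hr _ (clamp_mem hT t) x this, hr _ (clamp_mem hT s) x this]
        simp
      rw [intervalIntegral.integral_eq_integral_of_support_subset hs]
      refine intervalIntegral_le_integral ((ch s t).integrable_of_hasCompactSupport
        (HasCompactSupport.intro (isCompact_Icc (a := -r - 1) (b := r + 1)) fun x hx => ?_))
        (fun _ => by positivity) hab
      by_contra hx'
      exact hx (Ioc_subset_Icc_self (hs hx'))
    refine continuous_iff_continuousAt.2 fun s => ?_
    rw [ContinuousAt, tendsto_iff_edist_tendsto_0]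
    have h1 : Tendsto (fun t => ENNReal.ofReal (∫ x in (-r - 1)..(r + 1), h s t x)) (𝓝 s) (𝓝 0) := by
      have := ((ENNReal.continuous_ofReal.comp (cJ s)).tendsto s)
      simpa [hh, Function.comp_def] using this
    have h2 : Tendsto (fun t : ℝ≥0 => edist (hmem t).toLp (hmem s).toLp ^ 2) (𝓝 s) (𝓝 0) :=
      tendsto_of_tendsto_of_tendsto_of_le_of_le tendsto_const_nhds h1 (fun _ => zero_le)
        fun t => hb s t
    have h3 := ((ENNReal.continuous_rpow_const (y := 1 / 2)).tendsto 0).comp h2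
    rw [ENNReal.zero_rpow_of_pos (by norm_num)] at h3
    refine h3.congr fun n => ?_
    simp only [Function.comp]
    rw [← ENNReal.rpow_natCast, ← ENNReal.rpow_mul]
    norm_num
  · refine (hmem t).coeFn_toLp.trans (EventuallyEq.of_eq ?_)
    rw [clamp_of_mem (s := (t : ℝ)) ⟨t.coe_nonneg, ht⟩]

/-- Limit of a sequence of curves which is Cauchy locally uniformly in time. -/
theorem exists_limit_curve {E : Type*} [NormedAddCommGroup E] [CompleteSpace E] {c : ℕ → ℝ≥0 → E}
    (hc : ∀ n, Continuous (c n)) {K : ℕ → ℝ}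
    (h : ∀ N n k : ℕ, N ≤ n → N ≤ k → ∀ t : ℝ≥0, (t : ℝ) ≤ N →
      ‖c n t - c k t‖ ≤ K N * ((1 / 2) ^ n + (1 / 2) ^ k)) :
    ∃ u : C(ℝ≥0, E), ∀ N n : ℕ, N ≤ n → ∀ t : ℝ≥0, (t : ℝ) ≤ N → ‖c n t - u t‖ ≤ K N * (1 / 2) ^ n := by
  have hpow : Tendsto (fun n : ℕ => (1 / 2 : ℝ) ^ n) atTop (𝓝 0) :=
    tendsto_pow_atTop_nhds_zero_of_lt_one (by norm_num) (by norm_num)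
  have hcau : ∀ t, CauchySeq fun n => c n t := fun t => by
    obtain ⟨N, hN⟩ := exists_nat_ge (t : ℝ)
    refine Metric.cauchySeq_iff'.2 fun ε hε => ?_
    have : Tendsto (fun n : ℕ => |K N| * (2 * (1 / 2 : ℝ) ^ n)) atTop (𝓝 0) := by
      simpa using (hpow.const_mul 2).const_mul |K N|
    obtain ⟨M, hM, hNM⟩ := ((this.eventually_lt_const hε).and (eventually_ge_atTop N)).exists
    refine ⟨M, fun n hn => ?_⟩
    rw [dist_eq_norm]
    refine (h N n M (hNM.trans hn) hNM t hN).trans_lt (lt_of_le_of_lt ?_ hM)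
    have h1 : (1 / 2 : ℝ) ^ n ≤ (1 / 2) ^ M := pow_le_pow_of_le_one (by norm_num) (by norm_num) hn
    calc K N * ((1 / 2) ^ n + (1 / 2) ^ M) ≤ |K N| * ((1 / 2) ^ n + (1 / 2) ^ M) := by
          gcongr; exact le_abs_self _
      _ ≤ |K N| * (2 * (1 / 2) ^ M) := by gcongr; linarith
  choose u hu using fun t => cauchySeq_tendsto_of_complete (hcau t)
  have hlim : ∀ N n : ℕ, N ≤ n → ∀ t : ℝ≥0, (t : ℝ) ≤ N → ‖c n t - u t‖ ≤ K N * (1 / 2) ^ n := by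
    intro N n hn t ht
    have h1 : Tendsto (fun k => ‖c n t - c k t‖) atTop (𝓝 ‖c n t - u t‖) :=
      (tendsto_const_nhds.sub (hu t)).norm
    have h2 : Tendsto (fun k : ℕ => K N * ((1 / 2 : ℝ) ^ n + (1 / 2) ^ k)) atTop
        (𝓝 (K N * (1 / 2) ^ n)) := by
      simpa using (hpow.const_add ((1 / 2 : ℝ) ^ n)).const_mul (K N)
    refine le_of_tendsto_of_tendsto h1 h2 ?_
    filter_upwards [eventually_ge_atTop N] with k hk
    exact h N n k hn hk t ht
  refine ⟨⟨u, ?_⟩, hlim⟩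
  have hloc : TendstoLocallyUniformly c u atTop := by
    refine Metric.tendstoLocallyUniformly_iff.2 fun ε hε t => ?_
    obtain ⟨N, hN⟩ := exists_nat_gt (t : ℝ)
    refine ⟨{s | (s : ℝ) < N}, (isOpen_lt NNReal.continuous_coe continuous_const).mem_nhds hN, ?_⟩
    have : Tendsto (fun n : ℕ => K N * (1 / 2 : ℝ) ^ n) atTop (𝓝 0) := by
      simpa using hpow.const_mul (K N)
    filter_upwards [this.eventually_lt_const hε, eventually_ge_atTop N] with n h1 h2 s hs
    rw [dist_comm, dist_eq_norm]
    exact (hlim N n h2 s (le_of_lt hs)).trans_lt h1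
  exact hloc.continuous (Eventually.of_forall hc).frequently

theorem IsClassicalSolution.mono {m α β T T' : ℝ} {U V : ℝ → ℝ → ℂ} (hT' : 0 < T') (hle : T' ≤ T)
    (h : IsClassicalSolution m α β T U V) : IsClassicalSolution m α β T' U V := by
  have hsub : Icc 0 T' ⊆ Icc 0 T := Icc_subset_Icc le_rfl hle
  have key : ∀ {F : ℝ → ℝ → ℂ}, ContDiffOn ℝ 1 (fun p : ℝ × ℝ => F p.1 p.2) (strip T) →
      ∀ t ∈ Icc 0 T', ∀ x, derivWithin (fun s => F s x) (Icc 0 T') t =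
        derivWithin (fun s => F s x) (Icc 0 T) t := by
    intro F hF t ht x
    refine derivWithin_subset hsub (uniqueDiffOn_Icc hT' t ht) ?_
    exact ((hF.differentiableOn one_ne_zero).comp (f := fun s : ℝ => (s, x)) (by fun_prop)
      fun s hs => ⟨hs, mem_univ _⟩) t (hsub ht)
  refine ⟨h.1.mono (prod_mono hsub subset_rfl), h.2.mono (prod_mono hsub subset_rfl),
    fun t ht x => ?_, fun t ht x => ?_⟩
  · rw [key h.1 t ht]; exact h.3 t (hsub ht) x
  · rw [key h.2 t ht]; exact h.4 t (hsub ht) x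

/-- Space-time bound of the product of the two components of a classical solution. -/
theorem lintegral_product_le {m α β T L : ℝ} (hT : 0 < T) {U V : ℝ → ℝ → ℂ} (hL0 : 0 ≤ L)
    (h : IsClassicalSolution m α β T U V) (cU : Continuous fun p : ℝ × ℝ => U p.1 p.2)
    (cV : Continuous fun p : ℝ × ℝ => V p.1 p.2)
    (hL : eLpNorm (U 0) 2 volume ^ 2 + eLpNorm (V 0) 2 volume ^ 2 ≤ ENNReal.ofReal L) :
    ∫⁻ t in Icc 0 T, ∫⁻ x, ‖U t x‖ₑ ^ 2 * ‖V t x‖ₑ ^ 2 ≤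
      ENNReal.ofReal (Real.exp (T + 4 * |β| * L)) *
        (ENNReal.ofReal L * ENNReal.ofReal L +
          ENNReal.ofReal (m ^ 2 * L) * (ENNReal.ofReal L * ENNReal.ofReal T)) := by
  have s := h.isDampedSolution
  have h0 : (0 : ℝ) ∈ Icc 0 T := left_mem_Icc.2 hT.le
  have hLab := intervalIntegral_sq_le (h.continuous_slices h0).1 (h.continuous_slices h0).2 hL0 hL
  set K := Real.exp (T + 4 * |β| * L)
  have cU0 : Continuous (U 0) := cU.comp (f := fun x : ℝ => ((0 : ℝ), x)) (by fun_prop)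
  have cVl : Continuous fun p : ℝ × ℝ => V p.1 (p.2 + p.1) :=
    cV.comp (f := fun p : ℝ × ℝ => (p.1, p.2 + p.1)) (by fun_prop)
  set a : ℝ → ℝ≥0∞ := fun y => ENNReal.ofReal K * (‖U 0 y‖ₑ ^ 2 + ENNReal.ofReal (m ^ 2 * L)) with ha
  have ma : Measurable a := by fun_prop
  have hpt : ∀ t ∈ Icc 0 T, ∀ x, ‖U t x‖ₑ ^ 2 ≤ a (x - t) := fun t ht x => by
    have := ENNReal.ofReal_le_ofReal (s.norm_sq_fst_le hLab ht x)
    rw [ENNReal.ofReal_mul (Real.exp_pos _).le, ENNReal.ofReal_add (by positivity) (by positivity),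
      ofReal_sq_norm, ofReal_sq_norm] at this
    exact this
  have hcharge : ∀ t ∈ Icc 0 T, ∫⁻ y, ‖V t y‖ₑ ^ 2 ≤ ENNReal.ofReal L := fun t ht => by
    have := lintegral_le_of_forall_intervalIntegral_le
      (h := fun y => ‖U t y‖ ^ 2 + ‖V t y‖ ^ 2)
      (((h.continuous_slices ht).1.norm.pow 2).add ((h.continuous_slices ht).2.norm.pow 2))
      (fun _ => by positivity) (s.flux_snd_le hLab ht).1
    rw [lintegral_sq_add_sq (h.continuous_slices ht).1] at this
    rw [← sq_eLpNorm_two]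
    exact le_add_self.trans this
  have hflux : ∀ y, ∫⁻ t in Icc 0 T, ‖V t (y + t)‖ₑ ^ 2 ≤ ENNReal.ofReal L := fun y => by
    have c1 : Continuous fun t => ‖V t (y + t)‖ ^ 2 :=
      (cV.comp (f := fun t : ℝ => (t, y + t)) (by fun_prop)).norm.pow 2
    have := (s.flux_snd_le hLab (right_mem_Icc.2 hT.le)).2 y
    rw [intervalIntegral.integral_of_le hT.le] at this
    rw [← Measure.restrict_congr_set Ioc_ae_eq_Icc]
    simp only [← ofReal_sq_norm]
    rw [← ofReal_integral_eq_lintegral_ofReal (c1.integrableOn_Icc.mono_set Ioc_subset_Icc_self)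
      (ae_of_all _ fun _ => by positivity)]
    exact ENNReal.ofReal_le_ofReal this
  -- After the shift y = x - t the majorant of |U|² no longer depends on t. In its |u₀|² part the
  -- time integral is done first and is the flux of |V|²; the constant part uses the charge at each
  -- time and costs a factor T.
  calc ∫⁻ t in Icc 0 T, ∫⁻ x, ‖U t x‖ₑ ^ 2 * ‖V t x‖ₑ ^ 2
      ≤ ∫⁻ t in Icc 0 T, ∫⁻ y, a y * ‖V t (y + t)‖ₑ ^ 2 := by
        refine setLIntegral_mono' measurableSet_Icc fun t ht => ?_
        rw [← lintegral_sub_right_eq_self (fun y => a y * ‖V t (y + t)‖ₑ ^ 2) t]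
        refine lintegral_mono fun x => ?_
        simp only [sub_add_cancel]
        exact mul_le_mul_left (hpt t ht x) _
    _ = ∫⁻ t in Icc 0 T, ∫⁻ y, (ENNReal.ofReal K * (‖U 0 y‖ₑ ^ 2 * ‖V t (y + t)‖ₑ ^ 2) +
          ENNReal.ofReal K * (ENNReal.ofReal (m ^ 2 * L) * ‖V t (y + t)‖ₑ ^ 2)) := by
        refine lintegral_congr fun t => lintegral_congr fun y => ?_
        simp only [ha]
        ring
    _ = (∫⁻ t in Icc 0 T, ∫⁻ y, ENNReal.ofReal K * (‖U 0 y‖ₑ ^ 2 * ‖V t (y + t)‖ₑ ^ 2)) +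
          ∫⁻ t in Icc 0 T, ∫⁻ y,
            ENNReal.ofReal K * (ENNReal.ofReal (m ^ 2 * L) * ‖V t (y + t)‖ₑ ^ 2) := by
        have m1 : Measurable fun p : ℝ × ℝ => ENNReal.ofReal K * (‖U 0 p.2‖ₑ ^ 2 * ‖V p.1 (p.2 + p.1)‖ₑ ^ 2) :=
          (((cU0.measurable.comp measurable_snd).enorm.pow_const 2).mul
            (cVl.measurable.enorm.pow_const 2)).const_mul _
        rw [← lintegral_add_left m1.lintegral_prod_right']
        refine lintegral_congr fun t => ?_
        exact lintegral_add_left (m1.comp (measurable_const.prodMk measurable_id)) _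
    _ ≤ ENNReal.ofReal K * (ENNReal.ofReal L * ENNReal.ofReal L) +
          ENNReal.ofReal K * (ENNReal.ofReal (m ^ 2 * L) * (ENNReal.ofReal L * ENNReal.ofReal T)) := by
        refine add_le_add ?_ ?_
        · have m1 : Measurable fun p : ℝ × ℝ => ENNReal.ofReal K * (‖U 0 p.2‖ₑ ^ 2 * ‖V p.1 (p.2 + p.1)‖ₑ ^ 2) :=
            (((cU0.measurable.comp measurable_snd).enorm.pow_const 2).mul
              (cVl.measurable.enorm.pow_const 2)).const_mul _
          rw [lintegral_lintegral_swap (f := fun t y =>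
            ENNReal.ofReal K * (‖U 0 y‖ₑ ^ 2 * ‖V t (y + t)‖ₑ ^ 2)) m1.aemeasurable]
          have e1 : ∀ y, ∫⁻ t in Icc 0 T, ENNReal.ofReal K * (‖U 0 y‖ₑ ^ 2 * ‖V t (y + t)‖ₑ ^ 2) ≤
              ENNReal.ofReal K * (‖U 0 y‖ₑ ^ 2 * ENNReal.ofReal L) := fun y => by
            rw [lintegral_const_mul' _ _ ENNReal.ofReal_ne_top,
              lintegral_const_mul' _ _ (by finiteness)]
            gcongr
            exact hflux y
          refine (lintegral_mono e1).trans ?_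
          rw [lintegral_const_mul' _ _ ENNReal.ofReal_ne_top,
            lintegral_mul_const' _ _ ENNReal.ofReal_ne_top]
          gcongr
          rw [← sq_eLpNorm_two]
          exact le_self_add.trans hL
        · have e2 : ∀ t ∈ Icc 0 T, ∫⁻ y,
              ENNReal.ofReal K * (ENNReal.ofReal (m ^ 2 * L) * ‖V t (y + t)‖ₑ ^ 2) ≤
              ENNReal.ofReal K * (ENNReal.ofReal (m ^ 2 * L) * ENNReal.ofReal L) := fun t ht => by
            rw [lintegral_const_mul' _ _ ENNReal.ofReal_ne_top,
              lintegral_const_mul' _ _ ENNReal.ofReal_ne_top,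
              lintegral_add_right_eq_self (fun y => ‖V t y‖ₑ ^ 2) t]
            gcongr
            exact hcharge t ht
          refine (setLIntegral_mono' measurableSet_Icc e2).trans (le_of_eq ?_)
          rw [setLIntegral_const, Real.volume_Icc, sub_zero]
          ring
    _ = _ := by ring

theorem enorm_le_ofReal_iff {E : Type*} [NormedAddCommGroup E] {x : E} {a : ℝ} (ha : 0 ≤ a) :
    ‖x‖ₑ ≤ ENNReal.ofReal a ↔ ‖x‖ ≤ a := by
  rw [← ofReal_norm, ENNReal.ofReal_le_ofReal_iff ha]

/-- A sequence of space-time functions, Cauchy in `L²` locally uniformly in time, converges to a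
continuous curve with a jointly measurable version. -/
theorem exists_limit_version {U : ℕ → ℝ → ℝ → ℂ} {r : ℕ → ℝ} {K : ℕ → ℝ} (hK : ∀ N, 0 ≤ K N)
    (hU : ∀ n, Continuous fun p : ℝ × ℝ => U n p.1 p.2)
    (hr : ∀ n : ℕ, ∀ t ∈ Icc (0 : ℝ) (n + 1), ∀ x, r n < |x| → U n t x = 0)
    (hcau : ∀ N n k : ℕ, N ≤ n → N ≤ k → ∀ t : ℝ≥0, (t : ℝ) ≤ N →
      eLpNorm (fun x => U n t x - U k t x) 2 volume ≤
        ENNReal.ofReal (K N * ((1 / 2) ^ n + (1 / 2) ^ k))) :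
    ∃ (u : C(ℝ≥0, L2)) (f : ℝ × ℝ → ℂ), IsVersion u f ∧
      (∀ N n : ℕ, N ≤ n → ∀ t : ℝ≥0, (t : ℝ) ≤ N →
        eLpNorm (fun x => U n t x - u t x) 2 volume ≤ ENNReal.ofReal (K N * (1 / 2) ^ n)) ∧
      (∀ t : ℝ≥0, ∀ᵐ x, Tendsto (fun n => U n t x) atTop (𝓝 (f (t, x)))) ∧
      ∀ (T : ℝ) (N : ℕ), T ≤ N → Tendsto (fun n => eLpNorm (fun p : ℝ × ℝ => U (n + N) p.1 p.2 - f p) 2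
        (volume.restrict (strip T))) atTop (𝓝 0) := by
  choose c hc hcU using fun n : ℕ => exists_continuous_curve (T := n + 1) (by positivity) (hU n) (hr n)
  have hslice : ∀ n t, Continuous (U n t) := fun n t =>
    (hU n).comp (f := fun x : ℝ => (t, x)) (by fun_prop)
  obtain ⟨u, hu⟩ := exists_limit_curve hc (K := K) fun N n k hn hk t ht => by
    have ht' : ∀ {k : ℕ}, N ≤ k → (t : ℝ) ≤ k + 1 := fun {k} hk => by
      have : (N : ℝ) ≤ k := by exact_mod_cast hk
      linarith
    have hKN := hK N
    rw [← enorm_le_ofReal_iff (by positivity), Lp.enorm_def]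
    refine le_trans (le_of_eq (eLpNorm_congr_ae ?_)) (hcau N n k hn hk t ht)
    filter_upwards [Lp.coeFn_sub (c n t) (c k t), hcU n t (ht' hn), hcU k t (ht' hk)] with x h1 h2 h3
    rw [h1, Pi.sub_apply, h2, h3]
  have hu' : ∀ N n : ℕ, N ≤ n → ∀ t : ℝ≥0, (t : ℝ) ≤ N →
      eLpNorm (fun x => U n t x - u t x) 2 volume ≤ ENNReal.ofReal (K N * (1 / 2) ^ n) := by
    intro N n hn t ht
    have hKN := hK N
    have h1 := (enorm_le_ofReal_iff (by positivity)).2 (hu N n hn t ht)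
    rw [Lp.enorm_def] at h1
    refine le_trans (le_of_eq (eLpNorm_congr_ae ?_)) h1
    have : (t : ℝ) ≤ n + 1 := by
      have : (N : ℝ) ≤ n := by exact_mod_cast hn
      linarith
    filter_upwards [Lp.coeFn_sub (c n t) (u t), hcU n t this] with x h1 h2
    rw [h1, Pi.sub_apply, h2]
  -- A pointwise limit is jointly measurable, which a choice of representatives of u(t) for each t
  -- would not guarantee.
  set f : ℝ × ℝ → ℂ := fun p => limUnder atTop fun n => U n p.1 p.2 with hf
  have mf : StronglyMeasurable f := StronglyMeasurable.limUnder fun n => (hU n).stronglyMeasurable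
  have hlim : ∀ t : ℝ≥0, ∀ᵐ x, Tendsto (fun n => U n t x) atTop (𝓝 (u t x)) := by
    intro t
    obtain ⟨N, hN⟩ := exists_nat_ge (t : ℝ)
    -- The estimate at times up to N holds only for indices at least N, hence the shift.
    have := tendsto_ae_of_eLpNorm_geometric (g := fun n => U (n + N) t) (G := u t) (C := K N)
      (fun n => (hslice _ _).measurable) (Lp.aestronglyMeasurable _).aemeasurable (hK N) fun n => by
        refine (hu' N (n + N) (by omega) t hN).trans (ENNReal.ofReal_le_ofReal ?_)
        have := hK N
        gcongr ?_ * ?_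
        exact pow_le_pow_of_le_one (by norm_num) (by norm_num) (by omega)
    filter_upwards [this] with x hx
    exact (tendsto_add_atTop_iff_nat (f := fun n => U n t x) N).1 hx
  have hfu : ∀ t : ℝ≥0, (fun x => f (t, x)) =ᵐ[volume] u t := fun t => by
    filter_upwards [hlim t] with x hx
    exact hx.limUnder_eq
  refine ⟨u, f, ⟨mf.aestronglyMeasurable, ae_of_all _ fun t ht => hfu ⟨t, ht⟩⟩, hu', fun t => ?_,
    fun T N hTN => ?_⟩
  · filter_upwards [hlim t, hfu t] with x h1 h2
    rwa [h2]
  · have h0 : Tendsto (fun n : ℕ => (1 + ENNReal.ofReal T) * ENNReal.ofReal (K N * (1 / 2) ^ (n + N)))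
        atTop (𝓝 0) := by
      have h1 : Tendsto (fun n : ℕ => K N * (1 / 2 : ℝ) ^ (n + N)) atTop (𝓝 0) := by
        have := ((tendsto_pow_atTop_nhds_zero_of_lt_one (r := (1 / 2 : ℝ)) (by norm_num)
          (by norm_num)).comp (tendsto_add_atTop_nat N)).const_mul (K N)
        simpa using this
      have h2 := (ENNReal.continuous_ofReal.tendsto 0).comp h1
      rw [ENNReal.ofReal_zero] at h2
      have h3 := ENNReal.Tendsto.const_mul (a := 1 + ENNReal.ofReal T) h2
        (Or.inr (ENNReal.add_ne_top.2 ⟨ENNReal.one_ne_top, ENNReal.ofReal_ne_top⟩))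
      simpa using h3
    refine tendsto_of_tendsto_of_tendsto_of_le_of_le tendsto_const_nhds h0 (fun _ => zero_le)
      fun n => ?_
    refine eLpNorm_strip_le ((hU _).aestronglyMeasurable.sub mf.aestronglyMeasurable)
      fun t ht => ?_
    refine le_trans (le_of_eq (eLpNorm_congr_ae ?_))
      (hu' N (n + N) (by omega) ⟨t, ht.1⟩ (ht.2.trans hTN))
    filter_upwards [hfu ⟨t, ht.1⟩] with x hx
    exact congrArg (fun z => U (n + N) t x - z) hx

/-- Fatou's lemma for `|f|² |g|²` on the strip. -/
theorem lintegral_strip_mul_le_of_tendsto {T : ℝ} {B : ℝ≥0∞} {f g : ℝ × ℝ → ℂ}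
    {U V : ℕ → ℝ → ℝ → ℂ} (mf : AEStronglyMeasurable f (volume.restrict (strip T)))
    (mg : AEStronglyMeasurable g (volume.restrict (strip T)))
    (cU : ∀ n, Continuous fun p : ℝ × ℝ => U n p.1 p.2)
    (cV : ∀ n, Continuous fun p : ℝ × ℝ => V n p.1 p.2)
    (hlim : ∀ t ∈ Icc 0 T, ∀ᵐ x, Tendsto (fun n => U n t x) atTop (𝓝 (f (t, x))) ∧
      Tendsto (fun n => V n t x) atTop (𝓝 (g (t, x))))
    (hB : ∀ n, ∫⁻ t in Icc 0 T, ∫⁻ x, ‖U n t x‖ₑ ^ 2 * ‖V n t x‖ₑ ^ 2 ≤ B) :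
    ∫⁻ p in strip T, ‖f p‖ₑ ^ 2 * ‖g p‖ₑ ^ 2 ≤ B := by
  have hm : ∀ n, Measurable fun p : ℝ × ℝ => ‖U n p.1 p.2‖ₑ ^ 2 * ‖V n p.1 p.2‖ₑ ^ 2 :=
    fun n => ((cU n).measurable.enorm.pow_const 2).mul ((cV n).measurable.enorm.pow_const 2)
  have hmt : ∀ (t : ℝ) n, Measurable fun x : ℝ => ‖U n t x‖ₑ ^ 2 * ‖V n t x‖ₑ ^ 2 :=
    fun t n => by
      have c : Continuous fun x : ℝ => (t, x) := by fun_prop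
      have c1 : Continuous fun x : ℝ => U n t x := (cU n).comp c
      have c2 : Continuous fun x : ℝ => V n t x := (cV n).comp c
      exact (c1.measurable.enorm.pow_const 2).mul (c2.measurable.enorm.pow_const 2)
  have hfatou : ∀ t ∈ Icc 0 T, ∫⁻ x, ‖f (t, x)‖ₑ ^ 2 * ‖g (t, x)‖ₑ ^ 2 ≤
      liminf (fun n => ∫⁻ x, ‖U n t x‖ₑ ^ 2 * ‖V n t x‖ₑ ^ 2) atTop := by
    intro t ht
    refine le_trans (le_of_eq (lintegral_congr_ae ?_)) (lintegral_liminf_le (hmt t))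
    filter_upwards [hlim t ht] with x hx
    have e1 := ENNReal.Tendsto.pow (n := 2) hx.1.enorm
    have e2 := ENNReal.Tendsto.pow (n := 2) hx.2.enorm
    exact (ENNReal.Tendsto.mul e1 (Or.inr (by finiteness)) e2
      (Or.inr (by finiteness))).liminf_eq.symm
  rw [volume_restrict_strip] at mf mg ⊢
  rw [lintegral_prod (fun p => ‖f p‖ₑ ^ 2 * ‖g p‖ₑ ^ 2)
    ((mf.enorm.pow_const 2).mul (mg.enorm.pow_const 2))]
  -- Fatou is used a second time, now in t; convergence is known for each t and almost every x.
  refine (setLIntegral_mono' measurableSet_Icc hfatou).trans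
    ((lintegral_liminf_le fun n => (hm n).lintegral_prod_right').trans ?_)
  exact (liminf_le_liminf (Eventually.of_forall hB)).trans (le_of_eq (liminf_const B))

theorem exists_globalStrongSolution (m α β : ℝ) (u₀ v₀ : L2) :
    ∃ u v : C(ℝ≥0, L2), IsGlobalStrongSolution m α β u₀ v₀ u v ∧ u 0 = u₀ ∧ v 0 = v₀ ∧
      ∀ T : ℝ, 0 < T → ProductMemL2 T u v := by
  obtain ⟨gu, hgu⟩ := exists_smooth_approx u₀
  obtain ⟨gv, hgv⟩ := exists_smooth_approx v₀
  -- The n-th solution lives on [0, n+1], so every bounded time interval is covered by all but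
  -- finitely many of them.
  choose U V hcl cU cV U0 V0 r hr using fun n : ℕ => exists_classicalSolution m α β
    (T := n + 1) (by positivity) (hgu n).1 (hgv n).1 (hgu n).2.1 (hgv n).2.1
  have dU : ∀ n, eLpNorm (fun x => U n 0 x - u₀ x) 2 volume ≤ ENNReal.ofReal ((1 / 2) ^ n) :=
    fun n => by rw [U0]; exact (hgu n).2.2
  have dV : ∀ n, eLpNorm (fun x => V n 0 x - v₀ x) 2 volume ≤ ENNReal.ofReal ((1 / 2) ^ n) :=
    fun n => by rw [V0]; exact (hgv n).2.2
  have hle1 : ∀ n : ℕ, ENNReal.ofReal ((1 / 2) ^ n) ≤ 1 := fun n =>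
    ENNReal.ofReal_le_one.2 (pow_le_one₀ (by norm_num) (by norm_num))
  have hcl' : ∀ {T : ℝ} {n : ℕ}, 0 < T → T ≤ n + 1 → IsClassicalSolution m α β T (U n) (V n) :=
    fun hT hn => (hcl _).mono hT hn
  set L := chargeBound u₀ v₀ with hL
  have hL0 : 0 ≤ L := chargeBound_nonneg u₀ v₀
  -- The factor 2 counts the errors of the two components of the data.
  set K : ℕ → ℝ := fun N => 2 * stabilityConst m α β (N + 1) L with hK
  have hC0 : ∀ N : ℕ, 0 ≤ stabilityConst m α β (N + 1) L := fun N =>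
    zero_le_one.trans (stabilityConst_ge_one (by positivity) hL0)
  have hK0 : ∀ N, 0 ≤ K N := fun N => mul_nonneg zero_le_two (hC0 N)
  have hcau : ∀ N n k : ℕ, N ≤ n → N ≤ k → ∀ t : ℝ≥0, (t : ℝ) ≤ N →
      eLpNorm (fun x => U n t x - U k t x) 2 volume ≤
        ENNReal.ofReal (K N * ((1 / 2) ^ n + (1 / 2) ^ k)) ∧
      eLpNorm (fun x => V n t x - V k t x) 2 volume ≤
        ENNReal.ofReal (K N * ((1 / 2) ^ n + (1 / 2) ^ k)) := by
    intro N n k hn hk t ht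
    have hn' : (N : ℝ) + 1 ≤ n + 1 := by exact_mod_cast Nat.succ_le_succ hn
    have hk' : (N : ℝ) + 1 ≤ k + 1 := by exact_mod_cast Nat.succ_le_succ hk
    have key := eLpNorm_strip_sub_le (T := N + 1) (by positivity) (hcl' (by positivity) hn')
      (hcl' (by positivity) hk') ((dU n).trans (hle1 n)) ((dV n).trans (hle1 n))
      ((dU k).trans (hle1 k)) ((dV k).trans (hle1 k)) t ⟨t.coe_nonneg, by linarith⟩
    have e : ENNReal.ofReal (stabilityConst m α β (N + 1) L) *
        ((eLpNorm (fun x => U n 0 x - u₀ x) 2 volume + eLpNorm (fun x => U k 0 x - u₀ x) 2 volume) +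
        (eLpNorm (fun x => V n 0 x - v₀ x) 2 volume + eLpNorm (fun x => V k 0 x - v₀ x) 2 volume)) ≤
        ENNReal.ofReal (K N * ((1 / 2) ^ n + (1 / 2) ^ k)) := by
      have h1 := mul_le_mul_right (add_le_add (add_le_add (dU n) (dU k)) (add_le_add (dV n) (dV k)))
        (ENNReal.ofReal (stabilityConst m α β (N + 1) L))
      refine h1.trans (le_of_eq ?_)
      rw [← ENNReal.ofReal_add (by positivity) (by positivity),
        ← ENNReal.ofReal_add (by positivity) (by positivity), ← ENNReal.ofReal_mul (hC0 N)]
      congr 1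
      simp only [hK]
      ring
    exact ⟨key.1.trans e, key.2.trans e⟩
  obtain ⟨u, f, hf, hu, hUf, hUT⟩ := exists_limit_version hK0 cU
    (fun n t ht x hx => (hr n t ht x hx).1) fun N n k hn hk t ht => (hcau N n k hn hk t ht).1
  obtain ⟨v, g, hg, hv, hVg, hVT⟩ := exists_limit_version hK0 cV
    (fun n t ht x hx => (hr n t ht x hx).2) fun N n k hn hk t ht => (hcau N n k hn hk t ht).2
  have hpow : ∀ C : ℝ, Tendsto (fun n : ℕ => ENNReal.ofReal (C * (1 / 2) ^ n)) atTop (𝓝 0) := fun C => by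
    have h1 : Tendsto (fun n : ℕ => C * (1 / 2 : ℝ) ^ n) atTop (𝓝 0) := by
      simpa using (tendsto_pow_atTop_nhds_zero_of_lt_one (r := (1 / 2 : ℝ)) (by norm_num)
        (by norm_num)).const_mul C
    simpa [Function.comp_def] using (ENNReal.continuous_ofReal.tendsto 0).comp h1
  have hpow1 : Tendsto (fun n : ℕ => ENNReal.ofReal ((1 / 2) ^ n)) atTop (𝓝 0) := by
    simpa using hpow 1
  have tU0 : Tendsto (fun n => eLpNorm (fun x => U n 0 x - u₀ x) 2 volume) atTop (𝓝 0) :=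
    tendsto_of_tendsto_of_tendsto_of_le_of_le tendsto_const_nhds hpow1 (fun _ => zero_le) dU
  have tV0 : Tendsto (fun n => eLpNorm (fun x => V n 0 x - v₀ x) 2 volume) atTop (𝓝 0) :=
    tendsto_of_tendsto_of_tendsto_of_le_of_le tendsto_const_nhds hpow1 (fun _ => zero_le) dV
  have init : ∀ {Z : ℕ → ℝ → ℝ → ℂ} {w₀ w : L2}, (∀ n, Continuous (Z n 0)) →
      Tendsto (fun n => eLpNorm (fun x => Z n 0 x - w₀ x) 2 volume) atTop (𝓝 0) →
      Tendsto (fun n => eLpNorm (fun x => Z n 0 x - w x) 2 volume) atTop (𝓝 0) → w = w₀ := by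
    intro Z w₀ w hZ h1 h2
    refine Lp.ext (ae_eq_of_tendsto_eLpNorm (Lp.aestronglyMeasurable _) (Lp.aestronglyMeasurable _)
      (fun n => (hZ n).aestronglyMeasurable) (fun n => (hZ n).aestronglyMeasurable) h2 h1 ?_)
    simp
  have cU0 : ∀ n t, Continuous (U n t) := fun n t =>
    (cU n).comp (f := fun x : ℝ => (t, x)) (by fun_prop)
  have cV0 : ∀ n t, Continuous (V n t) := fun n t =>
    (cV n).comp (f := fun x : ℝ => (t, x)) (by fun_prop)
  refine ⟨u, v, fun T hT => ?_, ?_, ?_, fun T hT => ⟨f, g, hf, hg, ?_⟩⟩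
  · obtain ⟨N, hN⟩ := exists_nat_ge T
    exact ⟨f, g, hf, hg, fun n => U (n + N), fun n => V (n + N), fun n => hcl' hT (by
        push_cast; linarith [(n.cast_nonneg : (0 : ℝ) ≤ n)]), hUT T N hN, hVT T N hN,
      tU0.comp (tendsto_add_atTop_nat N), tV0.comp (tendsto_add_atTop_nat N)⟩
  · exact init (fun n => cU0 n 0) tU0 (tendsto_of_tendsto_of_tendsto_of_le_of_le tendsto_const_nhds
      (hpow (K 0)) (fun _ => zero_le) fun n => hu 0 n (Nat.zero_le n) 0 (by simp))
  · exact init (fun n => cV0 n 0) tV0 (tendsto_of_tendsto_of_tendsto_of_le_of_le tendsto_const_nhds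
      (hpow (K 0)) (fun _ => zero_le) fun n => hv 0 n (Nat.zero_le n) 0 (by simp))
  · have mf := hf.aestronglyMeasurable_strip T
    have mg := hg.aestronglyMeasurable_strip T
    obtain ⟨N, hN⟩ := exists_nat_ge T
    obtain ⟨B, hBtop, hB⟩ : ∃ B : ℝ≥0∞, B ≠ ⊤ ∧ ∀ n,
        ∫⁻ t in Icc 0 T, ∫⁻ x, ‖U (n + N) t x‖ₑ ^ 2 * ‖V (n + N) t x‖ₑ ^ 2 ≤ B := by
      refine ⟨_, ?_, fun n => lintegral_product_le hT hL0 (hcl' hT (by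
        push_cast; linarith [(n.cast_nonneg : (0 : ℝ) ≤ n)])) (cU _) (cV _)
        (charge_le_chargeBound (cU0 _ _) (cV0 _ _) ((dU _).trans (hle1 _)) ((dV _).trans (hle1 _)))⟩
      finiteness
    have hprod : ∫⁻ p in strip T, ‖f p‖ₑ ^ 2 * ‖g p‖ₑ ^ 2 ≤ B := by
      refine lintegral_strip_mul_le_of_tendsto mf mg (fun n => cU (n + N)) (fun n => cV (n + N))
        (fun t ht => ?_) hB
      filter_upwards [hUf ⟨t, ht.1⟩, hVg ⟨t, ht.1⟩] with x h1 h2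
      exact ⟨(tendsto_add_atTop_iff_nat (f := fun n => U n t x) N).2 h1,
        (tendsto_add_atTop_iff_nat (f := fun n => V n t x) N).2 h2⟩
    refine ⟨mf.norm.mul mg.norm, ?_⟩
    have h2 : eLpNorm (fun p => ‖f p‖ * ‖g p‖) 2 (volume.restrict (strip T)) ^ 2 ≤ B := by
      have e := eLpNorm_nnreal_pow_eq_lintegral (f := fun p => ‖f p‖ * ‖g p‖)
        (μ := volume.restrict (strip T)) (p := 2) two_ne_zero
      have e' : eLpNorm (fun p => ‖f p‖ * ‖g p‖) 2 (volume.restrict (strip T)) ^ 2 =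
          ∫⁻ p in strip T, ‖f p‖ₑ ^ 2 * ‖g p‖ₑ ^ 2 := by
        simpa [enorm_mul, mul_pow] using e
      rwa [e']
    by_contra hcon
    rw [not_lt_top_iff] at hcon
    rw [hcon] at h2
    exact hBtop (top_le_iff.1 (by simpa using h2))

end Dirac

theorem theorem1p1 (m α β : ℝ) (hm : 0 ≤ m) (u₀ v₀ : Dirac.L2) :
    ∃ u v : C(ℝ≥0, Dirac.L2),
      Dirac.IsGlobalStrongSolution m α β u₀ v₀ u v ∧
      u 0 = u₀ ∧ v 0 = v₀ ∧
      (∀ T : ℝ, 0 < T → Dirac.ProductMemL2 T u v) ∧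
      ∀ u' v' : C(ℝ≥0, Dirac.L2),
        Dirac.IsGlobalStrongSolution m α β u₀ v₀ u' v' → u' = u ∧ v' = v := by
  obtain ⟨u, v, h, hu, hv, hp⟩ := Dirac.exists_globalStrongSolution m α β u₀ v₀
  refine ⟨u, v, h, hu, hv, hp, fun u' v' h' => ?_⟩
  -- The strip up to t + 1 contains time t and has positive height even for t = 0.
  have key : ∀ t : ℝ≥0, u' t = u t ∧ v' t = v t := fun t =>
    (h' (t + 1) (by positivity)).unique (by positivity) (h (t + 1) (by positivity)) (by simp)
  exact ⟨ContinuousMap.ext fun t => (key t).1, ContinuousMap.ext fun t => (key t).2⟩
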